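/- **Setting.** Let $(Z_i,D_i,Y_i)$, $i=1,2,\dots$, be i.i.d., where $Z_i$ takes values in $[\underline z,\overline z]$ with $-\infty<\underline z<\overline z<\infty$, $D_i\in\{0,1\}$, and $|Y_i|\le B$ for a constant $B$. For $h>0$ put $\mathcal A_h=[\underline z,\underline z+h]$, $\mathcal B_h=[\overline z-h,\overline z]$ and $$\theta(h)=\frac{E(Y_i\mid Z_i\in\mathcal A_h)-E(Y_i\mid Z_i\in\mathcal B_h)}{P(D_i=1\mid Z_i\in\mathcal A_h)-P(D_i=1\mid Z_i\in\mathcal B_h)} ,$$ and let $\hat\theta(h)$ be its sample analogue based on $n$ observations (conditional means and probabilities replaced by averages over the observations with $Z_i\in\mathcal A_h$, respectively $Z_i\in\mathcal B_h$). Let $\hat\sigma^2(h)/h$ be the heteroskedasticity-robust (sandwich) variance estimate for $\sqrt n(\hat\beta-\beta)$ in the instrumental variables regression $Y_i=\alpha+D_i\beta+\varepsilon_i$ on the observations with $Z_i\in\mathcal A_h\cup\mathcal B_h$, with a constant and $I(Z_i\ge\overline z-h)$ as instruments. Let $X_i$ be the signed distance of $Z_i$ to the nearest endpoint ($X_i=Z_i-\underline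 z$ if $Z_i\le(\underline z+\overline z)/2$ and $X_i=Z_i-\overline z$ otherwise), let $W_i=(Z_i,D_i,Y_i)$, and let $k(u)=I(|u|\le1)$. **Theorem.** Suppose that (i) on the points within a distance $\delta>0$ of the endpoints, $Z_i$ has a density $f_Z$ with $f_Z(\underline z)>0$ and $f_Z(\overline z)>0$, and, for some function $\ell$ with $\ell(t)\log\log t^{-1}\to0$ as $t\downarrow0$, the functions $f_Z(z)$, $E(Y_i\mid Z_i=z)$, $E(D_i\mid Z_i=z)$ and $\mathrm{var}((D_i,Y_i)'\mid Z_i=z)$ are continuous at $\underline z$ (from the right) and at $\overline z$ (from the left) with local modulus of continuity $\ell$, i.e. $|g(z)-g(\underline z)|\le\ell(|z-\underline z|)$ for $z>\underline z$ close to $\underline z$, and similarly at $\overline z$; (ii) $P(D_i=1\mid Z_i=\overline z)-P(D_i=1\mid Z_i=\underline z)\ne0$, and for some $d\in\{0,1\}$ and some $z\in\{\underline z,\overline z\}$, $P(D_i=d\mid Z_i=z)>0$ and $\mathrm{var}(Y_i\mid D_i=d,Z_i=z)\ne0$. Conditional moments given $Z_i=z$ are those of a regular conditional law of $(D_i,Y_i)$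 given $Z_i=z$, supported in $\{0,1\}\times[-B,B]$. Then there are $\eta>0$ and a function $\psi(w,h)$ such that, for all sequences $0<\underline h_n\le\overline h_n\le\eta$ with $n\underline h_n/(\log\log\underline h_n^{-1})^3\to\infty$, the following two conditions hold. *Influence function representation.* $E\,\psi(W_i,h)k(X_i/h)=0$ and $\frac1h\mathrm{var}(\psi(W_i,h)k(X_i/h))=1$ for every bandwidth $h$, i.e. every $h>0$ with $h\le\overline h_n$ for some $n$; uniformly over $h\in[\underline h_n,\overline h_n]$, $$\frac{\sqrt{nh}\,(\hat\theta(h)-\theta(h))}{\hat\sigma(h)}=\frac1{\sqrt{nh}}\sum_{i=1}^n\psi(W_i,h)k(X_i/h)+o_P\!\left(\frac1{\sqrt{\max\{1,\log\log(\overline h_n/\underline h_n)\}}}\right),$$ where the maximum is read as $1$ if $\overline h_n=\underline h_n$; and the classes $\{w\mapsto\psi(w,h)\}$ (over $h=0$ and all bandwidths) and $\{x\mapsto k(x/h)\}$ (over all bandwidths) consist of measurable functions and have polynomial uniform covering numbers: for some $C,V>0$, $\sup_QN(\varepsilon,\mathcal F,L_2(Q))\le C\varepsilon^{-V}$ for all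 $0<\varepsilon\le1$, the supremum being over all probability measures $Q$. *Regularity.* The kernel $k$ is symmetric with finite support $[-A,A]$ ($A=1$), bounded with a bounded, uniformly continuous first derivative on $(0,A)$, and $\int k\ne0$. On $[0,\delta)$, $|X_i|$ has a density $f_{|X|}$ with $f_{|X|}(0)>0$; $\psi(W_i,h)k(X_i/h)$ is almost surely bounded uniformly over all bandwidths $h$; $\mathrm{var}[\psi(W_i,0)\mid|X_i|=0]>0$; and, for some function $\tilde\ell$ with $\tilde\ell(t)\log\log t^{-1}\to0$ as $t\downarrow0$ and suitable versions of the density and of the conditional moments, the expressions $|f_{|X|}(t)-f_{|X|}(0)|$ (for $0<t<\delta$), $|E[\psi(W_i,0)\mid|X_i|=t]-E[\psi(W_i,0)\mid|X_i|=0]|$, $|\mathrm{var}[\psi(W_i,0)\mid|X_i|=t]-\mathrm{var}[\psi(W_i,0)\mid|X_i|=0]|$ (for $t>0$) and, almost surely, $|(\psi(W_i,t)-\psi(W_i,0))k(X_i/t)|$ (for every bandwidth $t$) are bounded by $\tilde\ell(t)$. -/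

import Mathlib

open MeasureTheory ProbabilityTheory Filter Topology

namespace BandwidthSnooping

noncomputable section

/-! ### Continuity with a local modulus, uniform covering numbers -/

/-- The modulus `ℓ` satisfies `ℓ(t) log log t⁻¹ → 0` as `t ↓ 0`. -/
def LogLogModulus (ℓ : ℝ → ℝ) : Prop :=
  Tendsto (fun t => ℓ t * Real.log (Real.log t⁻¹)) (𝓝[>] 0) (𝓝 0)

/-- `g`, a function on the interval `[zl, zh]`, is continuous at both endpoints with local modulus
of continuity `ℓ`: `|g z - g zl| ≤ ℓ |z - zl|` for `z` in the interval close enough to `zl`, and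
similarly at `zh`. -/
def ContAtEndpoints (ℓ : ℝ → ℝ) (zl zh : ℝ) (g : ℝ → ℝ) : Prop :=
  (∀ᶠ z in 𝓝[>] zl, |g z - g zl| ≤ ℓ |z - zl|) ∧
  (∀ᶠ z in 𝓝[<] zh, |g z - g zh| ≤ ℓ |z - zh|)

/-- A class `F` of measurable functions has polynomial uniform covering numbers:
`sup_Q N(ε, F, L²(Q)) ≤ C ε ^ (-V)` for all `0 < ε ≤ 1`, the supremum being over all probability
measures `Q` (the centres of the covering balls are taken in `F`). -/
def PolynomialUniformCovering {S : Type*} [MeasurableSpace S] (F : Set (S → ℝ)) : Prop :=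
  (∀ f ∈ F, Measurable f) ∧
  ∃ C V : ℝ, 0 < C ∧ 0 < V ∧
    ∀ Q : Measure S, IsProbabilityMeasure Q → ∀ ε : ℝ, 0 < ε → ε ≤ 1 →
      ∃ T : Finset (S → ℝ), (T : Set (S → ℝ)) ⊆ F ∧ (T.card : ℝ) ≤ C * ε ^ (-V) ∧
        ∀ f ∈ F, ∃ g ∈ T, eLpNorm (f - g) 2 Q ≤ ENNReal.ofReal ε

/-! ### The two high-level assumptions -/

/-- The bandwidths in question: those `h > 0` with `h ≤ hhi n` for some `n`. -/
def bandwidths (hhi : ℕ → ℝ) : Set ℝ := {h | 0 < h ∧ ∃ n, h ≤ hhi n}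

/-- **Influence function representation.** With `E ψ(W,h) k(X/h) = 0` and
`h⁻¹ var (ψ(W,h) k(X/h)) = 1`,
`√(nh) (θ̂(h) - θ(h)) / σ̂(h) = (nh)^(-1/2) ∑_{i<n} ψ(W_i,h) k(X_i/h) + o_P(1/√(log log (h̄_n/h̲_n)))`
uniformly over `h ∈ [hlo n, hhi n]`, the classes `w ↦ ψ(w,h)` and `x ↦ k(x/h)` having polynomial
uniform covering numbers. For bounded ratios `h̄_n/h̲_n`, where `log log` may be small, zero or
undefined, the rate means `o_P(1)`: hence the `max 1`.
The observations `(X i, W i)` are i.i.d., so that the moments are written for `i = 0`;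
`μ` of a set is its outer measure, so that no measurability of the supremum is presupposed. -/
def InfluenceRepresentation {Ω 𝒲 : Type*} [MeasurableSpace Ω] [MeasurableSpace 𝒲]
    (μ : Measure Ω) (X : ℕ → Ω → ℝ) (W : ℕ → Ω → 𝒲)
    (θhat : ℕ → ℝ → Ω → ℝ) (σhat : ℕ → ℝ → Ω → ℝ) (θ : ℝ → ℝ)
    (hlo hhi : ℕ → ℝ) (k : ℝ → ℝ) (ψ : 𝒲 → ℝ → ℝ) : Prop :=
  (∀ h ∈ bandwidths hhi,
    ∫ ω, ψ (W 0 ω) h * k (X 0 ω / h) ∂μ = 0 ∧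
    h⁻¹ * Var[fun ω => ψ (W 0 ω) h * k (X 0 ω / h); μ] = 1) ∧
  (∀ ε : ℝ, 0 < ε →
    Tendsto (fun n : ℕ => μ {ω | ∃ h ∈ Set.Icc (hlo n) (hhi n),
      ε < √(max 1 (Real.log (Real.log (hhi n / hlo n)))) *
        |√(n * h) * (θhat n h ω - θ h) / σhat n h ω
          - (√(n * h))⁻¹ * ∑ i ∈ Finset.range n, ψ (W i ω) h * k (X i ω / h)|})
      atTop (𝓝 0)) ∧
  PolynomialUniformCovering {g : 𝒲 → ℝ | ∃ h ∈ insert 0 (bandwidths hhi), g = fun w => ψ w h} ∧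
  PolynomialUniformCovering {g : ℝ → ℝ | ∃ h ∈ bandwidths hhi, g = fun x => k (x / h)}

/-- **Kernel regularity.** `k` is symmetric with support `[-A, A]`, bounded, with a bounded,
uniformly continuous first derivative on `(0, A)`, and `∫ k ≠ 0`. -/
def KernelRegular (k : ℝ → ℝ) : Prop :=
  ∃ A : ℝ, 0 < A ∧
    (∀ u, k (-u) = k u) ∧
    tsupport k = Set.Icc (-A) A ∧
    (∃ C, ∀ u, |k u| ≤ C) ∧
    DifferentiableOn ℝ k (Set.Ioo 0 A) ∧
    (∃ C, ∀ u ∈ Set.Ioo 0 A, |deriv k u| ≤ C) ∧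
    UniformContinuousOn (deriv k) (Set.Ioo 0 A) ∧
    ∫ u, k u ≠ 0

/-- **Regularity of the data generating process.** On `[0, δ)` the variable `|X|` has a density `g`
with `g 0 > 0` (a density on the whole of `[0, ∞)` if `|X| < δ` almost surely);
`ψ(W,h) k(X/h)` is bounded uniformly over the bandwidths; and for some modulus `ℓ` with
`ℓ(t) log log t⁻¹ → 0` and some versions `m`, `v` of `t ↦ E[ψ(W,0) | |X| = t]` and
`t ↦ var[ψ(W,0) | |X| = t]`, with `v 0 > 0`, the quantities `|m t - m 0|`, `|v t - v 0|`,
`|g t - g 0|` and `|(ψ(W,t) - ψ(W,0)) k(X/t)|` are bounded by `ℓ t`. The continuity at `0` is also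
what gives the values `m 0`, `v 0`, `g 0` a meaning. -/
def DgpRegular {Ω 𝒲 : Type*} [MeasurableSpace Ω]
    (μ : Measure Ω) (X : Ω → ℝ) (W : Ω → 𝒲) (δ : ℝ)
    (hhi : ℕ → ℝ) (k : ℝ → ℝ) (ψ : 𝒲 → ℝ → ℝ) : Prop :=
  ∃ ℓ g m v : ℝ → ℝ,
    LogLogModulus ℓ ∧
    Measurable g ∧ (∀ t, 0 ≤ g t) ∧
    (μ.map (fun ω => |X ω|)).restrict (Set.Iio δ) =
      (volume.restrict (Set.Ico 0 δ)).withDensity (fun t => ENNReal.ofReal (g t)) ∧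
    0 < g 0 ∧
    Measurable m ∧
    μ[fun ω => ψ (W ω) 0 | MeasurableSpace.comap (fun ω => |X ω|) inferInstance]
      =ᵐ[μ] (fun ω => m |X ω|) ∧
    Measurable v ∧
    Var[fun ω => ψ (W ω) 0; μ | MeasurableSpace.comap (fun ω => |X ω|) inferInstance]
      =ᵐ[μ] (fun ω => v |X ω|) ∧
    0 < v 0 ∧
    (∃ C, ∀ h ∈ bandwidths hhi, ∀ᵐ ω ∂μ, |ψ (W ω) h * k (X ω / h)| ≤ C) ∧
    (∀ t ∈ Set.Ioo 0 δ, |g t - g 0| ≤ ℓ t) ∧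
    (∀ t, 0 < t → |m t - m 0| ≤ ℓ t) ∧
    (∀ t, 0 < t → |v t - v 0| ≤ ℓ t) ∧
    (∀ t ∈ bandwidths hhi, ∀ᵐ ω ∂μ, |(ψ (W ω) t - ψ (W ω) 0) * k (X ω / t)| ≤ ℓ t)

/-- The uniform kernel `k(u) = I(|u| ≤ 1)`. -/
def uniformKernel (u : ℝ) : ℝ := if |u| ≤ 1 then 1 else 0

/-! ### LATE on the largest sets of compliers -/

/-- `Δ^LATE(𝒜, ℬ) = (E(Y|Z∈𝒜) - E(Y|Z∈ℬ)) / (P(D=1|Z∈𝒜) - P(D=1|Z∈ℬ))`. -/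
def lateDelta {Ω : Type*} [MeasurableSpace Ω] (μ : Measure Ω) (Z D Y : Ω → ℝ)
    (𝒜 ℬ : Set ℝ) : ℝ :=
  ((∫ ω, Y ω ∂(μ[|Z ⁻¹' 𝒜])) - ∫ ω, Y ω ∂(μ[|Z ⁻¹' ℬ])) /
    ((μ[|Z ⁻¹' 𝒜]).real {ω | D ω = 1} - (μ[|Z ⁻¹' ℬ]).real {ω | D ω = 1})

/-- The estimand `θ(h) = Δ^LATE([zl, zl + h], [zh - h, zh])`. -/
def lateTheta {Ω : Type*} [MeasurableSpace Ω] (μ : Measure Ω) (Z D Y : Ω → ℝ)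
    (zl zh h : ℝ) : ℝ :=
  lateDelta μ Z D Y (Set.Icc zl (zl + h)) (Set.Icc (zh - h) zh)

open Classical in
/-- The observations `i < n` with `z i ∈ 𝒜`. -/
def obsIn (n : ℕ) (z : ℕ → ℝ) (𝒜 : Set ℝ) : Finset ℕ := (Finset.range n).filter (fun i => z i ∈ 𝒜)

/-- The average of `y i` over the observations `i < n` with `z i ∈ 𝒜`. -/
def avgIn (n : ℕ) (z y : ℕ → ℝ) (𝒜 : Set ℝ) : ℝ :=
  (1 / ((obsIn n z 𝒜).card : ℝ)) * ∑ i ∈ obsIn n z 𝒜, y i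

/-- The estimator `θ̂(h)`, the sample analogue of `θ(h)`. -/
def lateEst (n : ℕ) (z d y : ℕ → ℝ) (zl zh h : ℝ) : ℝ :=
  (avgIn n z y (Set.Icc zl (zl + h)) - avgIn n z y (Set.Icc (zh - h) zh)) /
    (avgIn n z d (Set.Icc zl (zl + h)) - avgIn n z d (Set.Icc (zh - h) zh))

/-- The restricted sample of the IV regression: `z i ∈ [zl, zl + h] ∪ [zh - h, zh]`. -/
def ivSample (n : ℕ) (z : ℕ → ℝ) (zl zh h : ℝ) : Finset ℕ :=
  obsIn n z (Set.Icc zl (zl + h) ∪ Set.Icc (zh - h) zh)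

/-- Instrument vector: a constant and `I(z ≥ zh - h)`. -/
def ivInstr (zh h z : ℝ) : Fin 2 → ℝ := ![1, if zh - h ≤ z then 1 else 0]

/-- Regressor vector: a constant and the treatment. -/
def ivRegr (d : ℝ) : Fin 2 → ℝ := ![1, d]

/-- The cross moment matrix `∑ q_i x_i'` of instruments and regressors. -/
def ivCross (n : ℕ) (z d : ℕ → ℝ) (zl zh h : ℝ) : Matrix (Fin 2) (Fin 2) ℝ :=
  ∑ i ∈ ivSample n z zl zh h, Matrix.vecMulVec (ivInstr zh h (z i)) (ivRegr (d i))

/-- The IV estimates `(α̂, β̂) = (∑ q_i x_i')⁻¹ ∑ q_i y_i` in `y = α + d β + ε`. -/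
def ivCoef (n : ℕ) (z d y : ℕ → ℝ) (zl zh h : ℝ) : Fin 2 → ℝ :=
  Matrix.mulVec (ivCross n z d zl zh h)⁻¹
    (∑ i ∈ ivSample n z zl zh h, y i • ivInstr zh h (z i))

/-- The IV residuals `ε̂_i = y_i - α̂ - d_i β̂`. -/
def ivResid (n : ℕ) (z d y : ℕ → ℝ) (zl zh h : ℝ) (i : ℕ) : ℝ :=
  y i - dotProduct (ivRegr (d i)) (ivCoef n z d y zl zh h)

/-- The heteroskedasticity-robust (sandwich) estimate of the variance matrix of `(α̂, β̂)`,
`(∑ q_i x_i')⁻¹ (∑ ε̂_i² q_i q_i') (∑ x_i q_i')⁻¹`. -/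
def ivRobustVar (n : ℕ) (z d y : ℕ → ℝ) (zl zh h : ℝ) : Matrix (Fin 2) (Fin 2) ℝ :=
  (ivCross n z d zl zh h)⁻¹ *
    (∑ i ∈ ivSample n z zl zh h, (ivResid n z d y zl zh h i) ^ 2 •
      Matrix.vecMulVec (ivInstr zh h (z i)) (ivInstr zh h (z i))) *
    ((ivCross n z d zl zh h).transpose)⁻¹

/-- `σ̂(h)`: `σ̂(h)² / h` is the robust variance estimate for `√n (β̂ - β)`, that is,
`σ̂(h) / √(nh)` is the robust standard error of `β̂`. -/
def lateSigmaHat (n : ℕ) (z d y : ℕ → ℝ) (zl zh h : ℝ) : ℝ :=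
  √(h * (n * ivRobustVar n z d y zl zh h 1 1))

/-- The running variable of the kernel representation: the signed distance of `z` to the nearest
endpoint of `[zl, zh]`. For `z ∈ [zl, zh]` and small `h`, `|lateX zl zh z| ≤ h` holds exactly when
`z ∈ [zl, zl + h] ∪ [zh - h, zh]`. -/
def lateX (zl zh z : ℝ) : ℝ := if z ≤ (zl + zh) / 2 then z - zl else z - zh

end

end BandwidthSnooping

open BandwidthSnooping

namespace BandwidthSnooping

set_option linter.unusedSectionVars false

/-! ### The estimator as a function of endpoint moments -/

/-! For a fixed bandwidth `h` everything depends on ten numbers: at each endpoint, the moments of 1,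
D, Y, DY, Y² over the points within `h` of it, divided by `h`. Because D² = D, these determine the
IV intercept and slope and the sandwich variance. So θ̂(h) and σ̂(h) are the functions `momSlope`
and `momSigma` of a sample vector x, and θ(h) is `momSlope` of the population vector u = u(h)
(`lateEst_eq`, `lateSigmaHat_eq`, `lateTheta_eq`).

The central algebraic fact is `momSlope_sub_div`: (slope x - slope u) / σ(x) equals, exactly, a sum
over the two endpoints of weight(x) times the moment at x of the residual from the line fitted at u.
That residual moment is linear in x and vanishes at x = u, by the normal equations. Replacing
weight(x) by weight(u) therefore costs only O(‖x - u‖²) (`momSlope_linearization`), and what is left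
is a sum of i.i.d. terms. This dictates the influence function `infl`: the weight of the nearest
endpoint times the residual, both taken at u(h). Its localized mean is zero by the normal equations,
and its localized variance is `h` because the weights are scaled by σ.

The remainder √(nh) ‖x - u‖² has to be o(1/√(log log)) uniformly in `h`. It suffices that ‖x - u‖ is
of smaller order than (nh)^(-1/4) (log log)^(-1/4), which is far weaker than the true rate
(nh)^(-1/2). With so much room, no sharp empirical process theory is needed: Chebyshev's inequality
on a grid of bandwidths equally spaced on the scale (nh)^(1/4), with monotone sandwiching between
grid points, is enough (`measure_exists_lt_abs_devSum_le`). The grid step must shrink with the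
tolerance, so the union bound has the cube of the tolerance in its denominator; this is where the
third power of log log in the bandwidth condition is used.

For the regularity statements, u(h) is the average over depths in [0, h] of density times
conditional moments, so it inherits their modulus at 0 (`LateDesign.logLogCont_lateMom`). For small
`h` all u(h) lie in one ball on which weights, intercept and slope are bounded and Lipschitz
(`MomRegular.exists_ball`). This gives the modulus of ψ(·, h) - ψ(·, 0), the uniform bound on ψ, and
polynomial covering numbers, the class being a Lipschitz image of a bounded finite-dimensional set.
Conditional moments given |X| = t are mixtures of those at the two points of depth t, weighted by
the density (`LateDesign.exists_condMom_version`). -/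

/-- Vectors of moments: for each endpoint, those of `1, D, Y, D Y, Y²`. -/
abbrev Moments := Bool → Fin 5 → ℝ

/-- The first stage difference. -/
noncomputable def momDen (x : Moments) : ℝ := x false 1 / x false 0 - x true 1 / x true 0

/-- The slope of the IV regression. -/
noncomputable def momSlope (x : Moments) : ℝ :=
  (x false 2 / x false 0 - x true 2 / x true 0) / momDen x

/-- The intercept of the IV regression. -/
noncomputable def momIcpt (x : Moments) : ℝ :=
  (x false 2 - momSlope x * x false 1) / x false 0

/-- The moment of the residual `Y - a - b D`. -/
def momResid (a b : ℝ) (y : Fin 5 → ℝ) : ℝ := y 2 - a * y 0 - b * y 1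

/-- The moment of the squared residual `(Y - a - b D)²`, for a zero-one variable `D`. -/
def momSq (a b : ℝ) (y : Fin 5 → ℝ) : ℝ :=
  y 4 + a ^ 2 * y 0 + b ^ 2 * y 1 - 2 * a * y 2 - 2 * b * y 3 + 2 * a * b * y 1

/-- The variance of the difference of the mean residuals at the two endpoints. -/
noncomputable def momVar (x : Moments) : ℝ :=
  momSq (momIcpt x) (momSlope x) (x false) / (x false 0) ^ 2 +
    momSq (momIcpt x) (momSlope x) (x true) / (x true 0) ^ 2

/-- The asymptotic standard deviation of the slope. -/
noncomputable def momSigma (x : Moments) : ℝ := √(momVar x / momDen x ^ 2)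

/-- The weights of the two endpoints in the influence function. -/
noncomputable def momWeight (s : Bool) (x : Moments) : ℝ :=
  (if s then -1 else 1) / (momDen x * x s 0 * momSigma x)

/-- Moment vectors at which the slope and its standard deviation are smooth. -/
def MomRegular (x : Moments) : Prop := (∀ s, 0 < x s 0) ∧ momDen x ≠ 0 ∧ 0 < momVar x

theorem contDiff_momCoord (s : Bool) (j : Fin 5) : ContDiff ℝ 1 (fun x : Moments => x s j) := by
  fun_prop

theorem MomRegular.contDiffAt_momDen {x : Moments} (hx : MomRegular x) :
    ContDiffAt ℝ 1 momDen x := by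
  have h0 := (hx.1 false).ne'
  have h1 := (hx.1 true).ne'
  unfold momDen
  exact ((contDiff_momCoord _ _).contDiffAt.div (contDiff_momCoord _ _).contDiffAt h0).sub
    ((contDiff_momCoord _ _).contDiffAt.div (contDiff_momCoord _ _).contDiffAt h1)

theorem MomRegular.contDiffAt_momSlope {x : Moments} (hx : MomRegular x) :
    ContDiffAt ℝ 1 momSlope x := by
  have h0 := (hx.1 false).ne'
  have h1 := (hx.1 true).ne'
  unfold momSlope
  exact (((contDiff_momCoord _ _).contDiffAt.div (contDiff_momCoord _ _).contDiffAt h0).sub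
    ((contDiff_momCoord _ _).contDiffAt.div (contDiff_momCoord _ _).contDiffAt h1)).div
    hx.contDiffAt_momDen hx.2.1

theorem MomRegular.contDiffAt_momIcpt {x : Moments} (hx : MomRegular x) :
    ContDiffAt ℝ 1 momIcpt x := by
  unfold momIcpt
  exact ((contDiff_momCoord _ _).contDiffAt.sub
    (hx.contDiffAt_momSlope.mul (contDiff_momCoord _ _).contDiffAt)).div
    (contDiff_momCoord _ _).contDiffAt (hx.1 false).ne'

theorem MomRegular.contDiffAt_momVar {x : Moments} (hx : MomRegular x) :
    ContDiffAt ℝ 1 momVar x := by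
  have h0 := pow_ne_zero 2 (hx.1 false).ne'
  have h1 := pow_ne_zero 2 (hx.1 true).ne'
  have ha := hx.contDiffAt_momIcpt
  have hb := hx.contDiffAt_momSlope
  have hc : ∀ s j, ContDiffAt ℝ 1 (fun x : Moments => x s j) x := fun s j =>
    (contDiff_momCoord s j).contDiffAt
  have hs : ∀ s, ContDiffAt ℝ 1 (fun x : Moments => momSq (momIcpt x) (momSlope x) (x s)) x := by
    intro s
    unfold momSq
    exact (((((hc s 4).add ((ha.pow 2).mul (hc s 0))).add ((hb.pow 2).mul (hc s 1))).sub
      ((contDiffAt_const.mul ha).mul (hc s 2))).sub ((contDiffAt_const.mul hb).mul (hc s 3))).add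
      (((contDiffAt_const.mul ha).mul hb).mul (hc s 1))
  exact ((hs false).div ((hc false 0).pow 2) h0).add ((hs true).div ((hc true 0).pow 2) h1)

theorem MomRegular.momSigma_pos {x : Moments} (hx : MomRegular x) : 0 < momSigma x :=
  Real.sqrt_pos.2 (div_pos hx.2.2 (by have := hx.2.1; positivity))

theorem MomRegular.contDiffAt_momWeight {x : Moments} (hx : MomRegular x) (s : Bool) :
    ContDiffAt ℝ 1 (momWeight s) x := by
  have h1 : ContDiffAt ℝ 1 momSigma x :=
    (hx.contDiffAt_momVar.div (hx.contDiffAt_momDen.pow 2) (pow_ne_zero 2 hx.2.1)).sqrt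
      (div_pos hx.2.2 (by have := hx.2.1; positivity)).ne'
  unfold momWeight
  exact contDiffAt_const.div
    ((hx.contDiffAt_momDen.mul (contDiff_momCoord _ _).contDiffAt).mul h1)
    (mul_ne_zero (mul_ne_zero hx.2.1 (hx.1 s).ne') hx.momSigma_pos.ne')

theorem MomRegular.eventually {x : Moments} (hx : MomRegular x) : ∀ᶠ y in 𝓝 x, MomRegular y := by
  have h1 : ∀ s, ∀ᶠ y : Moments in 𝓝 x, 0 < y s 0 := fun s =>
    (contDiff_momCoord s 0).continuous.continuousAt.eventually_const_lt (hx.1 s)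
  have h2 := hx.contDiffAt_momDen.continuousAt.eventually_ne hx.2.1
  have h3 := hx.contDiffAt_momVar.continuousAt.eventually_const_lt hx.2.2
  filter_upwards [h1 false, h1 true, h2, h3] with y a b c d
  exact ⟨fun s => by cases s <;> assumption, c, d⟩

theorem exists_ball_lipschitz {φ : Moments → ℝ} {x : Moments} (h : ContDiffAt ℝ 1 φ x) :
    ∃ ρ > 0, ∃ C, 0 ≤ C ∧ ∀ y ∈ Metric.ball x ρ, |φ y| ≤ C ∧
      ∀ z ∈ Metric.ball x ρ, |φ y - φ z| ≤ C * ‖y - z‖ := by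
  obtain ⟨K, t, ht, hK⟩ := h.exists_lipschitzOnWith
  obtain ⟨ρ, hρ, hb⟩ := Metric.mem_nhds_iff.1 ht
  refine ⟨ρ, hρ, max K (K * ρ + |φ x|), le_max_of_le_left K.2, fun y hy => ⟨?_, fun z hz => ?_⟩⟩
  · have h1 := hK.dist_le_mul y (hb hy) x (hb (Metric.mem_ball_self hρ))
    rw [Real.dist_eq] at h1
    have h2 : (K : ℝ) * dist y x ≤ K * ρ :=
      mul_le_mul_of_nonneg_left (Metric.mem_ball.1 hy).le K.2
    have h3 := abs_sub_abs_le_abs_sub (φ y) (φ x)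
    exact le_max_of_le_right (by linarith)
  · have h1 := hK.dist_le_mul y (hb hy) z (hb hz)
    rw [Real.dist_eq, dist_eq_norm] at h1
    exact h1.trans (mul_le_mul_of_nonneg_right (le_max_left _ _) (norm_nonneg _))

/-- One radius and one constant serve the linearization, the uniform bounds, the covering numbers
and the modulus of the influence function alike: a C¹ function is bounded and Lipschitz near a
point, and only finitely many are involved. -/
theorem MomRegular.exists_ball {x : Moments} (hx : MomRegular x) :
    ∃ ρ > 0, ∃ C, 0 ≤ C ∧ ∀ y ∈ Metric.ball x ρ, MomRegular y ∧
      (∀ s, |momWeight s y| ≤ C) ∧ |momIcpt y| ≤ C ∧ |momSlope y| ≤ C ∧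
      ∀ z ∈ Metric.ball x ρ, (∀ s, |momWeight s y - momWeight s z| ≤ C * ‖y - z‖) ∧
        |momIcpt y - momIcpt z| ≤ C * ‖y - z‖ ∧ |momSlope y - momSlope z| ≤ C * ‖y - z‖ := by
  obtain ⟨r0, hr0, hb⟩ := Metric.mem_nhds_iff.1 hx.eventually
  obtain ⟨r1, hr1, C1, hC1, h1⟩ := exists_ball_lipschitz (hx.contDiffAt_momWeight false)
  obtain ⟨r2, hr2, C2, hC2, h2⟩ := exists_ball_lipschitz (hx.contDiffAt_momWeight true)
  obtain ⟨r3, hr3, C3, hC3, h3⟩ := exists_ball_lipschitz hx.contDiffAt_momIcpt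
  obtain ⟨r4, hr4, C4, hC4, h4⟩ := exists_ball_lipschitz hx.contDiffAt_momSlope
  refine ⟨min r0 (min (min r1 r2) (min r3 r4)), by positivity, C1 + C2 + C3 + C4, by positivity,
    fun y hy => ?_⟩
  have hsub : ∀ {z : Moments}, z ∈ Metric.ball x (min r0 (min (min r1 r2) (min r3 r4))) →
      z ∈ Metric.ball x r0 ∧ z ∈ Metric.ball x r1 ∧ z ∈ Metric.ball x r2 ∧ z ∈ Metric.ball x r3 ∧
        z ∈ Metric.ball x r4 := by
    intro z hz
    simp only [Metric.mem_ball, lt_min_iff] at hz ⊢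
    tauto
  obtain ⟨y0, y1, y2, y3, y4⟩ := hsub hy
  refine ⟨hb y0, ?_, by linarith [(h3 y y3).1], by linarith [(h4 y y4).1], fun z hz => ?_⟩
  · rintro (_ | _)
    · linarith [(h1 y y1).1]
    · linarith [(h2 y y2).1]
  obtain ⟨z0, z1, z2, z3, z4⟩ := hsub hz
  have hn := norm_nonneg (y - z)
  refine ⟨?_, ?_, ?_⟩
  · rintro (_ | _)
    · exact ((h1 y y1).2 z z1).trans (mul_le_mul_of_nonneg_right (by linarith) hn)
    · exact ((h2 y y2).2 z z2).trans (mul_le_mul_of_nonneg_right (by linarith) hn)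
  · exact ((h3 y y3).2 z z3).trans (mul_le_mul_of_nonneg_right (by linarith) hn)
  · exact ((h4 y y4).2 z z4).trans (mul_le_mul_of_nonneg_right (by linarith) hn)

/-- These are the normal equations. With two instruments and two coefficients the fit is exactly
identified, so the mean residual vanishes at each endpoint separately: at the lower one by the
choice of the intercept, at the upper one by that of the slope. -/
theorem MomRegular.momResid_eq_zero {x : Moments} (hx : MomRegular x) (s : Bool) :
    momResid (momIcpt x) (momSlope x) (x s) = 0 := by
  have h0 := (hx.1 false).ne'
  have h1 := (hx.1 true).ne'
  have hd := hx.2.1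
  have hs : momSlope x * momDen x = x false 2 / x false 0 - x true 2 / x true 0 := by
    unfold momSlope; field_simp
  have ha : momIcpt x * x false 0 = x false 2 - momSlope x * x false 1 := by
    unfold momIcpt; field_simp
  cases s
  · unfold momResid; linarith
  · unfold momResid
    have ha' : momIcpt x = x false 2 / x false 0 - momSlope x * (x false 1 / x false 0) := by
      unfold momIcpt; field_simp
    have : momIcpt x = x true 2 / x true 0 - momSlope x * (x true 1 / x true 0) := by
      rw [ha']; unfold momDen at hs; linarith
    rw [this]; field_simp; ring

/-- The factor `momDen` cancels in the squared weight, which becomes 1 / (x_s0² V) with V = `momVar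
x`; the sum is then V / V. This yields the unit variance of the influence function. -/
theorem MomRegular.sum_momWeight_sq {x : Moments} (hx : MomRegular x) :
    momWeight false x ^ 2 * momSq (momIcpt x) (momSlope x) (x false) +
      momWeight true x ^ 2 * momSq (momIcpt x) (momSlope x) (x true) = 1 := by
  have h0 := (hx.1 false).ne'
  have h1 := (hx.1 true).ne'
  have hd := hx.2.1
  have hv := hx.2.2.ne'
  have hσ : momSigma x ^ 2 = momVar x / momDen x ^ 2 :=
    Real.sq_sqrt (div_pos hx.2.2 (by positivity)).le
  have hw : ∀ s, momWeight s x ^ 2 = 1 / ((x s 0) ^ 2 * momVar x) := by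
    intro s
    have : momWeight s x ^ 2 = 1 / (momDen x ^ 2 * (x s 0) ^ 2 * momSigma x ^ 2) := by
      unfold momWeight; rw [div_pow, mul_pow, mul_pow]; cases s <;> simp
    rw [this, hσ]; field_simp
  rw [hw, hw]
  have hv' : momVar x = momSq (momIcpt x) (momSlope x) (x false) / (x false 0) ^ 2 +
    momSq (momIcpt x) (momSlope x) (x true) / (x true 0) ^ 2 := rfl
  set V := momVar x
  set p := momSq (momIcpt x) (momSlope x) (x false)
  set q := momSq (momIcpt x) (momSlope x) (x true)
  calc _ = (p / (x false 0) ^ 2 + q / (x true 0) ^ 2) / V := by field_simp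
    _ = 1 := by rw [← hv', div_self hv]

/-- An identity, not an expansion: dividing the residual moments at `x` by the masses and
subtracting removes the intercept of `u`, leaving the difference of slopes times `momDen x`. -/
theorem momSlope_sub_div {x u : Moments} (hx : MomRegular x) :
    (momSlope x - momSlope u) / momSigma x =
      momWeight false x * momResid (momIcpt u) (momSlope u) (x false) +
      momWeight true x * momResid (momIcpt u) (momSlope u) (x true) := by
  have h0 := (hx.1 false).ne'
  have h1 := (hx.1 true).ne'
  have hd := hx.2.1
  have hσ := hx.momSigma_pos.ne'
  have hs : momSlope x = (x false 2 / x false 0 - x true 2 / x true 0) / momDen x := rfl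
  have hm : momDen x = x false 1 / x false 0 - x true 1 / x true 0 := rfl
  have : momSlope x - momSlope u = (momResid (momIcpt u) (momSlope u) (x false) / x false 0 -
      momResid (momIcpt u) (momSlope u) (x true) / x true 0) / momDen x := by
    rw [hs, eq_div_iff hd, sub_mul, div_mul_cancel₀ _ hd]
    nth_rewrite 1 [hm]
    unfold momResid
    field_simp
    ring
  rw [this]
  unfold momWeight
  simp only [Bool.false_eq_true, if_false, if_true]
  field_simp
  ring

/-- The error is a product of two small factors at each endpoint: the change of the weight, and the
residual moment, which is linear in the moments, vanishes at `u` and has Lipschitz constant 1 +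
|intercept| + |slope| ≤ 1 + 2C. -/
theorem momSlope_linearization {x u : Moments} {C N : ℝ} (hC : 0 ≤ C) (hN : 0 ≤ N)
    (hx : MomRegular x) (hu : MomRegular u) (ha : |momIcpt u| ≤ C) (hb : |momSlope u| ≤ C)
    (hw : ∀ s, |momWeight s x - momWeight s u| ≤ C * ‖x - u‖) :
    |N * ((momSlope x - momSlope u) / momSigma x) - N *
      (momWeight false u * momResid (momIcpt u) (momSlope u) (x false) +
        momWeight true u * momResid (momIcpt u) (momSlope u) (x true))| ≤
      2 * C * (1 + 2 * C) * (N * ‖x - u‖ ^ 2) := by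
  have hc : ∀ s j, |x s j - u s j| ≤ ‖x - u‖ := fun s j =>
    (norm_le_pi_norm ((x - u) s) j).trans (norm_le_pi_norm (x - u) s)
  have hr : ∀ s, |momResid (momIcpt u) (momSlope u) (x s)| ≤ (1 + 2 * C) * ‖x - u‖ := by
    intro s
    have h0 := hu.momResid_eq_zero s
    have h1 : momResid (momIcpt u) (momSlope u) (x s) = (x s 2 - u s 2) -
        momIcpt u * (x s 0 - u s 0) - momSlope u * (x s 1 - u s 1) := by
      unfold momResid at h0 ⊢; linarith
    rw [h1]
    have a1 : |momIcpt u * (x s 0 - u s 0)| ≤ C * ‖x - u‖ := by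
      rw [abs_mul]; exact mul_le_mul ha (hc s 0) (abs_nonneg _) hC
    have a2 : |momSlope u * (x s 1 - u s 1)| ≤ C * ‖x - u‖ := by
      rw [abs_mul]; exact mul_le_mul hb (hc s 1) (abs_nonneg _) hC
    have a3 := hc s 2
    have := abs_sub (x s 2 - u s 2 - momIcpt u * (x s 0 - u s 0)) (momSlope u * (x s 1 - u s 1))
    have := abs_sub (x s 2 - u s 2) (momIcpt u * (x s 0 - u s 0))
    linarith
  have hp : ∀ s, |(momWeight s x - momWeight s u) * momResid (momIcpt u) (momSlope u) (x s)| ≤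
      C * (1 + 2 * C) * ‖x - u‖ ^ 2 := by
    intro s
    rw [abs_mul]
    calc _ ≤ (C * ‖x - u‖) * ((1 + 2 * C) * ‖x - u‖) :=
          mul_le_mul (hw s) (hr s) (abs_nonneg _) (by positivity)
      _ = _ := by ring
  rw [momSlope_sub_div hx, ← mul_sub, abs_mul, abs_of_nonneg hN]
  have h1 := abs_add_le
    ((momWeight false x - momWeight false u) * momResid (momIcpt u) (momSlope u) (x false))
    ((momWeight true x - momWeight true u) * momResid (momIcpt u) (momSlope u) (x true))
  have h2 := hp false
  have h3 := hp true
  calc _ = N * |(momWeight false x - momWeight false u) *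
          momResid (momIcpt u) (momSlope u) (x false) +
        (momWeight true x - momWeight true u) * momResid (momIcpt u) (momSlope u) (x true)| := by
        congr 2; ring
    _ ≤ N * (2 * (C * (1 + 2 * C) * ‖x - u‖ ^ 2)) :=
        mul_le_mul_of_nonneg_left (by linarith) hN
    _ = _ := by ring

/-! ### Rates relative to `1 / log log t⁻¹` -/

/-- `g t - g 0 = o(1 / log log t⁻¹)` as `t ↓ 0`. -/
def LogLogCont {E : Type*} [NormedAddCommGroup E] (g : ℝ → E) : Prop :=
  (fun t => g t - g 0) =o[𝓝[>] 0] (fun t : ℝ => (Real.log (Real.log t⁻¹))⁻¹)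

theorem tendsto_loglog_inv : Tendsto (fun t : ℝ => Real.log (Real.log t⁻¹)) (𝓝[>] 0) atTop :=
  Real.tendsto_log_atTop.comp (Real.tendsto_log_atTop.comp tendsto_inv_nhdsGT_zero)

theorem logLogModulus_iff {ℓ : ℝ → ℝ} :
    LogLogModulus ℓ ↔ ℓ =o[𝓝[>] 0] (fun t : ℝ => (Real.log (Real.log t⁻¹))⁻¹) := by
  rw [Asymptotics.isLittleO_iff_tendsto']
  · simp only [div_inv_eq_mul]; rfl
  · filter_upwards [tendsto_loglog_inv.eventually_gt_atTop 0] with t ht h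
    exact absurd h (inv_pos.2 ht).ne'

theorem LogLogCont.tendsto {E : Type*} [NormedAddCommGroup E] {g : ℝ → E} (hg : LogLogCont g) :
    Tendsto g (𝓝[>] 0) (𝓝 (g 0)) :=
  tendsto_sub_nhds_zero_iff.1 (hg.trans_tendsto tendsto_loglog_inv.inv_tendsto_atTop)

/-- Differentiability at the limit point is enough: it bounds the increment of `φ` by a multiple of
the increment of `g`. -/
theorem LogLogCont.comp {E : Type*} [NormedAddCommGroup E] [NormedSpace ℝ E] {g : ℝ → E}
    (hg : LogLogCont g) {φ : E → ℝ} (hφ : DifferentiableAt ℝ φ (g 0)) :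
    LogLogCont (fun t => φ (g t)) :=
  ((hφ.isBigO_sub).comp_tendsto hg.tendsto).trans_isLittleO hg

theorem LogLogCont.logLogModulus {g : ℝ → ℝ} (hg : LogLogCont g) :
    LogLogModulus (fun t => |g t - g 0|) :=
  logLogModulus_iff.2 (Asymptotics.IsLittleO.norm_left hg)

theorem LogLogModulus.add {g k : ℝ → ℝ} (hg : LogLogModulus g) (hk : LogLogModulus k) :
    LogLogModulus (fun t => g t + k t) :=
  logLogModulus_iff.2 ((logLogModulus_iff.1 hg).add (logLogModulus_iff.1 hk))

/-! ### Covering numbers of bounded finite-dimensional classes -/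

/-- Cut the cube [-R, R]^ι into cells of side `r` and keep one member of `A` from each occupied
cell. Choosing representatives in this way puts the centres inside the class. -/
theorem exists_finset_net {α ι : Type*} [Fintype ι] (A : Set α) (c : α → ι → ℝ) {R : ℝ}
    (hR : 0 ≤ R) (hc : ∀ a ∈ A, ∀ i, |c a i| ≤ R) {r : ℝ} (hr : 0 < r) (hr1 : r ≤ 1) :
    ∃ T : Finset α, (T : Set α) ⊆ A ∧ (T.card : ℝ) ≤ ((2 * R + 3) / r) ^ Fintype.card ι ∧
      ∀ a ∈ A, ∃ b ∈ T, ∀ i, |c a i - c b i| ≤ r := by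
  classical
  let cell : α → ι → ℤ := fun a i => ⌊c a i / r⌋
  let M : ℤ := ⌈R / r⌉
  let G : Finset (ι → ℤ) := Fintype.piFinset fun _ => Finset.Icc (-M) M
  have hmem : ∀ a ∈ A, cell a ∈ G := by
    intro a ha
    refine Fintype.mem_piFinset.2 fun i => Finset.mem_Icc.2 ⟨?_, ?_⟩
    · refine Int.le_floor.2 ?_
      push_cast
      have h1 : -(R / r) ≤ c a i / r := by
        rw [← neg_div]; exact div_le_div_of_nonneg_right (abs_le.1 (hc a ha i)).1 hr.le
      linarith [Int.le_ceil (R / r)]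
    · have h1 : c a i / r ≤ R / r :=
        div_le_div_of_nonneg_right (abs_le.1 (hc a ha i)).2 hr.le
      have h2 : ((cell a i : ℤ) : ℝ) ≤ (M : ℝ) :=
        (Int.floor_le _).trans (h1.trans (Int.le_ceil _))
      exact_mod_cast h2
  let G' := G.filter fun g => ∃ a ∈ A, cell a = g
  have hG' : ∀ g ∈ G', ∃ a ∈ A, cell a = g := fun g hg => (Finset.mem_filter.1 hg).2
  refine ⟨G'.attach.image fun g => (hG' g.1 g.2).choose, ?_, ?_, ?_⟩
  · intro x hx
    obtain ⟨g, -, rfl⟩ := Finset.mem_image.1 hx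
    exact (hG' g.1 g.2).choose_spec.1
  · have hM : (0 : ℤ) ≤ M := Int.ceil_nonneg (by positivity)
    have h1 : (G'.attach.image fun g => (hG' g.1 g.2).choose).card ≤ G.card :=
      Finset.card_image_le.trans (by rw [Finset.card_attach]; exact Finset.card_filter_le _ _)
    have h2 : (G.card : ℝ) = (2 * (M : ℝ) + 1) ^ Fintype.card ι := by
      simp only [G, Fintype.card_piFinset, Int.card_Icc, Finset.prod_const, Finset.card_univ]
      push_cast
      congr 1
      have : ((M + 1 - -M).toNat : ℤ) = 2 * M + 1 := by omega
      exact_mod_cast this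
    -- From M r ≤ R + r and r ≤ 1: (2M + 1) r ≤ 2R + 3r ≤ 2R + 3.
    have h3 : (2 * (M : ℝ) + 1) ≤ (2 * R + 3) / r := by
      have := (Int.ceil_lt_add_one (R / r)).le
      rw [le_div_iff₀ hr]
      have h4 : (M : ℝ) * r ≤ R + r := by
        calc (M : ℝ) * r ≤ (R / r + 1) * r := mul_le_mul_of_nonneg_right this hr.le
          _ = R + r := by field_simp
      nlinarith
    calc _ ≤ (G.card : ℝ) := by exact_mod_cast h1
      _ = (2 * (M : ℝ) + 1) ^ Fintype.card ι := h2
      _ ≤ _ := pow_le_pow_left₀ (by have : (0 : ℝ) ≤ M := by exact_mod_cast hM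
                                    positivity) h3 _
  · intro a ha
    have hg : cell a ∈ G' := Finset.mem_filter.2 ⟨hmem a ha, a, ha, rfl⟩
    refine ⟨(hG' _ hg).choose, Finset.mem_image.2 ⟨⟨_, hg⟩, Finset.mem_attach _ _, rfl⟩, fun i => ?_⟩
    have h1 : ⌊c (hG' _ hg).choose i / r⌋ = ⌊c a i / r⌋ :=
      congrFun (hG' _ hg).choose_spec.2 i
    have h2 := Int.abs_sub_lt_one_of_floor_eq_floor h1.symm
    rw [← sub_div, abs_div, abs_of_pos hr, div_lt_one hr] at h2
    exact h2.le

/-- A class indexed by `A` has polynomial uniform covering numbers if its `L²(Q)` distances are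
bounded by a power of the distances of bounded finite-dimensional parameters. -/
theorem polynomialUniformCovering_of_param {S α ι : Type*} [MeasurableSpace S] [Fintype ι]
    [Nonempty ι] (A : Set α) (φ : α → S → ℝ) (hφ : ∀ a ∈ A, Measurable (φ a))
    {R M : ℝ} (hR : 0 ≤ R) (hM : 1 ≤ M) (k : ℕ) (hk : k ≠ 0)
    (h : ∀ Q : Measure S, IsProbabilityMeasure Q → ∃ c : α → ι → ℝ, (∀ a ∈ A, ∀ i, |c a i| ≤ R) ∧
      ∀ a ∈ A, ∀ b ∈ A, ∀ ε : ℝ, 0 < ε → ε ≤ 1 → (∀ i, |c a i - c b i| ≤ (ε / M) ^ k) →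
        eLpNorm (φ a - φ b) 2 Q ≤ ENNReal.ofReal ε) :
    PolynomialUniformCovering {g | ∃ a ∈ A, g = φ a} := by
  classical
  -- The net is taken at scale (ε / M)^k in `ι`-dimensional parameter space, hence the exponent k
  -- |ι|. The parametrization may depend on Q, but the constants do not.
  refine ⟨fun f ⟨a, ha, hf⟩ => hf ▸ hφ a ha, ((2 * R + 3) * M ^ k) ^ Fintype.card ι,
    k * Fintype.card ι, by positivity, by positivity, fun Q hQ ε hε hε1 => ?_⟩
  obtain ⟨c, hc, hcφ⟩ := h Q hQ
  have hM0 : 0 < M := by linarith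
  have hr : 0 < (ε / M) ^ k := by positivity
  have hr1 : (ε / M) ^ k ≤ 1 :=
    pow_le_one₀ (by positivity) (by rw [div_le_one hM0]; linarith)
  obtain ⟨T, hTA, hT, hnet⟩ := exists_finset_net A c hR hc hr hr1
  refine ⟨T.image φ, ?_, ?_, ?_⟩
  · intro g hg
    obtain ⟨a, ha, rfl⟩ := Finset.mem_image.1 (Finset.mem_coe.1 hg)
    exact ⟨a, hTA ha, rfl⟩
  · have h1 : ((T.image φ).card : ℝ) ≤ T.card := by exact_mod_cast Finset.card_image_le
    refine (h1.trans hT).trans (le_of_eq ?_)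
    have h2 : ε ^ (-((k : ℝ) * Fintype.card ι)) = ((ε ^ k)⁻¹) ^ Fintype.card ι := by
      rw [Real.rpow_neg hε.le, Real.rpow_mul hε.le, Real.rpow_natCast, Real.rpow_natCast, inv_pow]
    rw [h2, ← mul_pow]
    congr 1
    rw [div_pow]
    field_simp
  · rintro f ⟨a, ha, rfl⟩
    obtain ⟨b, hb, hab⟩ := hnet a ha
    exact ⟨φ b, Finset.mem_image_of_mem _ hb, hcφ a ha b (hTA hb) ε hε hε1 hab⟩

theorem eLpNorm_two_le_ofReal_of_abs_le {S : Type*} [MeasurableSpace S] {Q : Measure S}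
    [IsProbabilityMeasure Q] {f : S → ℝ} {C : ℝ} (h : ∀ w, |f w| ≤ C) :
    eLpNorm f 2 Q ≤ ENNReal.ofReal C := by
  have := eLpNorm_le_of_ae_bound (p := 2) (μ := Q) (f := f) (C := C)
    (Eventually.of_forall fun w => h w)
  simpa using this

theorem measurable_uniformKernel : Measurable uniformKernel :=
  Measurable.ite (measurableSet_le measurable_id.abs measurable_const) measurable_const
    measurable_const

/-- The intervals [-h, h] are nested, so the squared L²(Q) distance of two members is the difference
of their Q-masses. The mass Q[-h, h] in [0, 1] is thus a one-dimensional parameter, used with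
exponent 2. -/
theorem polynomialUniformCovering_uniformKernel (A : Set ℝ) (hA : ∀ h ∈ A, 0 < h) :
    PolynomialUniformCovering {g : ℝ → ℝ | ∃ h ∈ A, g = fun x => uniformKernel (x / h)} := by
  refine polynomialUniformCovering_of_param (ι := Unit) A (fun h x => uniformKernel (x / h))
    (fun h _ => measurable_uniformKernel.comp (measurable_id.div_const h)) (R := 1) (M := 1)
    zero_le_one le_rfl 2 two_ne_zero fun Q hQ => ?_
  refine ⟨fun h _ => Q.real (Set.Icc (-h) h), fun h _ _ => ?_, ?_⟩
  · rw [abs_of_nonneg measureReal_nonneg]; exact measureReal_le_one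
  have key : ∀ a ∈ A, ∀ b ∈ A, a ≤ b → ∀ ε : ℝ, 0 < ε →
      |Q.real (Set.Icc (-a) a) - Q.real (Set.Icc (-b) b)| ≤ ε ^ 2 →
      eLpNorm ((fun x => uniformKernel (x / b)) - fun x => uniformKernel (x / a)) 2 Q ≤
        ENNReal.ofReal ε := by
    intro a ha b hb hab ε hε h
    have ha0 := hA a ha
    have hb0 := hA b hb
    have hind : ((fun x => uniformKernel (x / b)) - fun x => uniformKernel (x / a)) =
        (Set.Icc (-b) b \ Set.Icc (-a) a).indicator fun _ => (1 : ℝ) := by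
      funext x
      have e : ∀ c, 0 < c → (uniformKernel (x / c) = if x ∈ Set.Icc (-c) c then 1 else 0) := by
        intro c hc
        simp only [uniformKernel, abs_div, abs_of_pos hc, div_le_one hc, abs_le, Set.mem_Icc]
      have hsub : x ∈ Set.Icc (-a) a → x ∈ Set.Icc (-b) b := fun hx =>
        ⟨by linarith [hx.1], by linarith [hx.2]⟩
      simp only [Pi.sub_apply, e a ha0, e b hb0, Set.indicator_apply, Set.mem_sdiff]
      by_cases h1 : x ∈ Set.Icc (-a) a
      · simp [h1, hsub h1]
      · by_cases h2 : x ∈ Set.Icc (-b) b <;> simp [h1, h2]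
    have hsub : Set.Icc (-a) a ⊆ Set.Icc (-b) b := Set.Icc_subset_Icc (by linarith) hab
    have hm : MeasurableSet (Set.Icc (-b) b \ Set.Icc (-a) a) :=
      measurableSet_Icc.diff measurableSet_Icc
    rw [hind, eLpNorm_indicator_const hm two_ne_zero ENNReal.ofNat_ne_top]
    have hd := measureReal_sdiff (μ := Q) hsub measurableSet_Icc
    have hle : Q.real (Set.Icc (-b) b \ Set.Icc (-a) a) ≤ ε ^ 2 := by
      rw [hd]; exact (le_abs_self _).trans (by rw [abs_sub_comm]; exact h)
    have hq : Q (Set.Icc (-b) b \ Set.Icc (-a) a) ≤ ENNReal.ofReal (ε ^ 2) :=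
      (ENNReal.le_ofReal_iff_toReal_le (measure_ne_top _ _) (by positivity)).2 hle
    have h3 : Q (Set.Icc (-b) b \ Set.Icc (-a) a) ^ (1 / ENNReal.toReal 2) ≤
        ENNReal.ofReal (ε ^ 2) ^ (1 / ENNReal.toReal 2) := ENNReal.rpow_le_rpow hq (by positivity)
    have h4 : ENNReal.ofReal (ε ^ 2) ^ (1 / ENNReal.toReal 2) = ENNReal.ofReal ε := by
      rw [ENNReal.ofReal_rpow_of_nonneg (by positivity) (by positivity)]
      congr 1
      rw [← Real.rpow_natCast, ← Real.rpow_mul hε.le]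
      norm_num
    simpa using h3.trans h4.le
  intro a ha b hb ε hε _ h
  have h' : |Q.real (Set.Icc (-a) a) - Q.real (Set.Icc (-b) b)| ≤ ε ^ 2 := by
    simpa using h ()
  rcases le_total a b with hab | hab
  · rw [eLpNorm_sub_comm]
    exact key a ha b hb hab ε hε h'
  · exact key b hb a ha hab ε hε (by rw [abs_sub_comm]; exact h')

theorem kernelRegular_uniformKernel : KernelRegular uniformKernel := by
  have hval : Set.EqOn uniformKernel (fun _ => 1) (Set.Icc (-1) 1) := fun u hu => by
    unfold uniformKernel; rw [if_pos (abs_le.2 hu)]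
  have hev : ∀ u ∈ Set.Ioo (0 : ℝ) 1, uniformKernel =ᶠ[𝓝 u] fun _ => 1 := fun u hu =>
    (hval.eventuallyEq_of_mem (Icc_mem_nhds (by linarith [hu.1]) hu.2))
  have hder : ∀ u ∈ Set.Ioo (0 : ℝ) 1, deriv uniformKernel u = 0 := fun u hu => by
    rw [(hev u hu).deriv_eq]; simp
  have hind : uniformKernel = (Set.Icc (-1) 1).indicator fun _ => (1 : ℝ) := by
    funext u
    unfold uniformKernel
    simp [Set.indicator_apply, abs_le]
  refine ⟨1, one_pos, fun u => by simp [uniformKernel], ?_, ⟨1, fun u => ?_⟩, ?_, ⟨0, ?_⟩, ?_, ?_⟩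
  · have : Function.support uniformKernel = Set.Icc (-1) 1 := by
      rw [hind]; ext u; simp
    rw [tsupport, this, isClosed_Icc.closure_eq]
  · unfold uniformKernel; split_ifs <;> simp
  · intro u hu
    exact ((differentiableAt_const _).congr_of_eventuallyEq (hev u hu)).differentiableWithinAt
  · intro u hu; rw [hder u hu, abs_zero]
  · exact ((uniformContinuous_const (b := (0 : ℝ))).uniformContinuousOn).congr
      (fun u hu => (hder u hu).symm)
  · rw [hind, integral_indicator measurableSet_Icc]; simp

/-! ### A maximal inequality for localized empirical processes -/

section Maximal

variable {Ω S : Type*} [MeasurableSpace Ω] [MeasurableSpace S]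

/-- The centred sum `∑_{i<n} (g(V_i) - E g(V_0))`. -/
noncomputable def devSum (μ : Measure Ω) (V : ℕ → Ω → S) (g : S → ℝ) (n : ℕ) (ω : Ω) : ℝ :=
  ∑ i ∈ Finset.range n, g (V i ω) - n * ∫ ω, g (V 0 ω) ∂μ

theorem integrable_comp_of_abs_le {μ : Measure Ω} [IsFiniteMeasure μ] {X : Ω → S}
    (hX : Measurable X) {g : S → ℝ} (hg : Measurable g) {C : ℝ} (hC : ∀ x, |g x| ≤ C) :
    Integrable (fun ω => g (X ω)) μ :=
  Integrable.of_bound (hg.comp hX).aestronglyMeasurable C (Eventually.of_forall fun _ => hC _)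

/-- Chebyshev's inequality; by independence the variances add, and each is at most the second
moment. -/
theorem measure_le_abs_devSum {μ : Measure Ω} [IsProbabilityMeasure μ] {V : ℕ → Ω → S}
    (hV : ∀ i, Measurable (V i)) (hind : iIndepFun V μ)
    (hid : ∀ i, IdentDistrib (V i) (V 0) μ μ) {g : S → ℝ} (hg : Measurable g) {C : ℝ}
    (hC : ∀ x, |g x| ≤ C) (n : ℕ) {x : ℝ} (hx : 0 < x) :
    μ {ω | x ≤ |devSum μ V g n ω|} ≤
      ENNReal.ofReal (n * (∫ ω, (g (V 0 ω)) ^ 2 ∂μ) / x ^ 2) := by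
  have hmem : ∀ i, MemLp (fun ω => g (V i ω)) 2 μ := fun i =>
    MemLp.of_bound (hg.comp (hV i)).aestronglyMeasurable C (Eventually.of_forall fun _ => hC _)
  have hint : ∀ i, ∫ ω, g (V i ω) ∂μ = ∫ ω, g (V 0 ω) ∂μ := fun i =>
    ((hid i).comp hg).integral_eq
  set T : Ω → ℝ := ∑ i ∈ Finset.range n, fun ω => g (V i ω) with hT
  have hTω : ∀ ω, T ω = ∑ i ∈ Finset.range n, g (V i ω) := fun ω => by
    rw [hT, Finset.sum_apply]
  have hTmem : MemLp T 2 μ := memLp_finsetSum' _ fun i _ => hmem i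
  have hTint : μ[T] = n * ∫ ω, g (V 0 ω) ∂μ := by
    simp only [hTω]
    rw [integral_finsetSum _ fun i _ => (hmem i).integrable one_le_two]
    simp [hint]
  have hvar : variance T μ ≤ n * ∫ ω, (g (V 0 ω)) ^ 2 ∂μ := by
    rw [hT, IndepFun.variance_sum (fun i _ => hmem i)]
    · have h1 : ∀ i, variance (fun ω => g (V i ω)) μ = variance (fun ω => g (V 0 ω)) μ := fun i =>
        ((hid i).comp hg).variance_eq
      simp only [h1, Finset.sum_const, Finset.card_range, nsmul_eq_mul]
      exact mul_le_mul_of_nonneg_left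
        (variance_le_expectation_sq (hmem 0).aestronglyMeasurable) (Nat.cast_nonneg n)
    · intro i _ j _ hij
      exact (hind.indepFun hij).comp hg hg
  have h := meas_ge_le_variance_div_sq hTmem hx
  rw [hTint] at h
  simp only [hTω] at h
  exact h.trans (ENNReal.ofReal_le_ofReal (by gcongr))

/-- For a nonnegative `ζ` both the sum and its mean increase with the set. So the sum over `B` lies
between those over `A` and `D`, whose means differ by at most n C P(D \ A). -/
theorem abs_devSum_le_of_sandwich {μ : Measure Ω} [IsProbabilityMeasure μ] {V : ℕ → Ω → S}
    (hV : Measurable (V 0)) {ζ : S → ℝ} (hζ : Measurable ζ) {C : ℝ} (h0 : ∀ x, 0 ≤ ζ x)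
    (hC : ∀ x, ζ x ≤ C) {A B D : Set S} (hA : MeasurableSet A) (hB : MeasurableSet B)
    (hD : MeasurableSet D) (hAB : A ⊆ B) (hBD : B ⊆ D) (n : ℕ) (ω : Ω) {y z : ℝ}
    (hy : |devSum μ V (A.indicator ζ) n ω| ≤ y) (hy' : |devSum μ V (D.indicator ζ) n ω| ≤ y)
    (hz : n * (C * (μ.real (V 0 ⁻¹' D) - μ.real (V 0 ⁻¹' A))) ≤ z) :
    |devSum μ V (B.indicator ζ) n ω| ≤ y + z := by
  have habs : ∀ (E : Set S) x, |E.indicator ζ x| ≤ C := fun E x => by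
    by_cases hx : x ∈ E
    · rw [Set.indicator_of_mem hx, abs_of_nonneg (h0 x)]; exact hC x
    · rw [Set.indicator_of_notMem hx, abs_zero]; exact (h0 x).trans (hC x)
  have hi : ∀ E : Set S, MeasurableSet E → Integrable (fun ω => E.indicator ζ (V 0 ω)) μ :=
    fun E hE => integrable_comp_of_abs_le hV (hζ.indicator hE) (habs E)
  have hmono : ∀ {E F : Set S}, E ⊆ F → ∀ x, E.indicator ζ x ≤ F.indicator ζ x :=
    fun h x => Set.indicator_le_indicator_of_subset h h0 x
  have hsum : ∀ {E F : Set S}, E ⊆ F → ∑ i ∈ Finset.range n, E.indicator ζ (V i ω) ≤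
      ∑ i ∈ Finset.range n, F.indicator ζ (V i ω) := fun h => Finset.sum_le_sum fun i _ => hmono h _
  have hmean : ∀ {E F : Set S}, MeasurableSet E → MeasurableSet F → E ⊆ F →
      ∫ ω, E.indicator ζ (V 0 ω) ∂μ ≤ ∫ ω, F.indicator ζ (V 0 ω) ∂μ := fun hE hF h =>
    integral_mono (hi _ hE) (hi _ hF) fun ω => hmono h _
  have hdiff : ∫ ω, D.indicator ζ (V 0 ω) ∂μ - ∫ ω, A.indicator ζ (V 0 ω) ∂μ ≤
      C * (μ.real (V 0 ⁻¹' D) - μ.real (V 0 ⁻¹' A)) := by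
    have e : ∀ E : Set S, MeasurableSet E →
        μ.real (V 0 ⁻¹' E) = ∫ ω, (V 0 ⁻¹' E).indicator (fun _ => (1 : ℝ)) ω ∂μ := fun E hE => by
      rw [integral_indicator (hV hE)]; simp
    have hi1 : ∀ E : Set S, MeasurableSet E →
        Integrable ((V 0 ⁻¹' E).indicator fun _ => (1 : ℝ)) μ := fun E hE =>
      (integrable_const 1).indicator (hV hE)
    rw [← integral_sub (hi D hD) (hi A hA), e D hD, e A hA, ← integral_sub (hi1 D hD) (hi1 A hA),
      ← integral_const_mul]
    refine integral_mono ((hi D hD).sub (hi A hA)) (((hi1 D hD).sub (hi1 A hA)).const_mul C)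
      fun ω => ?_
    have hAD := hAB.trans hBD
    by_cases ha : V 0 ω ∈ A
    · simp [ha, hAD ha]
    · by_cases hd : V 0 ω ∈ D
      · simpa [Set.indicator_apply, ha, hd] using hC _
      · simp [ha, hd]
  have hn : (0 : ℝ) ≤ n := Nat.cast_nonneg n
  have hd' := mul_le_mul_of_nonneg_left hdiff hn
  have s1 := hsum hAB
  have s2 := hsum hBD
  have m1 := mul_le_mul_of_nonneg_left (hmean hA hB hAB) hn
  have m2 := mul_le_mul_of_nonneg_left (hmean hB hD hBD) hn
  rw [abs_le] at hy hy' ⊢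
  unfold devSum at *
  constructor <;> linarith [hy.1, hy'.2]

/-- Telescoping, from 1 / s_{m+1}² ≤ (1 / s_m - 1 / s_{m+1}) / c; the first term 1 / b² is at most 1
/ (b c) since c ≤ b. The bound does not depend on the number of grid points, so no restriction on
`hi / lo` arises. -/
theorem sum_inv_sq_arith_le {b c : ℝ} (hb : 0 < b) (hc : 0 < c) (hcb : c ≤ b) (K : ℕ) :
    ∑ m ∈ Finset.range K, 1 / (b + c * m) ^ 2 ≤ 2 / (b * c) := by
  have key : ∀ K : ℕ, ∑ m ∈ Finset.range (K + 1), 1 / (b + c * m) ^ 2 ≤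
      1 / b ^ 2 + 1 / c * (1 / b - 1 / (b + c * K)) := by
    intro K
    induction K with
    | zero => simp
    | succ K ih =>
      rw [Finset.sum_range_succ]
      have h1 : 0 < b + c * K := by positivity
      have h2 : 0 < b + c * (K + 1 : ℕ) := by positivity
      have h3 : 1 / (b + c * (K + 1 : ℕ)) ^ 2 ≤
          1 / c * (1 / (b + c * K) - 1 / (b + c * (K + 1 : ℕ))) := by
        have : 1 / c * (1 / (b + c * K) - 1 / (b + c * (K + 1 : ℕ))) =
            1 / ((b + c * K) * (b + c * (K + 1 : ℕ))) := by
          field_simp; push_cast; ring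
        rw [this, sq]
        refine one_div_le_one_div_of_le (by positivity) ?_
        refine mul_le_mul_of_nonneg_right ?_ h2.le
        push_cast; linarith
      have : 1 / c * (1 / b - 1 / (b + c * (K + 1 : ℕ))) =
          1 / c * (1 / b - 1 / (b + c * K)) +
          1 / c * (1 / (b + c * K) - 1 / (b + c * (K + 1 : ℕ))) := by ring
      linarith
  have h1 : ∑ m ∈ Finset.range K, 1 / (b + c * m) ^ 2 ≤
      ∑ m ∈ Finset.range (K + 1), 1 / (b + c * m) ^ 2 := by
    rw [Finset.sum_range_succ]; linarith [show 0 ≤ 1 / (b + c * K) ^ 2 by positivity]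
  have h2 : 1 / b ^ 2 ≤ 1 / (b * c) := by
    refine one_div_le_one_div_of_le (by positivity) ?_
    rw [sq]; exact mul_le_mul_of_nonneg_left hcb hb.le
  have h3 : 1 / c * (1 / b - 1 / (b + c * K)) ≤ 1 / (b * c) := by
    have h4 : 1 / (b * c) = 1 / c * (1 / b) := by field_simp
    have h5 : 0 < 1 / (b + c * K) := by positivity
    rw [h4]
    exact mul_le_mul_of_nonneg_left (by linarith) (by positivity)
  have h6 : 2 / (b * c) = 1 / (b * c) + 1 / (b * c) := by ring
  linarith [key K]

theorem sqrt_sqrt_pow_four {x : ℝ} (hx : 0 ≤ x) : √(√x) ^ 4 = x := by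
  rw [show 4 = 2 * 2 by norm_num, pow_mul, Real.sq_sqrt (Real.sqrt_nonneg x), Real.sq_sqrt hx]

/-- At a grid point with (nh)^(1/4) = s the variance is of order s⁴ and the threshold x s³, so
Chebyshev gives a probability of order 1 / (x² s²), summable along an arithmetic progression of
values s. A step c of order x keeps the expected mass between neighbouring grid points below the
threshold. -/
theorem measure_exists_lt_abs_devSum_le {μ : Measure Ω} [IsProbabilityMeasure μ] {V : ℕ → Ω → S}
    (hV : ∀ i, Measurable (V i)) (hind : iIndepFun V μ)
    (hid : ∀ i, IdentDistrib (V i) (V 0) μ μ) {ζ : S → ℝ} (hζ : Measurable ζ) {C : ℝ}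
    (h0 : ∀ x, 0 ≤ ζ x) (hC : ∀ x, ζ x ≤ C) {A : ℝ → Set S} (hA : ∀ h, MeasurableSet (A h))
    (hmono : Monotone A) {t L : ℝ} (hL : 0 ≤ L)
    (hA1 : ∀ h, 0 < h → h ≤ t → μ.real (V 0 ⁻¹' A h) ≤ L * h)
    (hA2 : ∀ h h', 0 < h → h ≤ h' → h' ≤ t →
      μ.real (V 0 ⁻¹' A h') - μ.real (V 0 ⁻¹' A h) ≤ L * (h' - h))
    {n : ℕ} (hn : 0 < n) {lo hi : ℝ} (hlo : 0 < lo) (hhi : lo ≤ hi) (ht : 16 * hi ≤ t)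
    {c x : ℝ} (hc : 0 < c) (hcb : c ≤ √√(n * lo)) (hx : 0 < x) (hcx : 30 * (C * L * c) ≤ x) :
    μ {ω | ∃ h ∈ Set.Icc lo hi,
        x * √√(n * h) ^ 3 < |devSum μ V ((A h).indicator ζ) n ω|} ≤
      ENNReal.ofReal (512 * C ^ 2 * L / (x ^ 2 * (√√(n * lo) * c))) := by
  set b := √√(n * lo) with hb
  have hn' : (0 : ℝ) < n := by exact_mod_cast hn
  have hb0 : 0 < b := hc.trans_le hcb
  obtain ⟨ω₀⟩ := μ.nonempty_of_neZero
  have hCn : 0 ≤ C := (h0 (V 0 ω₀)).trans (hC _)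
  -- Grid values of (nh)^(1/4), starting at `b` with step `c`; `g m` is the corresponding bandwidth.
  let s : ℕ → ℝ := fun m => b + c * m
  have hs0 : ∀ m, 0 < s m := fun m => by positivity
  let g : ℕ → ℝ := fun m => s m ^ 4 / n
  have hg0 : ∀ m, 0 < g m := fun m => by have := hs0 m; positivity
  -- Neighbouring grid values differ at most by a factor 2, because c ≤ b. This is the source of the
  -- constants 16 = 2⁴ in the range condition on `hi` and 16 = 2 · 2³ in the grid thresholds.
  have hsbig : ∀ m, s (m + 1) ≤ 2 * s m := fun m => by
    have : 0 ≤ c * m := by positivity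
    simp only [s]; push_cast; linarith
  let idx : ℝ → ℕ := fun h => ⌊(√√(n * h) - b) / c⌋₊
  have hroot : ∀ h, lo ≤ h → b ≤ √√(n * h) := fun h hh =>
    Real.sqrt_le_sqrt (Real.sqrt_le_sqrt (mul_le_mul_of_nonneg_left hh hn'.le))
  have hidx1 : ∀ h, lo ≤ h → s (idx h) ≤ √√(n * h) := fun h hh => by
    have := Nat.floor_le (div_nonneg (sub_nonneg.2 (hroot h hh)) hc.le)
    rw [le_div_iff₀ hc] at this
    simp only [s, idx]; linarith
  have hidx2 : ∀ h, √√(n * h) < s (idx h + 1) := fun h => by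
    have := Nat.lt_floor_add_one ((√√(n * h) - b) / c)
    rw [div_lt_iff₀ hc] at this
    simp only [s, idx]; push_cast; linarith
  set M := idx hi
  have hsmono : ∀ {m k : ℕ}, m ≤ k → s m ≤ s k := fun {m k} h => by
    have : (m : ℝ) ≤ k := by exact_mod_cast h
    have := mul_le_mul_of_nonneg_left this hc.le
    simp only [s]; linarith
  -- The grid overshoots `hi` by one point, whose bandwidth is at most 16 `hi`, still in the range
  -- where the distribution is controlled.
  have hgt : ∀ m, m < M + 2 → g m ≤ t := by
    intro m hm
    have h1 : s m ≤ 2 * √√(n * hi) :=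
      (hsmono (Nat.lt_succ_iff.1 hm)).trans ((hsbig M).trans (by linarith [hidx1 hi hhi]))
    have h2 : s m ^ 4 ≤ (2 * √√(n * hi)) ^ 4 := pow_le_pow_left₀ (hs0 m).le h1 4
    rw [mul_pow, sqrt_sqrt_pow_four (mul_nonneg hn'.le (hlo.le.trans hhi))] at h2
    simp only [g]
    rw [div_le_iff₀ hn']
    nlinarith
  let bad : ℕ → Set Ω := fun m =>
    {ω | x / 16 * s m ^ 3 ≤ |devSum μ V ((A (g m)).indicator ζ) n ω|}
  have hbad : ∀ m, m < M + 2 → μ (bad m) ≤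
      ENNReal.ofReal (256 * C ^ 2 * L / x ^ 2 * (1 / (b + c * m) ^ 2)) := by
    intro m hm
    have hsm := hs0 m
    have habs : ∀ y, |(A (g m)).indicator ζ y| ≤ C := fun y => by
      by_cases hy : y ∈ A (g m)
      · rw [Set.indicator_of_mem hy, abs_of_nonneg (h0 y)]; exact hC y
      · rw [Set.indicator_of_notMem hy, abs_zero]; exact hCn
    refine (measure_le_abs_devSum hV hind hid (hζ.indicator (hA (g m))) habs n
      (by positivity : 0 < x / 16 * s m ^ 3)).trans (ENNReal.ofReal_le_ofReal ?_)
    have h1 : ∫ ω, ((A (g m)).indicator ζ (V 0 ω)) ^ 2 ∂μ ≤ C ^ 2 * μ.real (V 0 ⁻¹' A (g m)) := by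
      have : C ^ 2 * μ.real (V 0 ⁻¹' A (g m)) =
          ∫ ω, (V 0 ⁻¹' A (g m)).indicator (fun _ => C ^ 2) ω ∂μ := by
        rw [integral_indicator (hV 0 (hA _))]; simp [mul_comm]
      rw [this]
      refine integral_mono_of_nonneg (Eventually.of_forall fun _ => sq_nonneg _)
        ((integrable_const _).indicator (hV 0 (hA _))) (Eventually.of_forall fun ω => ?_)
      by_cases hy : V 0 ω ∈ A (g m)
      · simpa [Set.indicator_apply, hy] using pow_le_pow_left₀ (h0 _) (hC _) 2
      · simp [hy]
    have h2 := hA1 (g m) (hg0 m) (hgt m hm)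
    have h3 : n * ∫ ω, ((A (g m)).indicator ζ (V 0 ω)) ^ 2 ∂μ ≤ C ^ 2 * L * s m ^ 4 := by
      calc _ ≤ n * (C ^ 2 * (L * g m)) := by gcongr; exact h1.trans (by gcongr)
        _ = _ := by simp only [g]; field_simp
    calc _ ≤ C ^ 2 * L * s m ^ 4 / (x / 16 * s m ^ 3) ^ 2 := by gcongr
      _ = 256 * C ^ 2 * L / x ^ 2 * (1 / s m ^ 2) := by field_simp; norm_num
  have hsub : {ω | ∃ h ∈ Set.Icc lo hi,
      x * √√(n * h) ^ 3 < |devSum μ V ((A h).indicator ζ) n ω|} ⊆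
      ⋃ m ∈ Finset.range (M + 2), bad m := by
    rintro ω ⟨h, ⟨hl, hh⟩, hω⟩
    by_contra hnot
    simp only [Set.mem_iUnion, Finset.mem_range, not_exists, bad, Set.mem_ofPred_eq, not_le] at hnot
    have hh0 : 0 < h := hlo.trans_le hl
    set m := idx h with hm
    have hmM : m ≤ M := Nat.floor_le_floor (div_le_div_of_nonneg_right (sub_le_sub_right
      (Real.sqrt_le_sqrt (Real.sqrt_le_sqrt (mul_le_mul_of_nonneg_left hh hn'.le))) _) hc.le)
    have hr4 : √√(n * h) ^ 4 = n * h := sqrt_sqrt_pow_four (by positivity)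
    have hg1 : g m ≤ h := by
      have := pow_le_pow_left₀ (hs0 m).le (hidx1 h hl) 4
      rw [hr4] at this
      simp only [g]; rw [div_le_iff₀ hn']; linarith
    have hg2 : h ≤ g (m + 1) := by
      have := pow_le_pow_left₀ (Real.sqrt_nonneg _) (hidx2 h).le 4
      rw [hr4] at this
      simp only [g]; rw [le_div_iff₀ hn']; linarith
    have hsm := hs0 m
    have d1 := (hnot m (by omega)).le
    have d2 := (hnot (m + 1) (by omega)).le
    -- Both grid deviations are now at most half of x s_m³; the other half pays for the mass between
    -- the grid points.
    have d3 : x / 16 * s (m + 1) ^ 3 ≤ x / 2 * s m ^ 3 := by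
      have := pow_le_pow_left₀ (hs0 (m + 1)).le (hsbig m) 3
      nlinarith
    have d4 : x / 16 * s m ^ 3 ≤ x / 2 * s m ^ 3 := by
      have : 0 < s m ^ 3 := by positivity
      nlinarith
    have d5 : n * (C * (μ.real (V 0 ⁻¹' A (g (m + 1))) - μ.real (V 0 ⁻¹' A (g m)))) ≤
        x / 2 * s m ^ 3 := by
      have h1 := hA2 (g m) (g (m + 1)) (hg0 m) (hg1.trans hg2) (hgt _ (by omega))
      -- Expand (s + c)⁴ - s⁴ with c ≤ s: 4 + 6 + 4 + 1 = 15.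
      have h2 : n * (g (m + 1) - g m) ≤ 15 * c * s m ^ 3 := by
        have h3 : n * (g (m + 1) - g m) = s (m + 1) ^ 4 - s m ^ 4 := by
          simp only [g]; field_simp
        have h4 : s (m + 1) = s m + c := by simp only [s]; push_cast; ring
        have h5 : c ≤ s m := by
          have : 0 ≤ c * m := by positivity
          simp only [s]; linarith
        rw [h3, h4]
        have e1 : c * (s m) ^ 2 * c ≤ c * (s m) ^ 2 * s m :=
          mul_le_mul_of_nonneg_left h5 (by positivity)
        have e2 : c * s m * (c * c) ≤ c * s m * (s m * s m) :=
          mul_le_mul_of_nonneg_left (mul_le_mul h5 h5 hc.le hsm.le) (by positivity)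
        have e3 : c * c ^ 3 ≤ c * s m ^ 3 :=
          mul_le_mul_of_nonneg_left (pow_le_pow_left₀ hc.le h5 3) hc.le
        nlinarith
      have h6 : C * L * (n * (g (m + 1) - g m)) ≤ C * L * (15 * c * s m ^ 3) :=
        mul_le_mul_of_nonneg_left h2 (by positivity)
      have h7 : n * (C * (μ.real (V 0 ⁻¹' A (g (m + 1))) - μ.real (V 0 ⁻¹' A (g m)))) ≤
          n * (C * (L * (g (m + 1) - g m))) := by gcongr
      have h8 : 30 * (C * L * c) * s m ^ 3 ≤ x * s m ^ 3 :=
        mul_le_mul_of_nonneg_right hcx (by positivity)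
      linarith
    have h9 := abs_devSum_le_of_sandwich (hV 0) hζ h0 hC (hA _) (hA h) (hA _) (hmono hg1)
      (hmono hg2) n ω (d1.trans d4) (d2.trans d3) d5
    have h10 : x * s m ^ 3 ≤ x * √√(n * h) ^ 3 :=
      mul_le_mul_of_nonneg_left (pow_le_pow_left₀ hsm.le (hidx1 h hl) 3) hx.le
    linarith
  calc _ ≤ μ (⋃ m ∈ Finset.range (M + 2), bad m) := measure_mono hsub
    _ ≤ ∑ m ∈ Finset.range (M + 2), μ (bad m) := measure_biUnion_finset_le _ _
    _ ≤ ∑ m ∈ Finset.range (M + 2),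
          ENNReal.ofReal (256 * C ^ 2 * L / x ^ 2 * (1 / (b + c * m) ^ 2)) :=
        Finset.sum_le_sum fun m hm => hbad m (Finset.mem_range.1 hm)
    _ = ENNReal.ofReal (256 * C ^ 2 * L / x ^ 2 *
          ∑ m ∈ Finset.range (M + 2), 1 / (b + c * m) ^ 2) := by
        rw [Finset.mul_sum, ENNReal.ofReal_sum_of_nonneg fun m _ => by positivity]
    _ ≤ ENNReal.ofReal (256 * C ^ 2 * L / x ^ 2 * (2 / (b * c))) :=
        ENNReal.ofReal_le_ofReal
          (mul_le_mul_of_nonneg_left (sum_inv_sq_arith_le hb0 hc hcb _) (by positivity))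
    _ = _ := by congr 1; field_simp; ring

/-- With tolerance x = e / lam and a grid step proportional to x, the bound is a constant times 1 /
(x³ (n hlo)^(1/4)), that is lam³ / (n hlo)^(1/4). -/
theorem tendsto_measure_exists_lt_abs_devSum_of_nonneg {μ : Measure Ω} [IsProbabilityMeasure μ]
    {V : ℕ → Ω → S} (hV : ∀ i, Measurable (V i)) (hind : iIndepFun V μ)
    (hid : ∀ i, IdentDistrib (V i) (V 0) μ μ) {ζ : S → ℝ} (hζ : Measurable ζ) {C : ℝ}
    (h0 : ∀ x, 0 ≤ ζ x) (hC : ∀ x, ζ x ≤ C) {A : ℝ → Set S} (hA : ∀ h, MeasurableSet (A h))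
    (hmono : Monotone A) {t L : ℝ} (hL : 0 ≤ L)
    (hA1 : ∀ h, 0 < h → h ≤ t → μ.real (V 0 ⁻¹' A h) ≤ L * h)
    (hA2 : ∀ h h', 0 < h → h ≤ h' → h' ≤ t →
      μ.real (V 0 ⁻¹' A h') - μ.real (V 0 ⁻¹' A h) ≤ L * (h' - h))
    {hlo hhi lam : ℕ → ℝ} (hh : ∀ n, 0 < hlo n ∧ hlo n ≤ hhi n ∧ 16 * hhi n ≤ t)
    (hlam : ∀ n, 1 ≤ lam n) (hlim : Tendsto (fun n : ℕ => √√(n * hlo n) / lam n ^ 3) atTop atTop)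
    {e : ℝ} (he : 0 < e) :
    Tendsto (fun n : ℕ => μ {ω | ∃ h ∈ Set.Icc (hlo n) (hhi n),
      e / lam n * √√(n * h) ^ 3 < |devSum μ V ((A h).indicator ζ) n ω|}) atTop (𝓝 0) := by
  obtain ⟨ω₀⟩ := μ.nonempty_of_neZero
  have hCn : 0 ≤ C := (h0 (V 0 ω₀)).trans (hC _)
  have hCL : 0 ≤ C * L := mul_nonneg hCn hL
  set D := 512 * C ^ 2 * L * (30 * (C * L + 1)) / e ^ 3 with hD
  have hbound : Tendsto (fun n : ℕ => ENNReal.ofReal (D * (√√(n * hlo n) / lam n ^ 3)⁻¹))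
      atTop (𝓝 0) := by
    rw [← ENNReal.ofReal_zero]
    refine ENNReal.tendsto_ofReal ?_
    simpa using hlim.inv_tendsto_atTop.const_mul D
  refine tendsto_of_tendsto_of_tendsto_of_le_of_le' tendsto_const_nhds hbound
    (Eventually.of_forall fun _ => zero_le) ?_
  filter_upwards [hlim.eventually_ge_atTop (e / (30 * (C * L + 1))), eventually_gt_atTop 0]
    with n hn hn0
  obtain ⟨h1, h2, h3⟩ := hh n
  have hl := hlam n
  have hl0 : 0 < lam n := by linarith
  have hb0 : 0 < √√((n : ℝ) * hlo n) := by
    have : (0 : ℝ) < n := by exact_mod_cast hn0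
    positivity
  have hle : e / lam n / (30 * (C * L + 1)) ≤ √√(n * hlo n) := by
    calc e / lam n / (30 * (C * L + 1)) ≤ e / (30 * (C * L + 1)) :=
          div_le_div_of_nonneg_right (div_le_self he.le hl) (by positivity)
      _ ≤ _ := hn
      _ ≤ _ := div_le_self hb0.le (one_le_pow₀ hl)
  -- The step is the tolerance divided by 30 (C L + 1); the added 1 keeps the denominator positive
  -- when C L = 0.
  refine (measure_exists_lt_abs_devSum_le hV hind hid hζ h0 hC hA hmono hL hA1 hA2 hn0 h1 h2 h3
    (c := e / lam n / (30 * (C * L + 1))) (by positivity) hle (by positivity) ?_).trans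
    (le_of_eq ?_)
  · have : 30 * (C * L * (e / lam n / (30 * (C * L + 1)))) =
        e / lam n * (C * L / (C * L + 1)) := by field_simp
    rw [this]
    exact mul_le_of_le_one_right (by positivity) ((div_le_one (by positivity)).2 (by linarith))
  · congr 1
    rw [hD]
    field_simp

/-- Uniformly over `h ∈ [hlo n, hhi n]`, the centred sums over `A h` are at most of the order
`(n h) ^ (3 / 4) / lam n`. -/
theorem tendsto_measure_exists_lt_abs_devSum {μ : Measure Ω} [IsProbabilityMeasure μ]
    {V : ℕ → Ω → S} (hV : ∀ i, Measurable (V i)) (hind : iIndepFun V μ)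
    (hid : ∀ i, IdentDistrib (V i) (V 0) μ μ) {ζ : S → ℝ} (hζ : Measurable ζ) {C : ℝ}
    (hC : ∀ x, |ζ x| ≤ C) {A : ℝ → Set S} (hA : ∀ h, MeasurableSet (A h))
    (hmono : Monotone A) {t L : ℝ} (hL : 0 ≤ L)
    (hA1 : ∀ h, 0 < h → h ≤ t → μ.real (V 0 ⁻¹' A h) ≤ L * h)
    (hA2 : ∀ h h', 0 < h → h ≤ h' → h' ≤ t →
      μ.real (V 0 ⁻¹' A h') - μ.real (V 0 ⁻¹' A h) ≤ L * (h' - h))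
    {hlo hhi lam : ℕ → ℝ} (hh : ∀ n, 0 < hlo n ∧ hlo n ≤ hhi n ∧ 16 * hhi n ≤ t)
    (hlam : ∀ n, 1 ≤ lam n) (hlim : Tendsto (fun n : ℕ => √√(n * hlo n) / lam n ^ 3) atTop atTop)
    {e : ℝ} (he : 0 < e) :
    Tendsto (fun n : ℕ => μ {ω | ∃ h ∈ Set.Icc (hlo n) (hhi n),
      e / lam n * √√(n * h) ^ 3 < |devSum μ V ((A h).indicator ζ) n ω|}) atTop (𝓝 0) := by
  obtain ⟨ω₀⟩ := μ.nonempty_of_neZero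
  have hCn : 0 ≤ C := (abs_nonneg _).trans (hC (V 0 ω₀))
  -- Write `ζ` as (ζ + C) - C, a difference of nonnegative functions, each allowed half of the
  -- tolerance.
  have t1 := tendsto_measure_exists_lt_abs_devSum_of_nonneg hV hind hid
    (hζ.add measurable_const) (ζ := fun x => ζ x + C) (C := 2 * C)
    (fun x => by linarith [(abs_le.1 (hC x)).1]) (fun x => by linarith [(abs_le.1 (hC x)).2])
    hA hmono hL hA1 hA2 hh hlam hlim (half_pos he)
  have t2 := tendsto_measure_exists_lt_abs_devSum_of_nonneg hV hind hid
    measurable_const (ζ := fun _ => C) (C := C) (fun _ => hCn) (fun _ => le_rfl)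
    hA hmono hL hA1 hA2 hh hlam hlim (half_pos he)
  have t3 := t1.add t2
  rw [add_zero] at t3
  refine tendsto_of_tendsto_of_tendsto_of_le_of_le tendsto_const_nhds t3
    (fun _ => zero_le) fun n => ?_
  refine (measure_mono ?_).trans (measure_union_le _ _)
  rintro ω ⟨h, hh', hω⟩
  by_contra hnot
  simp only [Set.mem_union, Set.mem_ofPred_eq, not_or, not_exists, not_and, not_lt] at hnot
  have a1 := hnot.1 h hh'
  have a2 := hnot.2 h hh'
  have hi : ∀ ξ : S → ℝ, Measurable ξ → (∀ x, |ξ x| ≤ 2 * C) →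
      Integrable (fun ω => (A h).indicator ξ (V 0 ω)) μ := fun ξ hξ hb =>
    integrable_comp_of_abs_le (hV 0) (hξ.indicator (hA h)) (C := 2 * C) fun x => by
      by_cases hx : x ∈ A h
      · rw [Set.indicator_of_mem hx]; exact hb x
      · rw [Set.indicator_of_notMem hx, abs_zero]; linarith
  have hsplit : ∀ x, (A h).indicator ζ x =
      (A h).indicator (fun x => ζ x + C) x - (A h).indicator (fun _ => C) x := fun x => by
    by_cases hx : x ∈ A h <;> simp [hx]
  have hdev : devSum μ V ((A h).indicator ζ) n ω =
      devSum μ V ((A h).indicator fun x => ζ x + C) n ω -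
        devSum μ V ((A h).indicator fun _ => C) n ω := by
    unfold devSum
    simp only [hsplit]
    rw [Finset.sum_sub_distrib, integral_sub]
    · ring
    · exact hi _ (hζ.add measurable_const) fun x => by
        have := abs_le.1 (hC x); rw [abs_le]; constructor <;> linarith
    · exact hi _ measurable_const fun x => by rw [abs_of_nonneg hCn]; linarith
  rw [hdev] at hω
  have := abs_sub (devSum μ V ((A h).indicator fun x => ζ x + C) n ω)
    (devSum μ V ((A h).indicator fun _ => C) n ω)
  have h5 : e / 2 / lam n * √√(n * h) ^ 3 = e / lam n * √√(n * h) ^ 3 / 2 := by ring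
  linarith

end Maximal

/-! ### Moments near the endpoints -/

theorem LogLogCont.const {E : Type*} [NormedAddCommGroup E] (c : E) :
    LogLogCont (fun _ => c) := by
  simp [LogLogCont]

theorem LogLogCont.prodMk {E F : Type*} [NormedAddCommGroup E] [NormedAddCommGroup F]
    {g : ℝ → E} {k : ℝ → F} (hg : LogLogCont g) (hk : LogLogCont k) :
    LogLogCont (fun t => (g t, k t)) :=
  Asymptotics.IsLittleO.prod_left hg hk

theorem LogLogCont.add {g k : ℝ → ℝ} (hg : LogLogCont g) (hk : LogLogCont k) :
    LogLogCont (fun t => g t + k t) :=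
  (hg.prodMk hk).comp (φ := fun p => p.1 + p.2) (by fun_prop)

theorem LogLogCont.mul {g k : ℝ → ℝ} (hg : LogLogCont g) (hk : LogLogCont k) :
    LogLogCont (fun t => g t * k t) :=
  (hg.prodMk hk).comp (φ := fun p => p.1 * p.2) (by fun_prop)

theorem LogLogCont.pi {ι : Type*} [Fintype ι] {E : ι → Type*} [∀ i, NormedAddCommGroup (E i)]
    {g : ℝ → ∀ i, E i} (h : ∀ i, LogLogCont fun t => g t i) : LogLogCont g :=
  Asymptotics.isLittleO_pi.2 h

theorem LogLogCont.of_abs_le {g ℓ : ℝ → ℝ} (hℓ : LogLogModulus ℓ)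
    (h : ∀ᶠ t in 𝓝[>] 0, |g t - g 0| ≤ ℓ t) : LogLogCont g := by
  refine (Asymptotics.IsBigO.of_bound 1 ?_).trans_isLittleO (logLogModulus_iff.1 hℓ)
  filter_upwards [h] with t ht
  rw [one_mul]
  exact ht.trans (le_abs_self _)

/-- A quantity bounded by suprema of a quantity with the rate has the rate. -/
theorem LogLogCont.of_forall_le {E F : Type*} [NormedAddCommGroup E] [NormedAddCommGroup F]
    {g : ℝ → E} {k : ℝ → F} (hg : LogLogCont g) {r : ℝ} (hr : 0 < r)
    (h : ∀ t c, 0 < t → t < r → (∀ s, 0 < s → s ≤ t → ‖g s - g 0‖ ≤ c) → ‖k t - k 0‖ ≤ c) :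
    LogLogCont k := by
  refine Asymptotics.isLittleO_iff.2 fun ε hε => ?_
  have h1 := (Asymptotics.isLittleO_iff.1 hg) hε
  obtain ⟨a, ha, h2⟩ := mem_nhdsGT_iff_exists_Ioo_subset.1 h1
  obtain ⟨b, hb, h3⟩ := mem_nhdsGT_iff_exists_Ioo_subset.1
    (tendsto_loglog_inv.eventually_gt_atTop 0)
  have hc : 0 < min (min r 1) (min a b) := by
    have ha' : 0 < a := ha
    have hb' : 0 < b := hb
    positivity
  filter_upwards [Ioo_mem_nhdsGT hc] with t ht
  have ht0 : 0 < t := ht.1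
  simp only [Set.mem_Ioo, lt_min_iff] at ht
  refine h t _ ht0 ht.2.1.1 fun s hs hst => ?_
  refine (h2 (show s ∈ Set.Ioo 0 a from ⟨hs, hst.trans_lt ht.2.2.1⟩)).trans ?_
  have ht1 : 0 < Real.log (Real.log t⁻¹) := h3 ⟨ht0, ht.2.2.2⟩
  have hs1 : 0 < Real.log (Real.log s⁻¹) := h3 ⟨hs, hst.trans_lt ht.2.2.2⟩
  have hlog : 0 < Real.log t⁻¹ := Real.log_pos ((one_lt_inv₀ ht0).2 ht.2.1.2)
  -- The rate 1 / log log t⁻¹ is increasing in small `t`, so the rate at `t` dominates that at every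
  -- smaller `s`.
  have hle : Real.log (Real.log t⁻¹) ≤ Real.log (Real.log s⁻¹) := by
    refine Real.log_le_log hlog (Real.log_le_log (inv_pos.2 ht0) ?_)
    exact inv_anti₀ hs hst
  rw [Real.norm_of_nonneg (inv_pos.2 hs1).le, Real.norm_of_nonneg (inv_pos.2 ht1).le]
  exact mul_le_mul_of_nonneg_left (inv_anti₀ ht1 hle) hε.le

/-- Truncation to `[0, 1]`. -/
noncomputable def clampD (d : ℝ) : ℝ := max 0 (min d 1)

/-- Truncation to `[-B, B]`. -/
noncomputable def clampY (B y : ℝ) : ℝ := max (-B) (min y B)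

theorem abs_clampD_le (d : ℝ) : |clampD d| ≤ 1 := by
  rw [abs_of_nonneg (le_max_left _ _)]
  exact max_le zero_le_one (min_le_right _ _)

theorem abs_clampY_le {B : ℝ} (hB : 0 ≤ B) (y : ℝ) : |clampY B y| ≤ B :=
  abs_le.2 ⟨le_max_left _ _, max_le (by linarith) (min_le_right _ _)⟩

theorem clampD_eq {d : ℝ} (h : d = 0 ∨ d = 1) : clampD d = d := by
  rcases h with rfl | rfl <;> simp [clampD]

theorem clampY_eq {B y : ℝ} (h : |y| ≤ B) : clampY B y = y := by
  rw [abs_le] at h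
  rw [clampY, min_eq_left h.2, max_eq_right h.1]

theorem measurable_clampD : Measurable clampD := by unfold clampD; fun_prop

theorem measurable_clampY (B : ℝ) : Measurable (clampY B) := by unfold clampY; fun_prop

/-- The functions `1, D, Y, D Y, Y²` of `(D, Y)`, truncated. -/
noncomputable def mom (B : ℝ) (j : Fin 5) (p : ℝ × ℝ) : ℝ :=
  ![1, clampD p.1, clampY B p.2, clampD p.1 * clampY B p.2, clampY B p.2 ^ 2] j

theorem measurable_mom (B : ℝ) (j : Fin 5) : Measurable (mom B j) := by
  have h1 : Measurable fun p : ℝ × ℝ => clampD p.1 := measurable_clampD.comp measurable_fst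
  have h2 : Measurable fun p : ℝ × ℝ => clampY B p.2 := (measurable_clampY B).comp measurable_snd
  fin_cases j
  · exact measurable_const
  · exact h1
  · exact h2
  · exact h1.mul h2
  · exact h2.pow_const 2

/-- The bound holds at every point, not only almost surely: this is the purpose of the truncation.
Covering numbers are taken under arbitrary Q, which need not respect the support of (D, Y). -/
theorem abs_mom_le {B : ℝ} (hB : 0 ≤ B) (j : Fin 5) (p : ℝ × ℝ) : |mom B j p| ≤ (1 + B) ^ 2 := by
  have h1 := abs_clampD_le p.1
  have h2 := abs_clampY_le hB p.2
  fin_cases j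
  · show |(1 : ℝ)| ≤ _
    rw [abs_one]; nlinarith
  · show |clampD p.1| ≤ _
    nlinarith
  · show |clampY B p.2| ≤ _
    nlinarith
  · show |clampD p.1 * clampY B p.2| ≤ _
    rw [abs_mul]
    nlinarith [mul_le_mul h1 h2 (abs_nonneg _) zero_le_one]
  · show |clampY B p.2 ^ 2| ≤ _
    rw [abs_pow]
    nlinarith [mul_le_mul h2 h2 (abs_nonneg _) hB]

/-- The endpoint coordinate: the point at depth `t` from the endpoint `s`. -/
noncomputable def inward (zl zh : ℝ) (s : Bool) (t : ℝ) : ℝ := if s then zh - t else zl + t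

/-- The depth of `z`, measured from the endpoint `s`. -/
noncomputable def depth (zl zh : ℝ) (s : Bool) (z : ℝ) : ℝ := if s then zh - z else z - zl

theorem depth_inward (zl zh : ℝ) (s : Bool) (t : ℝ) : depth zl zh s (inward zl zh s t) = t := by
  cases s <;> simp [depth, inward]

theorem inward_depth (zl zh : ℝ) (s : Bool) (z : ℝ) : inward zl zh s (depth zl zh s z) = z := by
  cases s <;> simp [depth, inward]

theorem measurable_depth (zl zh : ℝ) (s : Bool) : Measurable (depth zl zh s) := by
  cases s
  · exact measurable_id.sub_const zl
  · exact measurable_const.sub measurable_id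

theorem measurable_inward (zl zh : ℝ) (s : Bool) : Measurable (inward zl zh s) := by
  cases s
  · exact measurable_const.add measurable_id
  · exact measurable_const.sub measurable_id

theorem measurePreserving_inward (zl zh : ℝ) (s : Bool) :
    MeasurePreserving (inward zl zh s) volume volume := by
  cases s
  · exact measurePreserving_add_left volume zl
  · exact Measure.measurePreserving_sub_left volume zh

/-- The assumptions on one observation. -/
structure LateDesign {Ω : Type*} [MeasurableSpace Ω] (μ : Measure Ω) (Z D Y : Ω → ℝ)
    (zl zh B δ : ℝ) (f : ℝ → ℝ) (κ : Kernel ℝ (ℝ × ℝ)) : Prop where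
  measurable_Z : Measurable Z
  measurable_D : Measurable D
  measurable_Y : Measurable Y
  lt : zl < zh
  mem_Z : ∀ᵐ ω ∂μ, Z ω ∈ Set.Icc zl zh
  binary_D : ∀ᵐ ω ∂μ, D ω = 0 ∨ D ω = 1
  bounded_Y : ∀ᵐ ω ∂μ, |Y ω| ≤ B
  nonneg_B : 0 ≤ B
  pos_δ : 0 < δ
  measurable_f : Measurable f
  nonneg_f : ∀ z, 0 ≤ f z
  density : (μ.map Z).restrict (Set.Iio (zl + δ) ∪ Set.Ioi (zh - δ)) =
      (volume.restrict (Set.Iio (zl + δ) ∪ Set.Ioi (zh - δ))).withDensity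
        (fun z => ENNReal.ofReal (f z))
  condDistrib : HasCondDistrib (fun ω => (D ω, Y ω)) Z κ μ
  support : ∀ z, ∀ᵐ p ∂(κ z), (p.1 = 0 ∨ p.1 = 1) ∧ |p.2| ≤ B

/-- Density times conditional moments, at depth `t` from the endpoints. -/
noncomputable def densMom (f : ℝ → ℝ) (κ : Kernel ℝ (ℝ × ℝ)) (B zl zh t : ℝ) : Moments :=
  fun s j => f (inward zl zh s t) * ∫ p, mom B j p ∂(κ (inward zl zh s t))

/-- The moments over the sets of points within a distance `h` of the endpoints, divided by `h`;
at `h = 0` their limits. -/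
noncomputable def lateMom {Ω : Type*} [MeasurableSpace Ω] (μ : Measure Ω) (Z D Y : Ω → ℝ)
    (f : ℝ → ℝ) (κ : Kernel ℝ (ℝ × ℝ)) (B zl zh h : ℝ) : Moments :=
  if h = 0 then densMom f κ B zl zh 0 else fun s j =>
    h⁻¹ * ∫ ω in {ω | depth zl zh s (Z ω) ∈ Set.Icc 0 h}, mom B j (D ω, Y ω) ∂μ

theorem ContAtEndpoints.logLogCont {ℓ g : ℝ → ℝ} {zl zh : ℝ} (hℓ : LogLogModulus ℓ)
    (h : ContAtEndpoints ℓ zl zh g) (s : Bool) :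
    LogLogCont fun t => g (inward zl zh s t) := by
  refine LogLogCont.of_abs_le hℓ ?_
  cases s
  · have ht : Tendsto (fun t => zl + t) (𝓝[>] 0) (𝓝[>] zl) := by
      refine tendsto_nhdsWithin_iff.2 ⟨?_, ?_⟩
      · have : Tendsto (fun t => zl + t) (𝓝 0) (𝓝 (zl + 0)) := by
          exact (continuous_const.add continuous_id).tendsto _
        rw [add_zero] at this
        exact this.mono_left nhdsWithin_le_nhds
      · filter_upwards [self_mem_nhdsWithin] with t ht
        exact lt_add_of_pos_right zl ht
    filter_upwards [ht.eventually h.1, self_mem_nhdsWithin] with t h1 h2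
    simpa [inward, abs_of_pos (show 0 < t from h2)] using h1
  · have ht : Tendsto (fun t => zh - t) (𝓝[>] 0) (𝓝[<] zh) := by
      refine tendsto_nhdsWithin_iff.2 ⟨?_, ?_⟩
      · have : Tendsto (fun t => zh - t) (𝓝 0) (𝓝 (zh - 0)) := by
          exact (continuous_const.sub continuous_id).tendsto _
        rw [sub_zero] at this
        exact this.mono_left nhdsWithin_le_nhds
      · filter_upwards [self_mem_nhdsWithin] with t ht
        exact sub_lt_self zh ht
    filter_upwards [ht.eventually h.2, self_mem_nhdsWithin] with t h1 h2
    simpa [inward, abs_of_pos (show 0 < t from h2)] using h1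

/-! ### Moments of a zero-one variable and a bounded variable -/

section Support

variable {ν : Measure (ℝ × ℝ)} [IsProbabilityMeasure ν] {B : ℝ}

theorem mom_eq_of_support {p : ℝ × ℝ} (h : (p.1 = 0 ∨ p.1 = 1) ∧ |p.2| ≤ B) (j : Fin 5) :
    mom B j p = ![1, p.1, p.2, p.1 * p.2, p.2 ^ 2] j := by
  rw [mom, clampD_eq h.1, clampY_eq h.2]

theorem integrable_mom (hB : 0 ≤ B) (j : Fin 5) : Integrable (mom B j) ν :=
  integrable_comp_of_abs_le measurable_id (measurable_mom B j) (abs_mom_le hB j)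

theorem integral_mom_zero : ∫ p, mom B 0 p ∂ν = 1 := by simp [mom]

theorem integral_mom_eq (h : ∀ᵐ p ∂ν, (p.1 = 0 ∨ p.1 = 1) ∧ |p.2| ≤ B) (j : Fin 5) :
    ∫ p, mom B j p ∂ν = ∫ p, ![1, p.1, p.2, p.1 * p.2, p.2 ^ 2] j ∂ν :=
  integral_congr_ae (h.mono fun _ hp => mom_eq_of_support hp j)

theorem memLp_fst_of_support (h : ∀ᵐ p ∂ν, (p.1 = 0 ∨ p.1 = 1) ∧ |p.2| ≤ B) :
    MemLp (fun p : ℝ × ℝ => p.1) 2 ν :=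
  MemLp.of_bound measurable_fst.aestronglyMeasurable 1 (h.mono fun p hp => by
    rcases hp.1 with h | h <;> simp [h])

theorem memLp_snd_of_support (h : ∀ᵐ p ∂ν, (p.1 = 0 ∨ p.1 = 1) ∧ |p.2| ≤ B) :
    MemLp (fun p : ℝ × ℝ => p.2) 2 ν :=
  MemLp.of_bound measurable_snd.aestronglyMeasurable B (h.mono fun _ hp => hp.2)

theorem integral_mom_three (h : ∀ᵐ p ∂ν, (p.1 = 0 ∨ p.1 = 1) ∧ |p.2| ≤ B) :
    ∫ p, mom B 3 p ∂ν =
      cov[fun p => p.1, fun p => p.2; ν] + (∫ p, p.1 ∂ν) * ∫ p, p.2 ∂ν := by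
  rw [integral_mom_eq h, covariance_eq_sub (memLp_fst_of_support h) (memLp_snd_of_support h),
    sub_add_cancel]
  rfl

theorem integral_mom_four (h : ∀ᵐ p ∂ν, (p.1 = 0 ∨ p.1 = 1) ∧ |p.2| ≤ B) :
    ∫ p, mom B 4 p ∂ν = Var[fun p => p.2; ν] + (∫ p, p.2 ∂ν) * ∫ p, p.2 ∂ν := by
  rw [integral_mom_eq h, variance_eq_sub (memLp_snd_of_support h), ← sq, sub_add_cancel]
  rfl

theorem integral_mom_one (h : ∀ᵐ p ∂ν, (p.1 = 0 ∨ p.1 = 1) ∧ |p.2| ≤ B) :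
    ∫ p, mom B 1 p ∂ν = ν.real {p | p.1 = 1} := by
  have hm : MeasurableSet {p : ℝ × ℝ | p.1 = 1} := measurable_fst (measurableSet_singleton 1)
  rw [integral_mom_eq h, ← integral_indicator_one hm]
  refine integral_congr_ae (h.mono fun p hp => ?_)
  rcases hp.1 with h | h <;> simp [h]

/-- The squared residual, expressed by the truncated moment functions. -/
theorem momSq_mom {p : ℝ × ℝ} (h : (p.1 = 0 ∨ p.1 = 1) ∧ |p.2| ≤ B) (a b : ℝ) :
    momSq a b (fun j => mom B j p) = (p.2 - a - b * p.1) ^ 2 := by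
  simp only [mom_eq_of_support h, momSq]
  rcases h.1 with h | h <;> simp [h] <;> ring

theorem momSq_integral {Ω : Type*} [MeasurableSpace Ω] {m : Measure Ω} {g : Fin 5 → Ω → ℝ}
    (hg : ∀ j, Integrable (g j) m) (a b c : ℝ) :
    momSq a b (fun j => c * ∫ ω, g j ω ∂m) = c * ∫ ω, momSq a b (fun j => g j ω) ∂m := by
  have h : ∫ ω, momSq a b (fun j => g j ω) ∂m = ∫ ω, g 4 ω ∂m + a ^ 2 * ∫ ω, g 0 ω ∂m +
      b ^ 2 * ∫ ω, g 1 ω ∂m - 2 * a * ∫ ω, g 2 ω ∂m - 2 * b * ∫ ω, g 3 ω ∂m +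
      2 * a * b * ∫ ω, g 1 ω ∂m := by
    have e : ∀ (k : ℝ) j, Integrable (fun ω => k * g j ω) m := fun k j => (hg j).const_mul k
    unfold momSq
    rw [integral_add, integral_sub, integral_sub, integral_add, integral_add, integral_const_mul,
      integral_const_mul, integral_const_mul, integral_const_mul, integral_const_mul]
    · exact hg 4
    · exact e _ _
    · exact (hg 4).add (e _ _)
    · exact e _ _
    · exact ((hg 4).add (e _ _)).add (e _ _)
    · exact e _ _
    · exact (((hg 4).add (e _ _)).add (e _ _)).sub (e _ _)
    · exact e _ _
    · exact ((((hg 4).add (e _ _)).add (e _ _)).sub (e _ _)).sub (e _ _)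
    · exact e _ _
  rw [h]
  unfold momSq
  ring

theorem momResid_integral {Ω : Type*} [MeasurableSpace Ω] {m : Measure Ω} {g : Fin 5 → Ω → ℝ}
    (hg : ∀ j, Integrable (g j) m) (a b c : ℝ) :
    momResid a b (fun j => c * ∫ ω, g j ω ∂m) = c * ∫ ω, momResid a b (fun j => g j ω) ∂m := by
  have e : ∀ (k : ℝ) j, Integrable (fun ω => k * g j ω) m := fun k j => (hg j).const_mul k
  have h : ∫ ω, momResid a b (fun j => g j ω) ∂m =
      ∫ ω, g 2 ω ∂m - a * ∫ ω, g 0 ω ∂m - b * ∫ ω, g 1 ω ∂m := by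
    unfold momResid
    rw [integral_sub, integral_sub, integral_const_mul, integral_const_mul]
    · exact hg 2
    · exact e _ _
    · exact (hg 2).sub (e _ _)
    · exact e _ _
  rw [h]
  unfold momResid
  ring

theorem integral_momSq_nonneg (h : ∀ᵐ p ∂ν, (p.1 = 0 ∨ p.1 = 1) ∧ |p.2| ≤ B) (a b : ℝ) :
    0 ≤ ∫ p, momSq a b (fun j => mom B j p) ∂ν := by
  refine integral_nonneg_of_ae (h.mono fun p hp => ?_)
  exact (sq_nonneg _).trans_eq (momSq_mom hp a b).symm

/-- If the mean squared residual vanished, then Y = a + b D almost surely, so Y would be constant on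
{D = d}, against the nonzero conditional variance. This works for any line, so the coefficients need
not be known. -/
theorem integral_momSq_pos (hB : 0 ≤ B) (h : ∀ᵐ p ∂ν, (p.1 = 0 ∨ p.1 = 1) ∧ |p.2| ≤ B)
    (a b : ℝ) {d : ℝ} (hv : Var[fun p => p.2; ν[|{p | p.1 = d}]] ≠ 0) :
    0 < ∫ p, momSq a b (fun j => mom B j p) ∂ν := by
  refine lt_of_le_of_ne (integral_momSq_nonneg h a b) fun h0 => hv ?_
  have hm : MeasurableSet {p : ℝ × ℝ | p.1 = d} := measurable_fst (measurableSet_singleton d)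
  have hi : Integrable (fun p => momSq a b (fun j => mom B j p)) ν := by
    have e : ∀ (k : ℝ) j, Integrable (fun p => k * mom B j p) ν := fun k j =>
      (integrable_mom hB j).const_mul k
    exact (((((integrable_mom hB 4).add (e _ _)).add (e _ _)).sub (e _ _)).sub (e _ _)).add (e _ _)
  have hz := (integral_eq_zero_iff_of_nonneg_ae
    (h.mono fun p hp => (sq_nonneg _).trans_eq (momSq_mom hp a b).symm) hi).1 h0.symm
  have hae : (fun p : ℝ × ℝ => p.2) =ᵐ[ν[|{p | p.1 = d}]] fun _ => a + b * d := by
    filter_upwards [cond_absolutelyContinuous.ae_le hz, cond_absolutelyContinuous.ae_le h,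
      ae_cond_mem hm] with p h1 h2 h3
    have h1' : momSq a b (fun j => mom B j p) = 0 := h1
    rw [momSq_mom h2, h3] at h1'
    have := pow_eq_zero_iff (two_ne_zero) |>.1 h1'
    linarith
  -- Conditioning on a null event gives the zero measure, for which the variance is 0 as well.
  by_cases hp : ν {p | p.1 = d} = 0
  · simp [cond_eq_zero_of_meas_eq_zero hp]
  · have := cond_isProbabilityMeasure hp
    rw [variance_congr hae, variance_eq_integral aemeasurable_const]
    simp

end Support

/-! ### The distribution near the endpoints -/

section Design

variable {Ω : Type*} [MeasurableSpace Ω] {μ : Measure Ω}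
  {Z D Y : Ω → ℝ} {zl zh B δ : ℝ} {f : ℝ → ℝ} {κ : Kernel ℝ (ℝ × ℝ)}

theorem LateDesign.measurable_depth (M : LateDesign μ Z D Y zl zh B δ f κ) (s : Bool) :
    Measurable fun ω => depth zl zh s (Z ω) :=
  (BandwidthSnooping.measurable_depth zl zh s).comp M.measurable_Z

/-- Depth is a translation or a reflection of `Z`, so it preserves Lebesgue measure, and depth below
`δ` keeps `Z` in the region where it has a density. -/
theorem LateDesign.map_depth_restrict (M : LateDesign μ Z D Y zl zh B δ f κ) (s : Bool) :
    (μ.map fun ω => depth zl zh s (Z ω)).restrict (Set.Iio δ) =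
      (volume.restrict (Set.Iio δ)).withDensity
        fun t => ENNReal.ofReal (f (inward zl zh s t)) := by
  set R := Set.Iio (zl + δ) ∪ Set.Ioi (zh - δ) with hR
  ext S hS
  set T := depth zl zh s ⁻¹' (S ∩ Set.Iio δ) with hT
  have hS' : MeasurableSet (S ∩ Set.Iio δ) := hS.inter measurableSet_Iio
  have hTm : MeasurableSet T := BandwidthSnooping.measurable_depth zl zh s hS'
  have hTR : T ⊆ R := by
    intro z hz
    have hz' : depth zl zh s z < δ := hz.2
    cases s
    · left; simp only [depth, Bool.false_eq_true, if_false] at hz'; simp only [Set.mem_Iio]; linarith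
    · right; simp only [depth, if_true] at hz'; simp only [Set.mem_Ioi]; linarith
  have h1 : ((μ.map fun ω => depth zl zh s (Z ω)).restrict (Set.Iio δ)) S =
      ((μ.map Z).restrict R) T := by
    rw [Measure.restrict_apply hS, Measure.map_apply (M.measurable_depth s) hS',
      Measure.restrict_apply hTm, Set.inter_eq_left.2 hTR, Measure.map_apply M.measurable_Z hTm]
    rfl
  rw [h1, M.density, withDensity_apply _ hTm, withDensity_apply _ hS,
    Measure.restrict_restrict hTm, Measure.restrict_restrict hS, Set.inter_eq_left.2 hTR,
    ← (measurePreserving_inward zl zh s).setLIntegral_comp_preimage hTm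
      (M.measurable_f.ennreal_ofReal)]
  congr 2
  ext t
  simp [hT, depth_inward]

variable [IsProbabilityMeasure μ] [IsMarkovKernel κ]

theorem measurable_densMom (hf : Measurable f) (s : Bool) (j : Fin 5) :
    Measurable fun t => densMom f κ B zl zh t s j :=
  (hf.comp (measurable_inward zl zh s)).mul
    ((measurable_mom B j).stronglyMeasurable.integral_kernel.measurable.comp
      (measurable_inward zl zh s))

/-- Disintegrate the law of (Z, D, Y) along `Z` with the kernel `κ`, then change variables from `Z`
to depth. All population moments are reduced in this way to Lebesgue integrals of `densMom`. -/
theorem LateDesign.setIntegral_mom (M : LateDesign μ Z D Y zl zh B δ f κ) (s : Bool) (j : Fin 5)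
    {S : Set ℝ} (hS : MeasurableSet S) (hSδ : S ⊆ Set.Iio δ) :
    ∫ ω in {ω | depth zl zh s (Z ω) ∈ S}, mom B j (D ω, Y ω) ∂μ =
      ∫ t in S, densMom f κ B zl zh t s j := by
  set T := depth zl zh s ⁻¹' S with hT
  have hTm : MeasurableSet T := BandwidthSnooping.measurable_depth zl zh s hS
  set q : ℝ → ℝ := fun z => ∫ p, mom B j p ∂(κ z) with hq
  have hqm : Measurable q := (measurable_mom B j).stronglyMeasurable.integral_kernel.measurable
  have : IsProbabilityMeasure (μ.map Z) := Measure.isProbabilityMeasure_map M.measurable_Z.aemeasurable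
  have hlaw : μ.map (fun ω => (Z ω, (D ω, Y ω))) = (μ.map Z) ⊗ₘ κ := M.condDistrib.map_eq
  have hm : Measurable fun ω => (Z ω, (D ω, Y ω)) :=
    M.measurable_Z.prodMk (M.measurable_D.prodMk M.measurable_Y)
  have hmm : Measurable fun p : ℝ × ℝ × ℝ => mom B j p.2 := (measurable_mom B j).comp measurable_snd
  have e1 : ∫ ω in {ω | depth zl zh s (Z ω) ∈ S}, mom B j (D ω, Y ω) ∂μ =
      ∫ z in T, q z ∂(μ.map Z) := by
    have h1 := setIntegral_map (μ := μ) (f := fun p : ℝ × ℝ × ℝ => mom B j p.2)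
      (hTm.prod MeasurableSet.univ) hmm.aestronglyMeasurable hm.aemeasurable
    have h2 : (fun ω => (Z ω, (D ω, Y ω))) ⁻¹' (T ×ˢ Set.univ) =
        {ω | depth zl zh s (Z ω) ∈ S} := by
      ext ω; simp [hT]
    rw [h2] at h1
    rw [← h1, hlaw, Measure.setIntegral_compProd hTm MeasurableSet.univ]
    · simp [hq]
    · exact (integrable_comp_of_abs_le measurable_id hmm
        fun p => abs_mom_le M.nonneg_B j p.2).integrableOn
  have e2 : ∫ z in T, q z ∂(μ.map Z) =
      ∫ t in S, q (inward zl zh s t) ∂(μ.map fun ω => depth zl zh s (Z ω)) := by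
    have hqi : Measurable fun t => q (inward zl zh s t) := hqm.comp (measurable_inward zl zh s)
    rw [setIntegral_map hTm hqm.aestronglyMeasurable M.measurable_Z.aemeasurable,
      setIntegral_map hS hqi.aestronglyMeasurable (M.measurable_depth s).aemeasurable]
    simp only [inward_depth]
    rfl
  have e3 : (μ.map fun ω => depth zl zh s (Z ω)).restrict S =
      (volume.restrict S).withDensity fun t => ENNReal.ofReal (f (inward zl zh s t)) := by
    have := congrArg (fun m => m.restrict S) (M.map_depth_restrict s)
    simpa only [Measure.restrict_restrict hS, restrict_withDensity hS,
      Set.inter_eq_left.2 hSδ] using this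
  have hfi : Measurable fun t => ENNReal.ofReal (f (inward zl zh s t)) :=
    (M.measurable_f.comp (measurable_inward zl zh s)).ennreal_ofReal
  rw [e1, e2, e3, integral_withDensity_eq_integral_toReal_smul hfi
    (Eventually.of_forall fun _ => ENNReal.ofReal_lt_top)]
  refine integral_congr_ae (Eventually.of_forall fun t => ?_)
  simp [densMom, hq, ENNReal.toReal_ofReal (M.nonneg_f _)]

/-- The rate is stable under sums and products; the moments of DY and Y² are recovered from
covariance and variance by adding products of means. -/
theorem LateDesign.logLogCont_densMom (M : LateDesign μ Z D Y zl zh B δ f κ) {ℓ : ℝ → ℝ}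
    (hℓ : LogLogModulus ℓ) (hcf : ContAtEndpoints ℓ zl zh f)
    (hcY : ContAtEndpoints ℓ zl zh (fun z => ∫ p, p.2 ∂(κ z)))
    (hcD : ContAtEndpoints ℓ zl zh (fun z => ∫ p, p.1 ∂(κ z)))
    (hcYY : ContAtEndpoints ℓ zl zh (fun z => Var[fun p => p.2; κ z]))
    (hcDY : ContAtEndpoints ℓ zl zh (fun z => cov[fun p => p.1, fun p => p.2; κ z])) :
    LogLogCont (densMom f κ B zl zh) := by
  refine LogLogCont.pi fun s => LogLogCont.pi fun j => (hcf.logLogCont hℓ s).mul ?_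
  have hy := hcY.logLogCont hℓ s
  have hd := hcD.logLogCont hℓ s
  fin_cases j
  · simpa only [Fin.zero_eta, integral_mom_zero] using LogLogCont.const (1 : ℝ)
  · have : ∀ z, ∫ p, mom B 1 p ∂(κ z) = ∫ p, p.1 ∂(κ z) := fun z => integral_mom_eq (M.support z) 1
    simpa only [Fin.mk_one, this] using hd
  · have : ∀ z, ∫ p, mom B 2 p ∂(κ z) = ∫ p, p.2 ∂(κ z) := fun z => integral_mom_eq (M.support z) 2
    simpa only [Fin.reduceFinMk, this] using hy
  · simpa only [Fin.reduceFinMk, integral_mom_three (M.support _)] using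
      (hcDY.logLogCont hℓ s).add (hd.mul hy)
  · simpa only [Fin.reduceFinMk, integral_mom_four (M.support _)] using
      (hcYY.logLogCont hℓ s).add (hy.mul hy)

/-- Instrument relevance makes the first stage nonzero. For the variance, one endpoint has a
positive mean squared residual and the other contributes a nonnegative term. -/
theorem LateDesign.momRegular_densMom (M : LateDesign μ Z D Y zl zh B δ f κ)
    (hfl : 0 < f zl) (hfh : 0 < f zh)
    (hrel : (κ zh).real {p | p.1 = 1} - (κ zl).real {p | p.1 = 1} ≠ 0)
    (hvar : ∃ d : ℝ, (d = 0 ∨ d = 1) ∧ ∃ z : ℝ, (z = zl ∨ z = zh) ∧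
      κ z {p | p.1 = d} ≠ 0 ∧ Var[fun p => p.2; (κ z)[|{p | p.1 = d}]] ≠ 0) :
    MomRegular (densMom f κ B zl zh 0) := by
  have hin : ∀ s, inward zl zh s 0 = if s then zh else zl := fun s => by cases s <;> simp [inward]
  have hf : ∀ s, 0 < f (inward zl zh s 0) := fun s => by rw [hin]; cases s <;> simpa
  have h0 : ∀ s, densMom f κ B zl zh 0 s 0 = f (inward zl zh s 0) := fun s => by
    simp [densMom, integral_mom_zero]
  have h1 : ∀ s, densMom f κ B zl zh 0 s 1 / densMom f κ B zl zh 0 s 0 =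
      (κ (inward zl zh s 0)).real {p | p.1 = 1} := fun s => by
    rw [h0, densMom, integral_mom_one (M.support _), mul_div_cancel_left₀ _ (hf s).ne']
  have hsq : ∀ s a b, momSq a b (densMom f κ B zl zh 0 s) = f (inward zl zh s 0) *
      ∫ p, momSq a b (fun j => mom B j p) ∂(κ (inward zl zh s 0)) := fun s a b =>
    momSq_integral (fun j => integrable_mom M.nonneg_B j) a b _
  have hnn : ∀ s a b, 0 ≤ momSq a b (densMom f κ B zl zh 0 s) := fun s a b => by
    rw [hsq]; exact mul_nonneg (hf s).le (integral_momSq_nonneg (M.support _) a b)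
  refine ⟨fun s => by rw [h0]; exact hf s, ?_, ?_⟩
  · rw [momDen, h1, h1, hin, hin]
    simp only [Bool.false_eq_true, if_false, if_true]
    intro h
    exact hrel (by linarith)
  · obtain ⟨d, -, z, hz, -, hv⟩ := hvar
    obtain ⟨s, rfl⟩ : ∃ s, z = inward zl zh s 0 := by
      rcases hz with rfl | rfl
      · exact ⟨false, by simp [inward]⟩
      · exact ⟨true, by simp [inward]⟩
    have hpos : ∀ a b, 0 < momSq a b (densMom f κ B zl zh 0 s) := fun a b => by
      rw [hsq]; exact mul_pos (hf s) (integral_momSq_pos M.nonneg_B (M.support _) a b hv)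
    have hd : ∀ s, 0 < densMom f κ B zl zh 0 s 0 ^ 2 := fun s => by
      have := hf s; rw [h0]; positivity
    unfold momVar
    cases s
    · exact add_pos_of_pos_of_nonneg (div_pos (hpos _ _) (hd _)) (div_nonneg (hnn _ _ _) (hd _).le)
    · exact add_pos_of_nonneg_of_pos (div_nonneg (hnn _ _ _) (hd _).le) (div_pos (hpos _ _) (hd _))

end Design

/-! ### Uniform bounds near the endpoints and averages over small neighbourhoods -/

section Design

variable {Ω : Type*} [MeasurableSpace Ω] {μ : Measure Ω}
  {Z D Y : Ω → ℝ} {zl zh B δ : ℝ} {f : ℝ → ℝ} {κ : Kernel ℝ (ℝ × ℝ)}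
  [IsProbabilityMeasure μ] [IsMarkovKernel κ]

/-- The radius is kept below `δ`, where the density is available, and below half the length of the
interval, where the neighbourhoods of the two endpoints are disjoint. -/
theorem LateDesign.exists_densMom_le (M : LateDesign μ Z D Y zl zh B δ f κ)
    (hw : LogLogCont (densMom f κ B zl zh)) :
    ∃ t₀ L : ℝ, 0 < t₀ ∧ t₀ < δ ∧ t₀ < (zh - zl) / 2 ∧ 0 ≤ L ∧
      ∀ t ∈ Set.Icc 0 t₀, ∀ s j, |densMom f κ B zl zh t s j| ≤ L := by
  have h1 : ∀ᶠ t in 𝓝[>] 0, ‖densMom f κ B zl zh t‖ < ‖densMom f κ B zl zh 0‖ + 1 :=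
    hw.tendsto.norm.eventually_lt_const (lt_add_one _)
  obtain ⟨a, ha, h2⟩ := mem_nhdsGT_iff_exists_Ioo_subset.1 h1
  have ha0 : 0 < a := ha
  have hδ := M.pos_δ
  have hz := sub_pos.2 M.lt
  refine ⟨min (a / 2) (min (δ / 2) ((zh - zl) / 4)), ‖densMom f κ B zl zh 0‖ + 1, by positivity,
    ?_, ?_, by positivity, fun t ht s j => ?_⟩
  · exact ((min_le_right _ _).trans (min_le_left _ _)).trans_lt (by linarith)
  · exact ((min_le_right _ _).trans (min_le_right _ _)).trans_lt (by linarith)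
  have hn : ‖densMom f κ B zl zh t‖ ≤ ‖densMom f κ B zl zh 0‖ + 1 := by
    rcases ht.1.eq_or_lt with h | h
    · rw [← h]; linarith
    · have ha' : t ≤ a / 2 := ht.2.trans (min_le_left _ _)
      have : ‖densMom f κ B zl zh t‖ < ‖densMom f κ B zl zh 0‖ + 1 := h2 ⟨h, by linarith⟩
      exact this.le
  exact ((norm_le_pi_norm (densMom f κ B zl zh t s) j).trans
    (norm_le_pi_norm (densMom f κ B zl zh t) s)).trans hn

theorem LateDesign.measureReal_depth (M : LateDesign μ Z D Y zl zh B δ f κ) (s : Bool)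
    {S : Set ℝ} (hS : MeasurableSet S) (hSδ : S ⊆ Set.Iio δ) :
    μ.real {ω | depth zl zh s (Z ω) ∈ S} = ∫ t in S, densMom f κ B zl zh t s 0 := by
  rw [← M.setIntegral_mom s 0 hS hSδ]
  simp [mom]

theorem LateDesign.measureReal_depth_le (M : LateDesign μ Z D Y zl zh B δ f κ) {t₀ L : ℝ}
    (ht : t₀ < δ) (hL : ∀ t ∈ Set.Icc 0 t₀, ∀ s j, |densMom f κ B zl zh t s j| ≤ L) (s : Bool)
    {h : ℝ} (h0 : 0 < h) (h1 : h ≤ t₀) :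
    μ.real {ω | depth zl zh s (Z ω) ∈ Set.Icc 0 h} ≤ L * h := by
  rw [M.measureReal_depth s measurableSet_Icc fun t h2 => (h2.2.trans h1).trans_lt ht]
  have h3 := norm_setIntegral_le_of_norm_le_const (μ := volume) (s := Set.Icc 0 h) (C := L)
    (f := fun t => densMom f κ B zl zh t s 0) measure_Icc_lt_top
    fun t h2 => hL t ⟨h2.1, h2.2.trans h1⟩ s 0
  rw [Real.volume_real_Icc_of_le h0.le, sub_zero] at h3
  exact (le_abs_self _).trans h3

theorem LateDesign.measureReal_depth_sub_le (M : LateDesign μ Z D Y zl zh B δ f κ) {t₀ L : ℝ}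
    (ht : t₀ < δ) (hL : ∀ t ∈ Set.Icc 0 t₀, ∀ s j, |densMom f κ B zl zh t s j| ≤ L) (s : Bool)
    {h h' : ℝ} (h0 : 0 < h) (hh : h ≤ h') (h1 : h' ≤ t₀) :
    μ.real {ω | depth zl zh s (Z ω) ∈ Set.Icc 0 h'} -
      μ.real {ω | depth zl zh s (Z ω) ∈ Set.Icc 0 h} ≤ L * (h' - h) := by
  have hm := M.measurable_depth s
  have hd : {ω | depth zl zh s (Z ω) ∈ Set.Icc 0 h'} \ {ω | depth zl zh s (Z ω) ∈ Set.Icc 0 h} =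
      {ω | depth zl zh s (Z ω) ∈ Set.Ioc h h'} := by
    ext ω
    simp only [Set.mem_sdiff, Set.mem_ofPred_eq, Set.mem_Icc, Set.mem_Ioc, not_and, not_le]
    constructor
    · rintro ⟨⟨a, b⟩, c⟩; exact ⟨c a, b⟩
    · rintro ⟨a, b⟩; exact ⟨⟨(h0.trans a).le, b⟩, fun _ => a⟩
  have hsub : {ω | depth zl zh s (Z ω) ∈ Set.Icc 0 h} ⊆ {ω | depth zl zh s (Z ω) ∈ Set.Icc 0 h'} :=
    fun ω hω => ⟨hω.1, hω.2.trans hh⟩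
  rw [← measureReal_sdiff hsub (hm measurableSet_Icc), hd,
    M.measureReal_depth s measurableSet_Ioc fun t h2 => (h2.2.trans h1).trans_lt ht]
  have h3 := norm_setIntegral_le_of_norm_le_const (μ := volume) (s := Set.Ioc h h') (C := L)
    (f := fun t => densMom f κ B zl zh t s 0) measure_Ioc_lt_top
    fun t h2 => hL t ⟨h0.le.trans h2.1.le, h2.2.trans h1⟩ s 0
  rw [Real.volume_real_Ioc_of_le hh] at h3
  exact (le_abs_self _).trans h3

/-- `lateMom` at `t` is the average of `densMom` over depths in [0, t], so its distance from the
limit is at most the supremum of the distances of the averaged values. -/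
theorem LateDesign.logLogCont_lateMom (M : LateDesign μ Z D Y zl zh B δ f κ)
    (hw : LogLogCont (densMom f κ B zl zh)) : LogLogCont (lateMom μ Z D Y f κ B zl zh) := by
  obtain ⟨t₀, L, ht₀, hδ, -, -, hL⟩ := M.exists_densMom_le hw
  refine hw.of_forall_le ht₀ fun t c ht htt h => ?_
  have hc : 0 ≤ c := (norm_nonneg _).trans (h t ht le_rfl)
  have e0 : lateMom μ Z D Y f κ B zl zh 0 = densMom f κ B zl zh 0 := if_pos rfl
  rw [e0]
  refine (pi_norm_le_iff_of_nonneg hc).2 fun s => (pi_norm_le_iff_of_nonneg hc).2 fun j => ?_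
  have e1 : lateMom μ Z D Y f κ B zl zh t s j =
      t⁻¹ * ∫ τ in Set.Icc 0 t, densMom f κ B zl zh τ s j := by
    rw [lateMom, if_neg ht.ne', ← M.setIntegral_mom s j measurableSet_Icc
      fun τ h2 => h2.2.trans_lt (htt.trans hδ)]
  have hint : IntegrableOn (fun τ => densMom f κ B zl zh τ s j) (Set.Icc 0 t) :=
    Measure.integrableOn_of_bounded (M := L) measure_Icc_lt_top.ne
      (measurable_densMom M.measurable_f s j).aestronglyMeasurable
      ((ae_restrict_iff' measurableSet_Icc).2 (Eventually.of_forall fun τ h2 =>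
        hL τ ⟨h2.1, h2.2.trans htt.le⟩ s j))
  have e2 : lateMom μ Z D Y f κ B zl zh t s j - densMom f κ B zl zh 0 s j =
      t⁻¹ * ∫ τ in Set.Icc 0 t, (densMom f κ B zl zh τ s j - densMom f κ B zl zh 0 s j) := by
    rw [e1, integral_sub hint (integrable_const _)]
    simp [Real.volume_real_Icc_of_le ht.le]
    field_simp
  show ‖lateMom μ Z D Y f κ B zl zh t s j - densMom f κ B zl zh 0 s j‖ ≤ c
  have h3 := norm_setIntegral_le_of_norm_le_const (μ := volume) (s := Set.Icc 0 t) (C := c)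
    (f := fun τ => densMom f κ B zl zh τ s j - densMom f κ B zl zh 0 s j)
    measure_Icc_lt_top fun τ h2 => by
      rcases h2.1.eq_or_lt with h4 | h4
      · rw [← h4, sub_self, norm_zero]; exact hc
      · exact ((norm_le_pi_norm ((densMom f κ B zl zh τ - densMom f κ B zl zh 0) s) j).trans
          (norm_le_pi_norm (densMom f κ B zl zh τ - densMom f κ B zl zh 0) s)).trans
          (h τ h4 h2.2)
  rw [Real.volume_real_Icc_of_le ht.le, sub_zero] at h3
  rw [e2, norm_mul, Real.norm_of_nonneg (inv_pos.2 ht).le, inv_mul_le_iff₀ ht, mul_comm]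
  exact h3

end Design

/-! ### Versions of conditional expectations given a real variable -/

/-- A function `φ` with the right integrals over the sets `{T ∈ S}`, `S ⊆ I`, is on `I` a
version of the conditional expectation of `Ψ` given `T`. -/
theorem exists_condExp_version {Ω : Type*} [MeasurableSpace Ω] {μ : Measure Ω}
    [IsProbabilityMeasure μ] {T Ψ : Ω → ℝ} (hT : Measurable T) (hΨ : Integrable Ψ μ)
    {φ : ℝ → ℝ} (hφ : Measurable φ) {I : Set ℝ} (hI : MeasurableSet I)
    (hi : IntegrableOn φ I (μ.map T))
    (h : ∀ S, MeasurableSet S → S ⊆ I →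
      ∫ ω in T ⁻¹' S, Ψ ω ∂μ = ∫ t in S, φ t ∂(μ.map T)) :
    ∃ m : ℝ → ℝ, Measurable m ∧ (∀ t ∈ I, m t = φ t) ∧
      μ[Ψ | MeasurableSpace.comap T inferInstance] =ᵐ[μ] fun ω => m (T ω) := by
  have hle : MeasurableSpace.comap T inferInstance ≤ ‹MeasurableSpace Ω› := hT.comap_le
  -- Some version exists as a function of `T` by the factorization of measurable functions. It
  -- agrees with `φ` almost everywhere on `I`, so it may be overwritten there by `φ`; the pointwise
  -- values near 0 are then known.
  obtain ⟨m₁, hm₁, hm₁e⟩ :=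
    (stronglyMeasurable_condExp (m := MeasurableSpace.comap T inferInstance) (μ := μ)
      (f := Ψ)).measurable.exists_eq_measurable_comp
  classical
  refine ⟨I.piecewise φ m₁, hφ.piecewise hI hm₁, fun t ht => Set.piecewise_eq_of_mem _ _ _ ht, ?_⟩
  have hint : Integrable (fun ω => m₁ (T ω)) μ := by
    have : Integrable (m₁ ∘ T) μ := hm₁e ▸ integrable_condExp
    exact this
  have hint' : Integrable m₁ (μ.map T) :=
    (integrable_map_measure hm₁.aestronglyMeasurable hT.aemeasurable).2 hint
  have hae : m₁ =ᵐ[(μ.map T).restrict I] φ := by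
    refine Integrable.ae_eq_of_forall_setIntegral_eq _ _ hint'.integrableOn hi fun S hS _ => ?_
    rw [Measure.restrict_restrict hS, ← h _ (hS.inter hI) Set.inter_subset_right,
      setIntegral_map (hS.inter hI) hm₁.aestronglyMeasurable hT.aemeasurable]
    have h1 := setIntegral_condExp hle hΨ
      (s := T ⁻¹' (S ∩ I)) ⟨_, hS.inter hI, rfl⟩
    rw [← h1, hm₁e]
    rfl
  have hae' := (ae_restrict_iff' hI).1 hae
  filter_upwards [ae_of_ae_map hT.aemeasurable hae'] with ω hω
  rw [hm₁e]
  show m₁ (T ω) = _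
  by_cases h1 : T ω ∈ I
  · rw [Set.piecewise_eq_of_mem _ _ _ h1]; exact hω h1
  · rw [Set.piecewise_eq_of_notMem _ _ _ h1]

/-! ### The distance to the nearest endpoint -/

/-- The endpoint nearest to `z`. -/
noncomputable def side (zl zh z : ℝ) : Bool := decide ((zl + zh) / 2 < z)

theorem measurable_side (zl zh : ℝ) : Measurable (side zl zh) := by
  refine measurable_to_bool ?_
  have : side zl zh ⁻¹' {true} = Set.Ioi ((zl + zh) / 2) := by ext z; simp [side]
  rw [this]
  exact measurableSet_Ioi

theorem abs_lateX {zl zh z : ℝ} (hz : z ∈ Set.Icc zl zh) :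
    |lateX zl zh z| = depth zl zh (side zl zh z) z := by
  unfold lateX
  split_ifs with h
  · rw [abs_of_nonneg (by linarith [hz.1])]
    simp [side, depth, not_lt.2 h]
  · rw [abs_of_nonpos (by linarith [hz.2])]
    simp [side, depth, not_le.1 h]

theorem side_eq_of_depth_lt {zl zh z : ℝ} {s : Bool} (h : depth zl zh s z < (zh - zl) / 2) :
    side zl zh z = s := by
  cases s
  · simp only [depth, Bool.false_eq_true, if_false] at h
    simp only [side, decide_eq_false_iff_not, not_lt]
    linarith
  · simp only [depth, if_true] at h
    simp only [side, decide_eq_true_eq]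
    linarith

theorem measurable_lateX (zl zh : ℝ) : Measurable (lateX zl zh) :=
  Measurable.ite measurableSet_Iic (measurable_id.sub_const zl) (measurable_id.sub_const zh)

section Design

variable {Ω : Type*} [MeasurableSpace Ω] {μ : Measure Ω}
  {Z D Y : Ω → ℝ} {zl zh B δ : ℝ} {f : ℝ → ℝ} {κ : Kernel ℝ (ℝ × ℝ)}
  [IsProbabilityMeasure μ] [IsMarkovKernel κ]

theorem LateDesign.measurable_absX (M : LateDesign μ Z D Y zl zh B δ f κ) :
    Measurable fun ω => |lateX zl zh (Z ω)| :=
  ((measurable_lateX zl zh).comp M.measurable_Z).abs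

theorem LateDesign.absX_mem_ae (M : LateDesign μ Z D Y zl zh B δ f κ) {S : Set ℝ}
    (hS : S ⊆ Set.Iio ((zh - zl) / 2)) :
    {ω | |lateX zl zh (Z ω)| ∈ S} =ᵐ[μ]
      ({ω | depth zl zh false (Z ω) ∈ S} ∪ {ω | depth zl zh true (Z ω) ∈ S} : Set Ω) := by
  filter_upwards [M.mem_Z] with ω hω
  refine propext ?_
  show |lateX zl zh (Z ω)| ∈ S ↔ depth zl zh false (Z ω) ∈ S ∨ depth zl zh true (Z ω) ∈ S
  rw [abs_lateX hω]
  constructor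
  · intro h
    cases hs : side zl zh (Z ω)
    · left; rwa [hs] at h
    · right; rwa [hs] at h
  · rintro (h | h)
    · rwa [side_eq_of_depth_lt (hS h)]
    · rwa [side_eq_of_depth_lt (hS h)]

theorem disjoint_depth_mem {S : Set ℝ} (hS : S ⊆ Set.Iio ((zh - zl) / 2)) :
    Disjoint {ω | depth zl zh false (Z ω) ∈ S} {ω | depth zl zh true (Z ω) ∈ S} :=
  Set.disjoint_left.2 fun ω h1 h2 => by
    have := (side_eq_of_depth_lt (hS h1)).symm.trans (side_eq_of_depth_lt (hS h2))
    simp at this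

/-- Integrals over sets of points close to one of the endpoints split into two parts. -/
theorem LateDesign.setIntegral_absX (M : LateDesign μ Z D Y zl zh B δ f κ) {S : Set ℝ}
    (hSm : MeasurableSet S) (hS : S ⊆ Set.Iio ((zh - zl) / 2)) {G : Bool → Ω → ℝ}
    (hG : ∀ s, Integrable (G s) μ) :
    ∫ ω in {ω | |lateX zl zh (Z ω)| ∈ S}, G (side zl zh (Z ω)) ω ∂μ =
      ∫ ω in {ω | depth zl zh false (Z ω) ∈ S}, G false ω ∂μ +
      ∫ ω in {ω | depth zl zh true (Z ω) ∈ S}, G true ω ∂μ := by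
  have hm : ∀ s, MeasurableSet {ω | depth zl zh s (Z ω) ∈ S} := fun s => M.measurable_depth s hSm
  have he : ∀ s, Set.EqOn (fun ω => G (side zl zh (Z ω)) ω) (G s)
      {ω | depth zl zh s (Z ω) ∈ S} := fun s ω hω => by
    show G (side zl zh (Z ω)) ω = G s ω
    rw [side_eq_of_depth_lt (hS hω)]
  have hi : ∀ s, IntegrableOn (fun ω => G (side zl zh (Z ω)) ω) {ω | depth zl zh s (Z ω) ∈ S} μ :=
    fun s => ((hG s).integrableOn).congr_fun (he s).symm (hm s)
  rw [setIntegral_congr_set (M.absX_mem_ae hS), setIntegral_union (disjoint_depth_mem hS) (hm true)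
    (hi false) (hi true), setIntegral_congr_fun (hm false) (he false),
    setIntegral_congr_fun (hm true) (he true)]

/-- The density of the distance to the nearest endpoint. -/
noncomputable def densX (f : ℝ → ℝ) (zl zh t : ℝ) : ℝ :=
  if t < (zh - zl) / 2 then f (zl + t) + f (zh - t) else 0

theorem measurable_densX (hf : Measurable f) : Measurable (densX f zl zh) :=
  Measurable.ite measurableSet_Iio
    ((hf.comp (measurable_const.add measurable_id)).add
      (hf.comp (measurable_const.sub measurable_id))) measurable_const

/-- The distance to the nearest endpoint is at most half the length, with equality only at the
midpoint. If `δ` exceeds half the length, the midpoint lies in the region with a density and is a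
null set. -/
theorem LateDesign.absX_lt (M : LateDesign μ Z D Y zl zh B δ f κ) :
    ∀ᵐ ω ∂μ, |lateX zl zh (Z ω)| < δ → |lateX zl zh (Z ω)| < (zh - zl) / 2 := by
  rcases le_or_gt δ ((zh - zl) / 2) with h | h
  · exact Eventually.of_forall fun ω hω => hω.trans_le h
  have h0 : μ {ω | depth zl zh false (Z ω) ∈ ({(zh - zl) / 2} : Set ℝ)} = 0 := by
    have h1 := congrArg (fun m => m {(zh - zl) / 2}) (M.map_depth_restrict false)
    rw [Measure.restrict_apply (measurableSet_singleton _),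
      Set.inter_eq_left.2 (Set.singleton_subset_iff.2 (Set.mem_Iio.2 h)),
      Measure.map_apply (M.measurable_depth false) (measurableSet_singleton _)] at h1
    refine h1.trans ?_
    rw [withDensity_apply _ (measurableSet_singleton _)]
    refine setLIntegral_measure_zero _ _ ?_
    exact le_antisymm ((Measure.restrict_apply_le _ _).trans (by simp)) zero_le
  have h0' : ∀ᵐ ω ∂μ, ¬ depth zl zh false (Z ω) = (zh - zl) / 2 := by
    rw [ae_iff]
    simpa using h0
  filter_upwards [M.mem_Z, h0'] with ω hω h1 _
  rw [abs_lateX hω]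
  by_cases h2 : (zl + zh) / 2 < Z ω
  · have : side zl zh (Z ω) = true := by simp [side, h2]
    rw [this]; simp only [depth, if_true]; linarith
  · have : side zl zh (Z ω) = false := by simp [side, h2]
    rw [this]
    refine lt_of_le_of_ne ?_ h1
    simp only [depth, Bool.false_eq_true, if_false]; linarith

/-- Below half the length, being at distance in a set is the disjoint union of having that depth
from either endpoint, so the two densities add. Cutting at half the length avoids counting points
twice when `δ` is large. -/
theorem LateDesign.map_absX_restrict (M : LateDesign μ Z D Y zl zh B δ f κ) :
    (μ.map fun ω => |lateX zl zh (Z ω)|).restrict (Set.Iio δ) =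
      (volume.restrict (Set.Ico 0 δ)).withDensity
        fun t => ENNReal.ofReal (densX f zl zh t) := by
  ext S hS
  set r := (zh - zl) / 2 with hr
  set S' := (S ∩ Set.Ico 0 δ) ∩ Set.Iio r with hS'
  have hS'm : MeasurableSet S' := (hS.inter measurableSet_Ico).inter measurableSet_Iio
  have hsub : S' ⊆ Set.Iio r := Set.inter_subset_right
  have hsubδ : S' ⊆ Set.Iio δ := fun t ht => ht.1.2.2
  have h1 : {ω | |lateX zl zh (Z ω)| ∈ S ∩ Set.Iio δ} =ᵐ[μ] {ω | |lateX zl zh (Z ω)| ∈ S'} := by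
    filter_upwards [M.absX_lt] with ω hω
    refine propext ⟨fun h => ?_, fun h => ⟨h.1.1, h.1.2.2⟩⟩
    exact ⟨⟨h.1, abs_nonneg _, h.2⟩, hω h.2⟩
  have h2 : ∀ s, μ {ω | depth zl zh s (Z ω) ∈ S'} =
      ∫⁻ t in S', ENNReal.ofReal (f (inward zl zh s t)) := fun s => by
    have := congrArg (fun m => m S') (M.map_depth_restrict s)
    rw [Measure.restrict_apply hS'm, Set.inter_eq_left.2 hsubδ,
      Measure.map_apply (M.measurable_depth s) hS'm, withDensity_apply _ hS'm,
      Measure.restrict_restrict hS'm, Set.inter_eq_left.2 hsubδ] at this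
    exact this
  rw [Measure.restrict_apply hS, Measure.map_apply M.measurable_absX (hS.inter measurableSet_Iio),
    withDensity_apply _ hS, Measure.restrict_restrict hS]
  have h3 : ∫⁻ t in S ∩ Set.Ico 0 δ, ENNReal.ofReal (densX f zl zh t) =
      ∫⁻ t in S', (ENNReal.ofReal (f (inward zl zh false t)) +
        ENNReal.ofReal (f (inward zl zh true t))) := by
    have h4 : (fun t => ENNReal.ofReal (densX f zl zh t)) = (Set.Iio r).indicator fun t =>
        (ENNReal.ofReal (f (inward zl zh false t)) +
          ENNReal.ofReal (f (inward zl zh true t))) := by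
      funext t
      by_cases ht : t < r
      · rw [Set.indicator_of_mem (show t ∈ Set.Iio r from ht), densX, if_pos ht,
          ENNReal.ofReal_add (M.nonneg_f _) (M.nonneg_f _)]
        rfl
      · rw [Set.indicator_of_notMem (show t ∉ Set.Iio r from ht), densX, if_neg ht,
          ENNReal.ofReal_zero]
    rw [h4, lintegral_indicator measurableSet_Iio, Measure.restrict_restrict measurableSet_Iio,
      Set.inter_comm]
  have h5 : Measurable fun t => ENNReal.ofReal (f (inward zl zh false t)) :=
    (M.measurable_f.comp (measurable_inward zl zh false)).ennreal_ofReal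
  rw [h3, lintegral_add_left h5, ← h2, ← h2]
  calc _ = μ {ω | |lateX zl zh (Z ω)| ∈ S'} := measure_congr h1
    _ = μ ({ω | depth zl zh false (Z ω) ∈ S'} ∪ {ω | depth zl zh true (Z ω) ∈ S'}) :=
        measure_congr (M.absX_mem_ae hsub)
    _ = _ := measure_union (disjoint_depth_mem hsub) (M.measurable_depth true hS'm)

/-- Integrals of functions of the distance to the nearest endpoint. -/
theorem LateDesign.setIntegral_map_absX (M : LateDesign μ Z D Y zl zh B δ f κ) {S : Set ℝ}
    (hSm : MeasurableSet S) (hS : S ⊆ Set.Ico 0 ((zh - zl) / 2)) (hSδ : S ⊆ Set.Iio δ)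
    (φ : ℝ → ℝ) :
    ∫ t in S, φ t ∂(μ.map fun ω => |lateX zl zh (Z ω)|) =
      ∫ t in S, (densMom f κ B zl zh t false 0 + densMom f κ B zl zh t true 0) * φ t := by
  have h1 : (μ.map fun ω => |lateX zl zh (Z ω)|).restrict S =
      (volume.restrict S).withDensity fun t => ENNReal.ofReal (densX f zl zh t) := by
    have h2 : S ⊆ Set.Ico 0 δ := fun t ht => ⟨(hS ht).1, hSδ ht⟩
    have := congrArg (fun m => m.restrict S) M.map_absX_restrict
    simpa only [Measure.restrict_restrict hSm, restrict_withDensity hSm,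
      Set.inter_eq_left.2 hSδ, Set.inter_eq_left.2 h2] using this
  rw [h1, integral_withDensity_eq_integral_toReal_smul
    (measurable_densX M.measurable_f).ennreal_ofReal
    (Eventually.of_forall fun _ => ENNReal.ofReal_lt_top)]
  refine setIntegral_congr_fun hSm fun t ht => ?_
  have h3 : densX f zl zh t = f (zl + t) + f (zh - t) := if_pos (hS ht).2
  have h4 : 0 ≤ densX f zl zh t := by rw [h3]; exact add_nonneg (M.nonneg_f _) (M.nonneg_f _)
  show (ENNReal.ofReal (densX f zl zh t)).toReal • φ t = _
  rw [ENNReal.toReal_ofReal h4, h3]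
  simp [densMom, integral_mom_zero, inward]

end Design

/-! ### The influence function -/

/-- The influence function at the moment vector `x`. -/
noncomputable def infl (B zl zh : ℝ) (x : Moments) (w : ℝ × ℝ × ℝ) : ℝ :=
  momWeight (side zl zh w.1) x * momResid (momIcpt x) (momSlope x) (fun j => mom B j w.2)

theorem measurable_momResid_mom (B a b : ℝ) :
    Measurable fun p : ℝ × ℝ => momResid a b (fun j => mom B j p) :=
  ((measurable_mom B 2).sub ((measurable_mom B 0).const_mul a)).sub
    ((measurable_mom B 1).const_mul b)

theorem measurable_infl (B zl zh : ℝ) (x : Moments) : Measurable (infl B zl zh x) := by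
  have h1 : Measurable fun w : ℝ × ℝ × ℝ => momWeight (side zl zh w.1) x :=
    (measurable_of_finite fun s => momWeight s x).comp
      ((measurable_side zl zh).comp measurable_fst)
  exact h1.mul ((measurable_momResid_mom B _ _).comp measurable_snd)

theorem abs_momResid_le {a b C R : ℝ} {y : Fin 5 → ℝ} (ha : |a| ≤ C) (hb : |b| ≤ C)
    (hC : 0 ≤ C) (hy : ∀ j, |y j| ≤ R) : |momResid a b y| ≤ (1 + 2 * C) * R := by
  have h1 : |a * y 0| ≤ C * R := by
    rw [abs_mul]; exact mul_le_mul ha (hy 0) (abs_nonneg _) hC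
  have h2 : |b * y 1| ≤ C * R := by
    rw [abs_mul]; exact mul_le_mul hb (hy 1) (abs_nonneg _) hC
  have h3 := abs_sub (y 2 - a * y 0) (b * y 1)
  have h4 := abs_sub (y 2) (a * y 0)
  have h5 := hy 2
  unfold momResid
  linarith

theorem abs_infl_le {B zl zh C : ℝ} (hB : 0 ≤ B) (hC : 0 ≤ C) {x : Moments}
    (hw : ∀ s, |momWeight s x| ≤ C) (ha : |momIcpt x| ≤ C) (hb : |momSlope x| ≤ C)
    (w : ℝ × ℝ × ℝ) : |infl B zl zh x w| ≤ C * ((1 + 2 * C) * (1 + B) ^ 2) := by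
  rw [infl, abs_mul]
  exact mul_le_mul (hw _) (abs_momResid_le ha hb hC fun j => abs_mom_le hB j w.2)
    (abs_nonneg _) hC

/-- A product of bounded Lipschitz factors is Lipschitz, uniformly in `w` because the truncated
moments are bounded. -/
theorem abs_infl_sub_le {B zl zh C e : ℝ} (hB : 0 ≤ B) (hC : 0 ≤ C) (he : 0 ≤ e) {x y : Moments}
    (hw : ∀ s, |momWeight s y| ≤ C) (ha : |momIcpt x| ≤ C) (hb : |momSlope x| ≤ C)
    (hw' : ∀ s, |momWeight s x - momWeight s y| ≤ C * e)
    (ha' : |momIcpt x - momIcpt y| ≤ C * e) (hb' : |momSlope x - momSlope y| ≤ C * e)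
    (w : ℝ × ℝ × ℝ) :
    |infl B zl zh x w - infl B zl zh y w| ≤ C * (1 + 4 * C) * (1 + B) ^ 2 * e := by
  have hm := fun j => abs_mom_le hB j w.2
  set R := (1 + B) ^ 2
  have hR : 0 ≤ R := (abs_nonneg _).trans (hm 0)
  set s := side zl zh w.1
  set r := fun z : Moments => momResid (momIcpt z) (momSlope z) (fun j => mom B j w.2)
  have h1 : |(momWeight s x - momWeight s y) * r x| ≤ C * e * ((1 + 2 * C) * R) := by
    rw [abs_mul]
    exact mul_le_mul (hw' s) (abs_momResid_le ha hb hC hm) (abs_nonneg _) (by positivity)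
  have h2 : |r x - r y| ≤ 2 * (C * e) * R := by
    have e1 : r x - r y = -((momIcpt x - momIcpt y) * mom B 0 w.2) -
        (momSlope x - momSlope y) * mom B 1 w.2 := by
      simp only [r, momResid]; ring
    have e2 := abs_sub (-((momIcpt x - momIcpt y) * mom B 0 w.2))
      ((momSlope x - momSlope y) * mom B 1 w.2)
    rw [abs_neg, abs_mul, abs_mul] at e2
    have e3 := mul_le_mul ha' (hm 0) (abs_nonneg _) (by positivity)
    have e4 := mul_le_mul hb' (hm 1) (abs_nonneg _) (by positivity)
    rw [e1]; linarith
  have h3 : |momWeight s y * (r x - r y)| ≤ C * (2 * (C * e) * R) := by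
    rw [abs_mul]
    exact mul_le_mul (hw s) h2 (abs_nonneg _) hC
  have h4 : infl B zl zh x w - infl B zl zh y w =
      (momWeight s x - momWeight s y) * r x + momWeight s y * (r x - r y) := by
    simp only [infl, r, s]; ring
  rw [h4]
  refine (abs_add_le _ _).trans ((add_le_add h1 h3).trans (le_of_eq ?_))
  ring

theorem lateMom_of_pos {Ω : Type*} [MeasurableSpace Ω] (μ : Measure Ω) (Z D Y : Ω → ℝ)
    (f : ℝ → ℝ) (κ : Kernel ℝ (ℝ × ℝ)) (B zl zh : ℝ) {h : ℝ} (h0 : 0 < h) (s : Bool) :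
    lateMom μ Z D Y f κ B zl zh h s = fun j =>
      h⁻¹ * ∫ ω in {ω | depth zl zh s (Z ω) ∈ Set.Icc 0 h}, mom B j (D ω, Y ω) ∂μ := by
  rw [lateMom, if_neg h0.ne']

theorem uniformKernel_div_eq {h : ℝ} (h0 : 0 < h) (x : ℝ) :
    uniformKernel (x / h) = (Set.Icc 0 h).indicator (fun _ => 1) |x| := by
  by_cases hx : |x| ≤ h
  · have hmem : |x| ∈ Set.Icc 0 h := ⟨abs_nonneg x, hx⟩
    rw [Set.indicator_of_mem hmem, uniformKernel, abs_div, abs_of_pos h0,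
      if_pos ((div_le_one h0).2 hx)]
  · have hmem : |x| ∉ Set.Icc 0 h := fun h1 => hx h1.2
    rw [Set.indicator_of_notMem hmem, uniformKernel, abs_div, abs_of_pos h0,
      if_neg fun h1 => hx ((div_le_one h0).1 h1)]

theorem mul_uniformKernel_eq_indicator {Ω : Type*} (X g : Ω → ℝ) {h : ℝ} (h0 : 0 < h) :
    (fun ω => g ω * uniformKernel (X ω / h)) = {ω | |X ω| ∈ Set.Icc 0 h}.indicator g := by
  funext ω
  rw [uniformKernel_div_eq h0]
  by_cases hx : |X ω| ∈ Set.Icc 0 h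
  · have hmem : ω ∈ {ω | |X ω| ∈ Set.Icc 0 h} := hx
    rw [Set.indicator_of_mem hx, Set.indicator_of_mem hmem, mul_one]
  · have hmem : ω ∉ {ω | |X ω| ∈ Set.Icc 0 h} := hx
    rw [Set.indicator_of_notMem hx, Set.indicator_of_notMem hmem, mul_zero]

section Design

variable {Ω : Type*} [MeasurableSpace Ω] {μ : Measure Ω}
  {Z D Y : Ω → ℝ} {zl zh B δ : ℝ} {f : ℝ → ℝ} {κ : Kernel ℝ (ℝ × ℝ)}
  [IsProbabilityMeasure μ] [IsMarkovKernel κ]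

theorem LateDesign.measurable_DY (M : LateDesign μ Z D Y zl zh B δ f κ) :
    Measurable fun ω => (D ω, Y ω) := M.measurable_D.prodMk M.measurable_Y

theorem LateDesign.integrable_mom (M : LateDesign μ Z D Y zl zh B δ f κ) (j : Fin 5) :
    Integrable (fun ω => mom B j (D ω, Y ω)) μ :=
  integrable_comp_of_abs_le M.measurable_DY (measurable_mom B j) (abs_mom_le M.nonneg_B j)

theorem LateDesign.integrable_momResid (M : LateDesign μ Z D Y zl zh B δ f κ) (c a b : ℝ) :
    Integrable (fun ω => c * momResid a b (fun j => mom B j (D ω, Y ω))) μ :=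
  (((M.integrable_mom 2).sub ((M.integrable_mom 0).const_mul a)).sub
    ((M.integrable_mom 1).const_mul b)).const_mul c

theorem LateDesign.integrable_momSq (M : LateDesign μ Z D Y zl zh B δ f κ) (c a b : ℝ) :
    Integrable (fun ω => c * momSq a b (fun j => mom B j (D ω, Y ω))) μ :=
  ((((((M.integrable_mom 4).add ((M.integrable_mom 0).const_mul _)).add
    ((M.integrable_mom 1).const_mul _)).sub ((M.integrable_mom 2).const_mul _)).sub
    ((M.integrable_mom 3).const_mul _)).add ((M.integrable_mom 1).const_mul _)).const_mul c

theorem LateDesign.infl_sq_ae (M : LateDesign μ Z D Y zl zh B δ f κ) (x : Moments) :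
    ∀ᵐ ω ∂μ, infl B zl zh x (Z ω, D ω, Y ω) ^ 2 = momWeight (side zl zh (Z ω)) x ^ 2 *
      momSq (momIcpt x) (momSlope x) (fun j => mom B j (D ω, Y ω)) := by
  filter_upwards [M.binary_D, M.bounded_Y] with ω h1 h2
  have h3 : ((D ω, Y ω).1 = 0 ∨ (D ω, Y ω).1 = 1) ∧ |(D ω, Y ω).2| ≤ B := ⟨h1, h2⟩
  rw [infl, mul_pow, momSq_mom h3]
  congr 2
  simp only [momResid, mom_eq_of_support h3]
  simp

/-- Integrals of the influence function over points close to an endpoint. -/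
theorem LateDesign.setIntegral_infl (M : LateDesign μ Z D Y zl zh B δ f κ) (x : Moments)
    {S : Set ℝ} (hSm : MeasurableSet S) (hS : S ⊆ Set.Iio ((zh - zl) / 2)) :
    ∫ ω in {ω | |lateX zl zh (Z ω)| ∈ S}, infl B zl zh x (Z ω, D ω, Y ω) ∂μ =
      momWeight false x * ∫ ω in {ω | depth zl zh false (Z ω) ∈ S},
        momResid (momIcpt x) (momSlope x) (fun j => mom B j (D ω, Y ω)) ∂μ +
      momWeight true x * ∫ ω in {ω | depth zl zh true (Z ω) ∈ S},
        momResid (momIcpt x) (momSlope x) (fun j => mom B j (D ω, Y ω)) ∂μ := by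
  have := M.setIntegral_absX hSm hS (G := fun s ω => momWeight s x *
    momResid (momIcpt x) (momSlope x) (fun j => mom B j (D ω, Y ω)))
    fun s => M.integrable_momResid _ _ _
  rw [integral_const_mul, integral_const_mul] at this
  exact this

theorem LateDesign.setIntegral_infl_sq (M : LateDesign μ Z D Y zl zh B δ f κ) (x : Moments)
    {S : Set ℝ} (hSm : MeasurableSet S) (hS : S ⊆ Set.Iio ((zh - zl) / 2)) :
    ∫ ω in {ω | |lateX zl zh (Z ω)| ∈ S}, infl B zl zh x (Z ω, D ω, Y ω) ^ 2 ∂μ =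
      momWeight false x ^ 2 * ∫ ω in {ω | depth zl zh false (Z ω) ∈ S},
        momSq (momIcpt x) (momSlope x) (fun j => mom B j (D ω, Y ω)) ∂μ +
      momWeight true x ^ 2 * ∫ ω in {ω | depth zl zh true (Z ω) ∈ S},
        momSq (momIcpt x) (momSlope x) (fun j => mom B j (D ω, Y ω)) ∂μ := by
  have := M.setIntegral_absX hSm hS (G := fun s ω => momWeight s x ^ 2 *
    momSq (momIcpt x) (momSlope x) (fun j => mom B j (D ω, Y ω)))
    fun s => M.integrable_momSq _ _ _
  rw [integral_const_mul, integral_const_mul] at this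
  rw [← this]
  exact setIntegral_congr_ae (M.measurable_absX hSm) ((M.infl_sq_ae x).mono fun ω h _ => h)

/-- Line and integral use the same bandwidth, so both residual moments vanish by the normal
equations. -/
theorem LateDesign.integral_infl (M : LateDesign μ Z D Y zl zh B δ f κ) {h : ℝ} (h0 : 0 < h)
    (h1 : h < (zh - zl) / 2) (hx : MomRegular (lateMom μ Z D Y f κ B zl zh h)) :
    ∫ ω, infl B zl zh (lateMom μ Z D Y f κ B zl zh h) (Z ω, D ω, Y ω) *
      uniformKernel (lateX zl zh (Z ω) / h) ∂μ = 0 := by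
  set x := lateMom μ Z D Y f κ B zl zh h with hxd
  have hset : MeasurableSet {ω | |lateX zl zh (Z ω)| ∈ Set.Icc 0 h} :=
    M.measurable_absX measurableSet_Icc
  rw [mul_uniformKernel_eq_indicator (fun ω => lateX zl zh (Z ω)) _ h0, integral_indicator hset,
    M.setIntegral_infl x measurableSet_Icc fun t ht => ht.2.trans_lt h1]
  have h2 : ∀ s, ∫ ω in {ω | depth zl zh s (Z ω) ∈ Set.Icc 0 h},
      momResid (momIcpt x) (momSlope x) (fun j => mom B j (D ω, Y ω)) ∂μ = 0 := fun s => by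
    have h3 := hx.momResid_eq_zero s
    have h4 := momResid_integral (m := μ.restrict {ω | depth zl zh s (Z ω) ∈ Set.Icc 0 h})
      (g := fun j ω => mom B j (D ω, Y ω)) (fun j => (M.integrable_mom j).integrableOn)
      (momIcpt x) (momSlope x) h⁻¹
    rw [← lateMom_of_pos μ Z D Y f κ B zl zh h0 s, ← hxd, h3] at h4
    exact ((mul_eq_zero.1 h4.symm).resolve_left (inv_pos.2 h0).ne')
  rw [h2, h2, mul_zero, mul_zero, add_zero]

/-- As the mean is zero, the variance is the second moment, `h` times the sum of squared weights
times squared-residual moments, and that sum is 1. -/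
theorem LateDesign.variance_infl (M : LateDesign μ Z D Y zl zh B δ f κ) {h : ℝ} (h0 : 0 < h)
    (h1 : h < (zh - zl) / 2) (hx : MomRegular (lateMom μ Z D Y f κ B zl zh h)) :
    h⁻¹ * Var[fun ω => infl B zl zh (lateMom μ Z D Y f κ B zl zh h) (Z ω, D ω, Y ω) *
      uniformKernel (lateX zl zh (Z ω) / h); μ] = 1 := by
  have hmean := M.integral_infl h0 h1 hx
  set x := lateMom μ Z D Y f κ B zl zh h with hxd
  have hm : Measurable fun ω => infl B zl zh x (Z ω, D ω, Y ω) :=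
    (measurable_infl B zl zh x).comp (M.measurable_Z.prodMk M.measurable_DY)
  have hset : MeasurableSet {ω | |lateX zl zh (Z ω)| ∈ Set.Icc 0 h} :=
    M.measurable_absX measurableSet_Icc
  rw [variance_of_integral_eq_zero _ hmean]
  · have h2 : ∀ ω, (infl B zl zh x (Z ω, D ω, Y ω) * uniformKernel (lateX zl zh (Z ω) / h)) ^ 2 =
        {ω | |lateX zl zh (Z ω)| ∈ Set.Icc 0 h}.indicator
          (fun ω => infl B zl zh x (Z ω, D ω, Y ω) ^ 2) ω := fun ω => by
      have := congrFun (mul_uniformKernel_eq_indicator (fun ω => lateX zl zh (Z ω))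
        (fun ω => infl B zl zh x (Z ω, D ω, Y ω)) h0) ω
      refine (congrArg (· ^ 2) this).trans ?_
      by_cases hx : ω ∈ {ω | |lateX zl zh (Z ω)| ∈ Set.Icc 0 h}
      · simp only [Set.indicator_of_mem hx]
      · simp only [Set.indicator_of_notMem hx]; norm_num
    simp only [h2]
    rw [integral_indicator hset,
      M.setIntegral_infl_sq x measurableSet_Icc fun t ht => ht.2.trans_lt h1]
    have h3 : ∀ s, ∫ ω in {ω | depth zl zh s (Z ω) ∈ Set.Icc 0 h},
        momSq (momIcpt x) (momSlope x) (fun j => mom B j (D ω, Y ω)) ∂μ =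
        h * momSq (momIcpt x) (momSlope x) (x s) := fun s => by
      have h4 := momSq_integral (m := μ.restrict {ω | depth zl zh s (Z ω) ∈ Set.Icc 0 h})
        (g := fun j ω => mom B j (D ω, Y ω)) (fun j => (M.integrable_mom j).integrableOn)
        (momIcpt x) (momSlope x) h⁻¹
      rw [← lateMom_of_pos μ Z D Y f κ B zl zh h0 s, ← hxd] at h4
      rw [h4]; field_simp
    rw [h3, h3]
    have h5 := hx.sum_momWeight_sq
    calc _ = momWeight false x ^ 2 * momSq (momIcpt x) (momSlope x) (x false) +
          momWeight true x ^ 2 * momSq (momIcpt x) (momSlope x) (x true) := by field_simp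
      _ = 1 := h5
  · rw [mul_uniformKernel_eq_indicator (fun ω => lateX zl zh (Z ω)) _ h0]
    exact (hm.indicator hset).aemeasurable

end Design

/-! ### Conditional moments given the distance to the nearest endpoint; regularity of the design -/

theorem LogLogCont.congr {g k : ℝ → ℝ} (hg : LogLogCont g) {r : ℝ} (hr : 0 < r)
    (h : ∀ t ∈ Set.Ico 0 r, k t = g t) : LogLogCont k := by
  refine Asymptotics.IsLittleO.congr' hg ?_ EventuallyEq.rfl
  filter_upwards [Ioo_mem_nhdsGT hr] with t ht
  rw [h t ⟨ht.1.le, ht.2⟩, h 0 ⟨le_rfl, hr⟩]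

theorem exists_forall_Ico_of_eventually {P : ℝ → Prop} (h : ∀ᶠ t in 𝓝[>] 0, P t) (h0 : P 0) :
    ∃ r, 0 < r ∧ ∀ t ∈ Set.Ico (0 : ℝ) r, P t := by
  obtain ⟨r, hr, h1⟩ := mem_nhdsGT_iff_exists_Ioo_subset.1 h
  refine ⟨r, hr, fun t ht => ?_⟩
  rcases ht.1.eq_or_lt with h2 | h2
  · rwa [← h2]
  · exact h1 ⟨h2, ht.2⟩

theorem momResid_eq_sum (a b : ℝ) (y : Fin 5 → ℝ) :
    momResid a b y = ∑ j, ![-a, -b, 1, 0, 0] j * y j := by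
  simp [Fin.sum_univ_five, momResid]; ring

theorem momSq_eq_sum (a b : ℝ) (y : Fin 5 → ℝ) :
    momSq a b y = ∑ j, ![a ^ 2, b ^ 2 + 2 * a * b, -(2 * a), -(2 * b), 1] j * y j := by
  simp [Fin.sum_univ_five, momSq]; ring

/-- The conditional mean given the distance to the nearest endpoint, as a function of the moments
at the two points at that distance. -/
noncomputable def condMom (c x : Moments) : ℝ :=
  (∑ j, c false j * x false j + ∑ j, c true j * x true j) / (x false 0 + x true 0)

theorem differentiableAt_condMom (c : Moments) {x : Moments} (hx : x false 0 + x true 0 ≠ 0) :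
    DifferentiableAt ℝ (condMom c) x := by
  unfold condMom
  fun_prop (disch := assumption)

section Design

variable {Ω : Type*} [MeasurableSpace Ω] {μ : Measure Ω}
  {Z D Y : Ω → ℝ} {zl zh B δ : ℝ} {f : ℝ → ℝ} {κ : Kernel ℝ (ℝ × ℝ)}
  [IsProbabilityMeasure μ] [IsMarkovKernel κ]

/-- Given |X| = t, the point is at depth t from one of the endpoints, with odds given by the
densities. Multiplying the ratio `condMom` by the density of |X| cancels its denominator and returns
the sum of the contributions of the two endpoints. -/
theorem LateDesign.exists_condMom_version (M : LateDesign μ Z D Y zl zh B δ f κ)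
    (hw : LogLogCont (densMom f κ B zl zh))
    (h0 : 0 < densMom f κ B zl zh 0 false 0 + densMom f κ B zl zh 0 true 0) (c : Moments)
    {Ψ : Ω → ℝ} (hΨ : Integrable Ψ μ)
    (h : ∀ᵐ ω ∂μ, Ψ ω = ∑ j, c (side zl zh (Z ω)) j * mom B j (D ω, Y ω)) :
    ∃ m : ℝ → ℝ, Measurable m ∧ LogLogCont m ∧ m 0 = condMom c (densMom f κ B zl zh 0) ∧
      μ[Ψ | MeasurableSpace.comap (fun ω => |lateX zl zh (Z ω)|) inferInstance] =ᵐ[μ]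
        fun ω => m |lateX zl zh (Z ω)| := by
  set w := densMom f κ B zl zh with hwdef
  set φ : ℝ → ℝ := fun t => condMom c (w t) with hφ
  have hφc : LogLogCont φ := hw.comp (differentiableAt_condMom c h0.ne')
  have hwm : ∀ s j, Measurable fun t => w t s j := fun s j =>
    measurable_densMom M.measurable_f s j
  have hφm : Measurable φ :=
    ((Finset.measurable_sum _ fun j _ => (hwm false j).const_mul _).add
      (Finset.measurable_sum _ fun j _ => (hwm true j).const_mul _)).div
      ((hwm false 0).add (hwm true 0))
  obtain ⟨t₀, L, ht₀, hδ, hz, -, hL⟩ := M.exists_densMom_le hw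
  have hden : LogLogCont fun t => w t false 0 + w t true 0 :=
    hw.comp (φ := fun x : Moments => x false 0 + x true 0) (by fun_prop)
  obtain ⟨r, hr, hP⟩ := exists_forall_Ico_of_eventually
    (P := fun t => 0 < w t false 0 + w t true 0 ∧ |φ t| < |φ 0| + 1)
    ((hden.tendsto.eventually_const_lt h0).and
      (hφc.tendsto.abs.eventually_lt_const (lt_add_one _))) ⟨h0, lt_add_one _⟩
  set t₁ := min t₀ r with ht₁
  have ht₁0 : 0 < t₁ := lt_min ht₀ hr
  have hI : ∀ t ∈ Set.Ico 0 t₁, t ∈ Set.Icc 0 t₀ ∧ t ∈ Set.Ico 0 r := fun t ht =>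
    ⟨⟨ht.1, (ht.2.trans_le (min_le_left _ _)).le⟩, ⟨ht.1, ht.2.trans_le (min_le_right _ _)⟩⟩
  have := Measure.isProbabilityMeasure_map (μ := μ) M.measurable_absX.aemeasurable
  have hφi : IntegrableOn φ (Set.Ico 0 t₁) (μ.map fun ω => |lateX zl zh (Z ω)|) :=
    Measure.integrableOn_of_bounded (M := |φ 0| + 1) (measure_ne_top _ _)
      hφm.aestronglyMeasurable ((ae_restrict_iff' measurableSet_Ico).2
        (Eventually.of_forall fun t ht => (hP t (hI t ht).2).2.le))
  obtain ⟨m, hm, hmφ, hme⟩ := exists_condExp_version M.measurable_absX hΨ hφm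
    measurableSet_Ico hφi fun S hS hSI => by
      have hSδ : S ⊆ Set.Iio δ := fun t ht => (hI t (hSI ht)).1.2.trans_lt hδ
      have hSz : S ⊆ Set.Iio ((zh - zl) / 2) := fun t ht => (hI t (hSI ht)).1.2.trans_lt hz
      have e1 : ∫ ω in (fun ω => |lateX zl zh (Z ω)|) ⁻¹' S, Ψ ω ∂μ =
          ∫ ω in {ω | |lateX zl zh (Z ω)| ∈ S},
            ∑ j, c (side zl zh (Z ω)) j * mom B j (D ω, Y ω) ∂μ :=
        setIntegral_congr_ae (M.measurable_absX hS) (h.mono fun ω h _ => h)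
      have e2 := M.setIntegral_absX hS hSz (G := fun s ω => ∑ j, c s j * mom B j (D ω, Y ω))
        fun s => integrable_finsetSum _ fun j _ => (M.integrable_mom j).const_mul _
      have hwi : ∀ s j, IntegrableOn (fun t => c s j * w t s j) S volume := fun s j => by
        refine Measure.integrableOn_of_bounded (M := |c s j| * L)
          ((measure_mono hSI).trans_lt measure_Ico_lt_top).ne
          ((hwm s j).const_mul _).aestronglyMeasurable
          ((ae_restrict_iff' hS).2 (Eventually.of_forall fun t ht => ?_))
        rw [norm_mul]
        exact mul_le_mul_of_nonneg_left (hL t (hI t (hSI ht)).1 s j) (abs_nonneg _)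
      have e3 : ∀ s, ∫ ω in {ω | depth zl zh s (Z ω) ∈ S}, ∑ j, c s j * mom B j (D ω, Y ω) ∂μ =
          ∫ t in S, ∑ j, c s j * w t s j := fun s => by
        rw [integral_finsetSum _ fun j _ => ((M.integrable_mom j).const_mul _).integrableOn,
          integral_finsetSum _ fun j _ => hwi s j]
        refine Finset.sum_congr rfl fun j _ => ?_
        rw [integral_const_mul, integral_const_mul, M.setIntegral_mom s j hS hSδ]
      rw [e1, e2, e3, e3, M.setIntegral_map_absX hS (fun t ht => ⟨(hSI ht).1, hSz ht⟩) hSδ,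
        ← integral_add (integrable_finsetSum _ fun j _ => hwi false j)
          (integrable_finsetSum _ fun j _ => hwi true j)]
      refine setIntegral_congr_fun hS fun t ht => ?_
      exact (mul_div_cancel₀ _ (hP t (hI t (hSI ht)).2).1.ne').symm
  exact ⟨m, hm, hφc.congr ht₁0 hmφ, hmφ 0 ⟨le_rfl, ht₁0⟩, hme⟩

/-- For small bandwidths the influence function satisfies the regularity conditions. -/
theorem LateDesign.exists_dgpRegular (M : LateDesign μ Z D Y zl zh B δ f κ)
    (hw : LogLogCont (densMom f κ B zl zh)) (hreg : MomRegular (densMom f κ B zl zh 0)) :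
    ∃ η, 0 < η ∧ ∀ hhi : ℕ → ℝ, (∀ n, hhi n ≤ η) →
      DgpRegular μ (fun ω => lateX zl zh (Z ω)) (fun ω => (Z ω, D ω, Y ω)) δ hhi uniformKernel
        fun v h => infl B zl zh (lateMom μ Z D Y f κ B zl zh h) v := by
  set w := densMom f κ B zl zh with hwdef
  set u := lateMom μ Z D Y f κ B zl zh with hudef
  have hu : LogLogCont u := M.logLogCont_lateMom hw
  have hu0 : u 0 = w 0 := if_pos rfl
  obtain ⟨ρ, hρ, C, hC, hball⟩ := hreg.exists_ball
  have hut : Tendsto u (𝓝[>] 0) (𝓝 (w 0)) := hu0 ▸ hu.tendsto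
  obtain ⟨r, hr, hrb⟩ := exists_forall_Ico_of_eventually (P := fun t => u t ∈ Metric.ball (w 0) ρ)
    (hut (Metric.ball_mem_nhds _ hρ)) (by rw [hu0]; exact Metric.mem_ball_self hρ)
  have hsum : 0 < w 0 false 0 + w 0 true 0 := add_pos (hreg.1 _) (hreg.1 _)
  set a := momIcpt (w 0) with ha
  set b := momSlope (w 0) with hb
  set ψ₀ : Ω → ℝ := fun ω => infl B zl zh (w 0) (Z ω, D ω, Y ω) with hψ₀
  have hψm : Measurable ψ₀ :=
    (measurable_infl B zl zh _).comp (M.measurable_Z.prodMk M.measurable_DY)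
  have hw0 := hball (w 0) (Metric.mem_ball_self hρ)
  have hψb := fun v => abs_infl_le (zl := zl) (zh := zh) M.nonneg_B hC hw0.2.1 hw0.2.2.1
    hw0.2.2.2.1 v
  have hψL : MemLp ψ₀ 2 μ :=
    MemLp.of_bound hψm.aestronglyMeasurable _ (Eventually.of_forall fun ω => hψb _)
  -- The influence function at bandwidth 0 and its square are linear combinations of the truncated
  -- moments, with coefficients depending only on the side; one lemma thus handles both the
  -- conditional mean and the conditional second moment.
  obtain ⟨m, hm, hmc, hm0, hme⟩ := M.exists_condMom_version hw hsum
    (fun s j => momWeight s (w 0) * ![-a, -b, 1, 0, 0] j) (hψL.integrable one_le_two)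
    (Eventually.of_forall fun ω => by
      simp only [mul_assoc]
      rw [← Finset.mul_sum, ← momResid_eq_sum a b fun j => mom B j (D ω, Y ω)]
      rfl)
  obtain ⟨q, hq, hqc, hq0, hqe⟩ := M.exists_condMom_version hw hsum
    (fun s j => momWeight s (w 0) ^ 2 * ![a ^ 2, b ^ 2 + 2 * a * b, -(2 * a), -(2 * b), 1] j)
    (Ψ := ψ₀ ^ 2) hψL.integrable_sq ((M.infl_sq_ae (w 0)).mono fun ω hω => by
      simp only [mul_assoc]
      rw [← Finset.mul_sum]
      refine hω.trans ?_
      rw [momSq_eq_sum]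
      simp only [mul_assoc, ha, hb])
  -- Normal equations in the limit `h = 0`.
  have hm00 : m 0 = 0 := by
    rw [hm0, condMom]
    simp only [mul_assoc]
    rw [← Finset.mul_sum, ← Finset.mul_sum, ← momResid_eq_sum, ← momResid_eq_sum,
      hreg.momResid_eq_zero, hreg.momResid_eq_zero]
    simp
  -- The second moment at 0 is the reciprocal of the sum of the two endpoint densities.
  have hq00 : 0 < q 0 := by
    rw [hq0, condMom]
    have e : ∀ s, ∑ j, momWeight s (w 0) ^ 2 *
        ![a ^ 2, b ^ 2 + 2 * a * b, -(2 * a), -(2 * b), 1] j * w 0 s j =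
        momWeight s (w 0) ^ 2 * momSq a b (w 0 s) := fun s => by
      rw [momSq_eq_sum, Finset.mul_sum]
      exact Finset.sum_congr rfl fun j _ => mul_assoc _ _ _
    rw [e, e, hreg.sum_momWeight_sq]
    exact div_pos one_pos hsum
  have hvc : LogLogCont fun t => q t - m t ^ 2 :=
    (hqc.prodMk hmc).comp (φ := fun p => p.1 - p.2 ^ 2) (by fun_prop)
  have hgc : LogLogCont (densX f zl zh) := by
    have h1 : LogLogCont fun t => w t false 0 + w t true 0 :=
      hw.comp (φ := fun x : Moments => x false 0 + x true 0) (by fun_prop)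
    refine h1.congr (r := (zh - zl) / 2) (by linarith [M.lt]) fun t ht => ?_
    rw [densX, if_pos ht.2]
    simp [hwdef, densMom, integral_mom_zero, inward]
  have hg0 : densX f zl zh 0 = w 0 false 0 + w 0 true 0 := by
    rw [densX, if_pos (by linarith [M.lt])]
    simp [hwdef, densMom, integral_mom_zero, inward]
  set K := C * (1 + 4 * C) * (1 + B) ^ 2 with hK
  have hB := M.nonneg_B
  have hK0 : 0 ≤ K := by positivity
  have hul : LogLogModulus fun t => K * ‖u t - w 0‖ := by
    refine logLogModulus_iff.2 (Asymptotics.IsLittleO.const_mul_left ?_ K)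
    have := Asymptotics.IsLittleO.norm_left hu
    rwa [hu0] at this
  refine ⟨r / 2, half_pos hr, fun hhi hhη => ?_⟩
  have hbw : ∀ h ∈ bandwidths hhi, u h ∈ Metric.ball (w 0) ρ := fun h ⟨h0, n, hn⟩ =>
    hrb h ⟨h0.le, by linarith [hhη n]⟩
  have hk : ∀ x, |uniformKernel x| ≤ 1 := fun x => by unfold uniformKernel; split_ifs <;> simp
  -- A single modulus is needed, so the four increments are added; each is bounded by the sum.
  refine ⟨fun t => |densX f zl zh t - densX f zl zh 0| + |m t - m 0| +
      |(q t - m t ^ 2) - (q 0 - m 0 ^ 2)| + K * ‖u t - w 0‖, densX f zl zh, m,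
    fun t => q t - m t ^ 2, ((hgc.logLogModulus.add hmc.logLogModulus).add
      hvc.logLogModulus).add hul, measurable_densX M.measurable_f, fun t => ?_,
    M.map_absX_restrict, ?_, hm, ?_, hq.sub (hm.pow_const 2), ?_, ?_, ⟨C * ((1 + 2 * C) *
      (1 + B) ^ 2), fun h hh => Eventually.of_forall fun ω => ?_⟩, fun t _ => ?_, fun t _ => ?_,
    fun t _ => ?_, fun t ht => Eventually.of_forall fun ω => ?_⟩
  · unfold densX
    split_ifs
    · exact add_nonneg (M.nonneg_f _) (M.nonneg_f _)
    · exact le_rfl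
  · rw [hg0]; exact hsum
  · simp only [hu0]
    exact hme
  · simp only [hu0]
    filter_upwards [condVar_ae_eq_condExp_sq_sub_sq_condExp M.measurable_absX.comap_le hψL, hme,
      hqe] with ω h1 h2 h3
    rw [h1]
    simp only [Pi.sub_apply, Pi.pow_apply, h2, h3]
  · show 0 < q 0 - m 0 ^ 2
    rw [hm00]; simpa using hq00
  · have h1 := hball _ (hbw h hh)
    rw [abs_mul]
    exact (mul_le_of_le_one_right (abs_nonneg _) (hk _)).trans
      (abs_infl_le M.nonneg_B hC h1.2.1 h1.2.2.1 h1.2.2.2.1 _)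
  · have := abs_nonneg (m t - m 0)
    have := abs_nonneg ((q t - m t ^ 2) - (q 0 - m 0 ^ 2))
    have : 0 ≤ K * ‖u t - w 0‖ := by positivity
    linarith
  · have := abs_nonneg (densX f zl zh t - densX f zl zh 0)
    have := abs_nonneg ((q t - m t ^ 2) - (q 0 - m 0 ^ 2))
    have : 0 ≤ K * ‖u t - w 0‖ := by positivity
    linarith
  · have := abs_nonneg (densX f zl zh t - densX f zl zh 0)
    have := abs_nonneg (m t - m 0)
    have : 0 ≤ K * ‖u t - w 0‖ := by positivity
    linarith
  · have h1 := hball _ (hbw t ht)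
    have h2 := h1.2.2.2.2 (w 0) (Metric.mem_ball_self hρ)
    have h3 := abs_infl_sub_le (zl := zl) (zh := zh) M.nonneg_B hC (norm_nonneg (u t - w 0))
      hw0.2.1 h1.2.2.1 h1.2.2.2.1 h2.1 h2.2.1 h2.2.2 (Z ω, D ω, Y ω)
    show |(infl B zl zh (u t) (Z ω, D ω, Y ω) - infl B zl zh (u 0) (Z ω, D ω, Y ω)) *
      uniformKernel (lateX zl zh (Z ω) / t)| ≤ |densX f zl zh t - densX f zl zh 0| + |m t - m 0| +
        |q t - m t ^ 2 - (q 0 - m 0 ^ 2)| + K * ‖u t - w 0‖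
    rw [hu0, abs_mul]
    have h4 := (mul_le_of_le_one_right (abs_nonneg (infl B zl zh (u t) (Z ω, D ω, Y ω) -
      infl B zl zh (w 0) (Z ω, D ω, Y ω))) (hk (lateX zl zh (Z ω) / t))).trans h3
    have := abs_nonneg (densX f zl zh t - densX f zl zh 0)
    have := abs_nonneg (m t - m 0)
    have := abs_nonneg ((q t - m t ^ 2) - (q 0 - m 0 ^ 2))
    linarith

end Design

/-! ### The estimators as functions of sample moments -/

/-- The observations within a distance `h` of the endpoint `s`. -/
def nearSet (zl zh : ℝ) (s : Bool) (h : ℝ) : Set (ℝ × ℝ × ℝ) :=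
  {v | depth zl zh s v.1 ∈ Set.Icc 0 h}

/-- The sample analogue of `lateMom`. -/
noncomputable def sampMom (B zl zh : ℝ) (n : ℕ) (v : ℕ → ℝ × ℝ × ℝ) (h : ℝ) : Moments :=
  fun s j => (n * h)⁻¹ *
    ∑ i ∈ Finset.range n, (nearSet zl zh s h).indicator (fun w => mom B j w.2) (v i)

theorem mem_Icc_iff_depth_false {zl zh h z : ℝ} :
    z ∈ Set.Icc zl (zl + h) ↔ depth zl zh false z ∈ Set.Icc 0 h := by
  simp only [depth, Set.mem_Icc, Bool.false_eq_true, if_false]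
  constructor <;> rintro ⟨h1, h2⟩ <;> constructor <;> linarith

theorem mem_Icc_iff_depth_true {zl zh h z : ℝ} :
    z ∈ Set.Icc (zh - h) zh ↔ depth zl zh true z ∈ Set.Icc 0 h := by
  simp only [depth, Set.mem_Icc, if_true]
  constructor <;> rintro ⟨h1, h2⟩ <;> constructor <;> linarith

/-- The set of instrument values within a distance `h` of the endpoint `s`. -/
def nearIcc (zl zh : ℝ) (s : Bool) (h : ℝ) : Set ℝ :=
  if s then Set.Icc (zh - h) zh else Set.Icc zl (zl + h)

theorem mem_nearIcc {zl zh h z : ℝ} {s : Bool} :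
    z ∈ nearIcc zl zh s h ↔ depth zl zh s z ∈ Set.Icc 0 h := by
  cases s
  · exact mem_Icc_iff_depth_false
  · exact mem_Icc_iff_depth_true

section Sample

variable {B zl zh h : ℝ} {n : ℕ} {z d y : ℕ → ℝ}

theorem mem_of_mem_obsIn {A : Set ℝ} {i : ℕ} (hi : i ∈ obsIn n z A) : z i ∈ A := by
  classical
  exact (Finset.mem_filter.1 hi).2

theorem sum_obsIn_mom (hn : 0 < n) (h0 : 0 < h) (s : Bool) (j : Fin 5) :
    ∑ i ∈ obsIn n z (nearIcc zl zh s h), mom B j (d i, y i) =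
      n * h * sampMom B zl zh n (fun i => (z i, d i, y i)) h s j := by
  have hn' : (n : ℝ) ≠ 0 := by exact_mod_cast hn.ne'
  rw [sampMom, ← mul_assoc, mul_inv_cancel₀ (mul_ne_zero hn' h0.ne'), one_mul, obsIn,
    Finset.sum_filter]
  refine Finset.sum_congr rfl fun i _ => ?_
  by_cases hi : z i ∈ nearIcc zl zh s h
  · have : (z i, d i, y i) ∈ nearSet zl zh s h := mem_nearIcc.1 hi
    rw [if_pos hi, Set.indicator_of_mem this]
  · have : (z i, d i, y i) ∉ nearSet zl zh s h := fun h1 => hi (mem_nearIcc.2 h1)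
    rw [if_neg hi, Set.indicator_of_notMem this]

theorem sum_obsIn_linear (hn : 0 < n) (h0 : 0 < h) (s : Bool) (c : Fin 5 → ℝ) :
    ∑ i ∈ obsIn n z (nearIcc zl zh s h), ∑ j, c j * mom B j (d i, y i) =
      n * h * ∑ j, c j * sampMom B zl zh n (fun i => (z i, d i, y i)) h s j := by
  rw [Finset.sum_comm, Finset.mul_sum]
  refine Finset.sum_congr rfl fun j _ => ?_
  rw [← Finset.mul_sum, sum_obsIn_mom hn h0]
  ring

theorem sum_obsIn_eq (hd : ∀ i, d i = 0 ∨ d i = 1) (hy : ∀ i, |y i| ≤ B) (hn : 0 < n)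
    (h0 : 0 < h) (s : Bool) (j : Fin 5) :
    ∑ i ∈ obsIn n z (nearIcc zl zh s h), ![1, d i, y i, d i * y i, y i ^ 2] j =
      n * h * sampMom B zl zh n (fun i => (z i, d i, y i)) h s j := by
  rw [← sum_obsIn_mom hn h0]
  refine Finset.sum_congr rfl fun i _ => ?_
  rw [mom_eq_of_support (p := (d i, y i)) ⟨hd i, hy i⟩]

theorem card_obsIn (hd : ∀ i, d i = 0 ∨ d i = 1) (hy : ∀ i, |y i| ≤ B) (hn : 0 < n)
    (h0 : 0 < h) (s : Bool) :
    ((obsIn n z (nearIcc zl zh s h)).card : ℝ) =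
      n * h * sampMom B zl zh n (fun i => (z i, d i, y i)) h s 0 := by
  rw [← sum_obsIn_eq hd hy hn h0 s 0]
  simp

theorem lateEst_eq (hd : ∀ i, d i = 0 ∨ d i = 1) (hy : ∀ i, |y i| ≤ B) (hn : 0 < n)
    (h0 : 0 < h) :
    lateEst n z d y zl zh h = momSlope (sampMom B zl zh n (fun i => (z i, d i, y i)) h) := by
  have hc : (n : ℝ) * h ≠ 0 := mul_ne_zero (by exact_mod_cast hn.ne') h0.ne'
  set x := sampMom B zl zh n (fun i => (z i, d i, y i)) h with hx
  have hD : ∀ s, avgIn n z d (nearIcc zl zh s h) = x s 1 / x s 0 := fun s => by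
    have h1 : ∑ i ∈ obsIn n z (nearIcc zl zh s h), d i = n * h * x s 1 :=
      sum_obsIn_eq hd hy hn h0 s 1
    rw [avgIn, h1, card_obsIn hd hy hn h0, ← hx, one_div_mul_eq_div, mul_div_mul_left _ _ hc]
  have hY : ∀ s, avgIn n z y (nearIcc zl zh s h) = x s 2 / x s 0 := fun s => by
    have h1 : ∑ i ∈ obsIn n z (nearIcc zl zh s h), y i = n * h * x s 2 :=
      sum_obsIn_eq hd hy hn h0 s 2
    rw [avgIn, h1, card_obsIn hd hy hn h0, ← hx, one_div_mul_eq_div, mul_div_mul_left _ _ hc]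
  rw [momSlope, momDen, ← hD, ← hD, ← hY, ← hY]
  rfl

/-- For `h` below half the length, the two windows are disjoint. -/
theorem sum_ivSample {M : Type*} [AddCommMonoid M] (h1 : h < (zh - zl) / 2) (F : ℕ → M) :
    ∑ i ∈ ivSample n z zl zh h, F i = ∑ i ∈ obsIn n z (nearIcc zl zh false h), F i +
      ∑ i ∈ obsIn n z (nearIcc zl zh true h), F i := by
  classical
  have hdisj : Disjoint (obsIn n z (nearIcc zl zh false h)) (obsIn n z (nearIcc zl zh true h)) := by
    refine Finset.disjoint_left.2 fun i hi hi' => ?_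
    have a1 : z i ∈ Set.Icc zl (zl + h) := (Finset.mem_filter.1 hi).2
    have a2 : z i ∈ Set.Icc (zh - h) zh := (Finset.mem_filter.1 hi').2
    linarith [a1.2, a2.1]
  rw [← Finset.sum_union hdisj]
  refine Finset.sum_congr ?_ fun _ _ => rfl
  ext i
  simp only [ivSample, obsIn, Finset.mem_filter, Finset.mem_union, Set.mem_union, nearIcc,
    Bool.false_eq_true, if_false, if_true]
  tauto

theorem ivInstr_of_mem (h1 : h < (zh - zl) / 2) {s : Bool} {i : ℕ}
    (hi : i ∈ obsIn n z (nearIcc zl zh s h)) :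
    ivInstr zh h (z i) = ![1, if s then 1 else 0] := by
  have h2 := mem_of_mem_obsIn hi
  cases s
  · have a1 : z i ∈ Set.Icc zl (zl + h) := h2
    have : ¬ zh - h ≤ z i := by linarith [a1.2]
    simp [ivInstr, this]
  · have a1 : z i ∈ Set.Icc (zh - h) zh := h2
    simp only [ivInstr, if_pos a1.1, if_true]

theorem ivCross_eq (hd : ∀ i, d i = 0 ∨ d i = 1) (hy : ∀ i, |y i| ≤ B) (hn : 0 < n)
    (h0 : 0 < h) (h1 : h < (zh - zl) / 2) {x : Moments}
    (hx : x = sampMom B zl zh n (fun i => (z i, d i, y i)) h) :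
    ivCross n z d zl zh h = !![n * h * (x false 0 + x true 0), n * h * (x false 1 + x true 1);
      n * h * x true 0, n * h * x true 1] := by
  have e0 : ∀ s, ∑ i ∈ obsIn n z (nearIcc zl zh s h), (1 : ℝ) = n * h * x s 0 := fun s => by
    rw [hx]; exact sum_obsIn_eq hd hy hn h0 s 0
  have e1 : ∀ s, ∑ i ∈ obsIn n z (nearIcc zl zh s h), d i = n * h * x s 1 := fun s => by
    rw [hx]; exact sum_obsIn_eq hd hy hn h0 s 1
  have e : ∀ s a b, ∑ i ∈ obsIn n z (nearIcc zl zh s h),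
      Matrix.vecMulVec (ivInstr zh h (z i)) (ivRegr (d i)) a b =
      (![1, if s then 1 else 0] : Fin 2 → ℝ) a *
        (![n * h * x s 0, n * h * x s 1] : Fin 2 → ℝ) b := fun s a b => by
    have : ∀ i ∈ obsIn n z (nearIcc zl zh s h),
        Matrix.vecMulVec (ivInstr zh h (z i)) (ivRegr (d i)) a b =
        (![1, if s then 1 else 0] : Fin 2 → ℝ) a * (![1, d i] : Fin 2 → ℝ) b := fun i hi => by
      rw [Matrix.vecMulVec_apply, ivInstr_of_mem h1 hi, ivRegr]
    rw [Finset.sum_congr rfl this, ← Finset.mul_sum]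
    congr 1
    fin_cases b
    · exact e0 s
    · exact e1 s
  ext a b
  rw [ivCross, Matrix.sum_apply, sum_ivSample h1, e, e]
  fin_cases a <;> fin_cases b <;> simp <;> ring

theorem ivRhs_eq (hd : ∀ i, d i = 0 ∨ d i = 1) (hy : ∀ i, |y i| ≤ B) (hn : 0 < n)
    (h0 : 0 < h) (h1 : h < (zh - zl) / 2) {x : Moments}
    (hx : x = sampMom B zl zh n (fun i => (z i, d i, y i)) h) :
    ∑ i ∈ ivSample n z zl zh h, y i • ivInstr zh h (z i) =
      ![n * h * (x false 2 + x true 2), n * h * x true 2] := by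
  have e2 : ∀ s, ∑ i ∈ obsIn n z (nearIcc zl zh s h), y i = n * h * x s 2 := fun s => by
    rw [hx]; exact sum_obsIn_eq hd hy hn h0 s 2
  have e : ∀ s, ∑ i ∈ obsIn n z (nearIcc zl zh s h), y i • ivInstr zh h (z i) =
      (n * h * x s 2) • (![1, if s then 1 else 0] : Fin 2 → ℝ) := fun s => by
    rw [← e2, Finset.sum_smul]
    exact Finset.sum_congr rfl fun i hi => by rw [ivInstr_of_mem h1 hi]
  rw [sum_ivSample h1, e, e]
  ext a
  fin_cases a <;> simp <;> ring

theorem ivCross_det (hd : ∀ i, d i = 0 ∨ d i = 1) (hy : ∀ i, |y i| ≤ B) (hn : 0 < n)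
    (h0 : 0 < h) (h1 : h < (zh - zl) / 2) {x : Moments}
    (hx : x = sampMom B zl zh n (fun i => (z i, d i, y i)) h) (hreg : MomRegular x) :
    (ivCross n z d zl zh h).det = -((n * h) ^ 2 * (x false 0 * x true 0 * momDen x)) := by
  have a0 := (hreg.1 false).ne'
  have a1 := (hreg.1 true).ne'
  rw [ivCross_eq hd hy hn h0 h1 hx, Matrix.det_fin_two_of, momDen]
  field_simp
  ring

theorem ivCross_det_ne_zero (hd : ∀ i, d i = 0 ∨ d i = 1) (hy : ∀ i, |y i| ≤ B) (hn : 0 < n)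
    (h0 : 0 < h) (h1 : h < (zh - zl) / 2) {x : Moments}
    (hx : x = sampMom B zl zh n (fun i => (z i, d i, y i)) h) (hreg : MomRegular x) :
    (ivCross n z d zl zh h).det ≠ 0 := by
  have hn' : (n : ℝ) ≠ 0 := by exact_mod_cast hn.ne'
  rw [ivCross_det hd hy hn h0 h1 hx hreg]
  exact neg_ne_zero.2 (mul_ne_zero (pow_ne_zero 2 (mul_ne_zero hn' h0.ne'))
    (mul_ne_zero (mul_ne_zero (hreg.1 false).ne' (hreg.1 true).ne') hreg.2.1))

/-- The cross moment matrix is invertible, so it suffices to check that intercept and slope solve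
the IV equations, which are combinations of the normal equations at the two endpoints. -/
theorem ivCoef_eq (hd : ∀ i, d i = 0 ∨ d i = 1) (hy : ∀ i, |y i| ≤ B) (hn : 0 < n)
    (h0 : 0 < h) (h1 : h < (zh - zl) / 2) {x : Moments}
    (hx : x = sampMom B zl zh n (fun i => (z i, d i, y i)) h) (hreg : MomRegular x) :
    ivCoef n z d y zl zh h = ![momIcpt x, momSlope x] := by
  have hdet := ivCross_det_ne_zero hd hy hn h0 h1 hx hreg
  have := Matrix.invertibleOfIsUnitDet (ivCross n z d zl zh h) (isUnit_iff_ne_zero.2 hdet)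
  refine Matrix.inv_mulVec_eq_vec ?_
  rw [ivRhs_eq hd hy hn h0 h1 hx, ivCross_eq hd hy hn h0 h1 hx]
  have r0 := hreg.momResid_eq_zero false
  have r1 := hreg.momResid_eq_zero true
  unfold momResid at r0 r1
  ext a
  fin_cases a
  · simp [Matrix.mulVec, dotProduct, Fin.sum_univ_two]
    linear_combination (n * h : ℝ) * r0 + (n * h : ℝ) * r1
  · simp [Matrix.mulVec, dotProduct, Fin.sum_univ_two]
    linear_combination (n * h : ℝ) * r1

theorem sum_ivResid_sq (hd : ∀ i, d i = 0 ∨ d i = 1) (hy : ∀ i, |y i| ≤ B) (hn : 0 < n)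
    (h0 : 0 < h) (h1 : h < (zh - zl) / 2) {x : Moments}
    (hx : x = sampMom B zl zh n (fun i => (z i, d i, y i)) h) (hreg : MomRegular x) (s : Bool) :
    ∑ i ∈ obsIn n z (nearIcc zl zh s h), ivResid n z d y zl zh h i ^ 2 =
      n * h * momSq (momIcpt x) (momSlope x) (x s) := by
  have e : ∀ i, ivResid n z d y zl zh h i ^ 2 =
      ∑ j, ![momIcpt x ^ 2, momSlope x ^ 2 + 2 * momIcpt x * momSlope x, -(2 * momIcpt x),
        -(2 * momSlope x), 1] j * mom B j (d i, y i) := fun i => by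
    rw [← momSq_eq_sum (momIcpt x) (momSlope x) fun j => mom B j (d i, y i),
      momSq_mom (p := (d i, y i)) ⟨hd i, hy i⟩, ivResid, ivCoef_eq hd hy hn h0 h1 hx hreg, ivRegr]
    simp [dotProduct, Fin.sum_univ_two]
    ring
  simp only [e]
  rw [sum_obsIn_linear hn h0, ← hx, momSq_eq_sum]

/-- In the 2 × 2 sandwich, index 1 is the slope. The explicit inverse turns this entry into the sum
of the variances of the two mean residuals over the squared first stage, times 1 / (nh); the factor
n h in `lateSigmaHat` removes the last term. -/
theorem lateSigmaHat_eq (hd : ∀ i, d i = 0 ∨ d i = 1) (hy : ∀ i, |y i| ≤ B) (hn : 0 < n)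
    (h0 : 0 < h) (h1 : h < (zh - zl) / 2) {x : Moments}
    (hx : x = sampMom B zl zh n (fun i => (z i, d i, y i)) h) (hreg : MomRegular x) :
    lateSigmaHat n z d y zl zh h = momSigma x := by
  have hn' : (n : ℝ) ≠ 0 := by exact_mod_cast hn.ne'
  have a0 := (hreg.1 false).ne'
  have a1 := (hreg.1 true).ne'
  have hD := hreg.2.1
  set E : Bool → ℝ := fun s => n * h * momSq (momIcpt x) (momSlope x) (x s) with hE
  have hS : ∑ i ∈ ivSample n z zl zh h, ivResid n z d y zl zh h i ^ 2 •
      Matrix.vecMulVec (ivInstr zh h (z i)) (ivInstr zh h (z i)) =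
      !![E false + E true, E true; E true, E true] := by
    have e : ∀ s a b, ∑ i ∈ obsIn n z (nearIcc zl zh s h), (ivResid n z d y zl zh h i ^ 2 •
        Matrix.vecMulVec (ivInstr zh h (z i)) (ivInstr zh h (z i))) a b =
        E s * ((![1, if s then 1 else 0] : Fin 2 → ℝ) a *
          (![1, if s then 1 else 0] : Fin 2 → ℝ) b) := fun s a b => by
      rw [hE]
      simp only
      rw [← sum_ivResid_sq hd hy hn h0 h1 hx hreg, Finset.sum_mul]
      refine Finset.sum_congr rfl fun i hi => ?_
      rw [Matrix.smul_apply, Matrix.vecMulVec_apply, ivInstr_of_mem h1 hi, smul_eq_mul]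
    ext a b
    rw [Matrix.sum_apply, sum_ivSample h1, e, e]
    fin_cases a <;> fin_cases b <;> simp
  have hdet := ivCross_det hd hy hn h0 h1 hx hreg
  have hV : ivRobustVar n z d y zl zh h 1 1 = (n * h)⁻¹ * (momVar x / momDen x ^ 2) := by
    rw [ivRobustVar, hS, ← Matrix.transpose_nonsing_inv, Matrix.inv_def, hdet,
      ivCross_eq hd hy hn h0 h1 hx, Matrix.adjugate_fin_two_of, Ring.inverse_eq_inv']
    simp [Matrix.mul_apply, Fin.sum_univ_two, hE, momVar]
    field_simp
    ring
  rw [lateSigmaHat, hV, momSigma]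
  congr 1
  field_simp

/-- The kernel selects exactly the IV sample, and on each window the side, hence the weight, is
constant; what remains is linear in the sample moments. -/
theorem sum_infl_mul_uniformKernel (hn : 0 < n) (h0 : 0 < h) (h1 : h < (zh - zl) / 2)
    (hz : ∀ i, z i ∈ Set.Icc zl zh) (u : Moments) {x : Moments}
    (hx : x = sampMom B zl zh n (fun i => (z i, d i, y i)) h) :
    ∑ i ∈ Finset.range n, infl B zl zh u (z i, d i, y i) *
        uniformKernel (lateX zl zh (z i) / h) =
      n * h * (momWeight false u * momResid (momIcpt u) (momSlope u) (x false) +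
        momWeight true u * momResid (momIcpt u) (momSlope u) (x true)) := by
  have e1 : ∀ s, ∑ i ∈ obsIn n z (nearIcc zl zh s h), infl B zl zh u (z i, d i, y i) =
      momWeight s u * (n * h * momResid (momIcpt u) (momSlope u) (x s)) := fun s => by
    have e2 : ∀ i ∈ obsIn n z (nearIcc zl zh s h), infl B zl zh u (z i, d i, y i) =
        momWeight s u * ∑ j, ![-momIcpt u, -momSlope u, 1, 0, 0] j * mom B j (d i, y i) :=
      fun i hi => by
        have h2 := mem_nearIcc.1 (mem_of_mem_obsIn hi)
        rw [infl, side_eq_of_depth_lt (h2.2.trans_lt h1),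
          ← momResid_eq_sum (momIcpt u) (momSlope u) fun j => mom B j (d i, y i)]
    rw [Finset.sum_congr rfl e2, ← Finset.mul_sum, sum_obsIn_linear hn h0, ← hx, momResid_eq_sum]
  have e3 : ∑ i ∈ Finset.range n, infl B zl zh u (z i, d i, y i) *
      uniformKernel (lateX zl zh (z i) / h) =
      ∑ i ∈ ivSample n z zl zh h, infl B zl zh u (z i, d i, y i) := by
    rw [ivSample, obsIn, Finset.sum_filter]
    refine Finset.sum_congr rfl fun i _ => ?_
    rw [uniformKernel_div_eq h0, abs_lateX (hz i)]
    have hiff : z i ∈ Set.Icc zl (zl + h) ∪ Set.Icc (zh - h) zh ↔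
        depth zl zh (side zl zh (z i)) (z i) ∈ Set.Icc 0 h := by
      rw [Set.mem_union, mem_Icc_iff_depth_false, mem_Icc_iff_depth_true]
      constructor
      · rintro (h2 | h2) <;> rwa [side_eq_of_depth_lt (h2.2.trans_lt h1)]
      · intro h2
        cases hs : side zl zh (z i)
        · left; rwa [hs] at h2
        · right; rwa [hs] at h2
    by_cases hi : z i ∈ Set.Icc zl (zl + h) ∪ Set.Icc (zh - h) zh
    · rw [if_pos hi, Set.indicator_of_mem (hiff.1 hi), mul_one]
    · rw [if_neg hi, Set.indicator_of_notMem fun h2 => hi (hiff.2 h2), mul_zero]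
  rw [e3, sum_ivSample h1, e1, e1]
  ring

end Sample

/-! ### Uniform convergence of the sample moments and the linearization error -/

theorem measurableSet_nearSet (zl zh : ℝ) (s : Bool) (h : ℝ) :
    MeasurableSet (nearSet zl zh s h) :=
  ((measurable_depth zl zh s).comp measurable_fst) measurableSet_Icc

theorem monotone_nearSet (zl zh : ℝ) (s : Bool) : Monotone (nearSet zl zh s) :=
  fun _ _ hh _ hv => ⟨hv.1, hv.2.trans hh⟩

section Design

variable {Ω : Type*} [MeasurableSpace Ω] {μ : Measure Ω}
  {Z D Y : Ω → ℝ} {zl zh B δ : ℝ} {f : ℝ → ℝ} {κ : Kernel ℝ (ℝ × ℝ)}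
  [IsProbabilityMeasure μ] [IsMarkovKernel κ]

/-- Conditional means are ratios of moments over the same window, so the normalization by `h`
cancels. -/
theorem LateDesign.lateTheta_eq (M : LateDesign μ Z D Y zl zh B δ f κ) {h : ℝ} (h0 : 0 < h) :
    lateTheta μ Z D Y zl zh h = momSlope (lateMom μ Z D Y f κ B zl zh h) := by
  set u := lateMom μ Z D Y f κ B zl zh h with hu
  set A : Bool → Set Ω := fun s => {ω | depth zl zh s (Z ω) ∈ Set.Icc 0 h} with hA
  have hAm : ∀ s, MeasurableSet (A s) := fun s => M.measurable_depth s measurableSet_Icc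
  have hpre : ∀ s, Z ⁻¹' nearIcc zl zh s h = A s := fun s => by
    ext ω; exact mem_nearIcc
  have hus : ∀ s j, u s j = h⁻¹ * ∫ ω in A s, mom B j (D ω, Y ω) ∂μ := fun s j => by
    rw [hu, lateMom_of_pos μ Z D Y f κ B zl zh h0 s]
  have hsupp : ∀ᵐ ω ∂μ, ((D ω, Y ω).1 = 0 ∨ (D ω, Y ω).1 = 1) ∧ |(D ω, Y ω).2| ≤ B := by
    filter_upwards [M.binary_D, M.bounded_Y] with ω h1 h2
    exact ⟨h1, h2⟩
  have hi := inv_ne_zero h0.ne'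
  have e0 : ∀ s, u s 0 = h⁻¹ * μ.real (A s) := fun s => by rw [hus]; simp [mom]
  have e2 : ∀ s, ∫ ω, Y ω ∂(μ[|A s]) = u s 2 / u s 0 := fun s => by
    have h1 : ∫ ω in A s, mom B 2 (D ω, Y ω) ∂μ = ∫ ω in A s, Y ω ∂μ :=
      setIntegral_congr_ae (hAm s) (hsupp.mono fun ω hω _ => mom_eq_of_support hω 2)
    rw [hus, e0, h1, mul_div_mul_left _ _ hi, ProbabilityTheory.cond, integral_smul_measure, smul_eq_mul,
      ENNReal.toReal_inv, inv_mul_eq_div]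
    rfl
  have e1 : ∀ s, (μ[|A s]).real {ω | D ω = 1} = u s 1 / u s 0 := fun s => by
    have hm : MeasurableSet {ω | D ω = 1} := M.measurable_D (measurableSet_singleton 1)
    have h1 : ∫ ω in A s, mom B 1 (D ω, Y ω) ∂μ = μ.real (A s ∩ {ω | D ω = 1}) := by
      have h2 : ∫ ω in A s, mom B 1 (D ω, Y ω) ∂μ =
          ∫ ω in A s, {ω | D ω = 1}.indicator (fun _ => (1 : ℝ)) ω ∂μ := by
        refine setIntegral_congr_ae (hAm s) (hsupp.mono fun ω hω _ => ?_)
        rw [mom_eq_of_support hω]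
        rcases hω.1 with h3 | h3
        · have h3' : D ω = 0 := h3
          simp [h3']
        · have h3' : D ω = 1 := h3
          simp [h3']
      rw [h2, integral_indicator hm, Measure.restrict_restrict hm]
      simp [Set.inter_comm]
    rw [hus, e0, h1, mul_div_mul_left _ _ hi, measureReal_def, cond_apply (hAm s),
      ENNReal.toReal_mul, ENNReal.toReal_inv, inv_mul_eq_div]
    rfl
  have h3 : lateTheta μ Z D Y zl zh h =
      ((∫ ω, Y ω ∂(μ[|Z ⁻¹' nearIcc zl zh false h])) -
        ∫ ω, Y ω ∂(μ[|Z ⁻¹' nearIcc zl zh true h])) /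
      ((μ[|Z ⁻¹' nearIcc zl zh false h]).real {ω | D ω = 1} -
        (μ[|Z ⁻¹' nearIcc zl zh true h]).real {ω | D ω = 1}) := rfl
  rw [h3, hpre, hpre, e1, e1, e2, e2, momSlope, momDen]

end Design

theorem sampMom_sub_lateMom {Ω : Type*} [MeasurableSpace Ω] {μ : Measure Ω}
    {Z D Y : ℕ → Ω → ℝ} {zl zh B : ℝ} {f : ℝ → ℝ} {κ : Kernel ℝ (ℝ × ℝ)}
    (hZ : Measurable (Z 0)) {n : ℕ} (hn : 0 < n) {h : ℝ} (h0 : 0 < h) (s : Bool) (j : Fin 5)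
    (ω : Ω) :
    sampMom B zl zh n (fun i => (Z i ω, D i ω, Y i ω)) h s j -
        lateMom μ (Z 0) (D 0) (Y 0) f κ B zl zh h s j =
      (n * h)⁻¹ * devSum μ (fun i ω => (Z i ω, D i ω, Y i ω))
        ((nearSet zl zh s h).indicator fun w => mom B j w.2) n ω := by
  have hn' : (n : ℝ) ≠ 0 := by exact_mod_cast hn.ne'
  have hm : MeasurableSet {ω | depth zl zh s (Z 0 ω) ∈ Set.Icc 0 h} :=
    ((measurable_depth zl zh s).comp hZ) measurableSet_Icc
  have h1 : ∫ ω, (nearSet zl zh s h).indicator (fun w => mom B j w.2) (Z 0 ω, D 0 ω, Y 0 ω) ∂μ =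
      ∫ ω in {ω | depth zl zh s (Z 0 ω) ∈ Set.Icc 0 h}, mom B j (D 0 ω, Y 0 ω) ∂μ := by
    rw [← integral_indicator hm]
    rfl
  rw [lateMom_of_pos μ (Z 0) (D 0) (Y 0) f κ B zl zh h0 s, devSum, h1, sampMom]
  field_simp

/-- Uniformly over the bandwidths, the sample moments converge at a rate slightly faster than
`(n h) ^ (-1/4)`. -/
theorem tendsto_measure_sampMom {Ω : Type*} [MeasurableSpace Ω] {μ : Measure Ω}
    [IsProbabilityMeasure μ] {Z D Y : ℕ → Ω → ℝ}
    (hV : ∀ i, Measurable fun ω => (Z i ω, D i ω, Y i ω))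
    (hindep : iIndepFun (fun i ω => (Z i ω, D i ω, Y i ω)) μ)
    (hident : ∀ i, IdentDistrib (fun ω => (Z i ω, D i ω, Y i ω))
      (fun ω => (Z 0 ω, D 0 ω, Y 0 ω)) μ μ)
    {zl zh B δ : ℝ} {f : ℝ → ℝ} {κ : Kernel ℝ (ℝ × ℝ)} [IsMarkovKernel κ]
    (M : LateDesign μ (Z 0) (D 0) (Y 0) zl zh B δ f κ) {t₀ L : ℝ} (ht : t₀ < δ) (hL0 : 0 ≤ L)
    (hL : ∀ t ∈ Set.Icc 0 t₀, ∀ s j, |densMom f κ B zl zh t s j| ≤ L)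
    {hlo hhi lam : ℕ → ℝ} (hh : ∀ n, 0 < hlo n ∧ hlo n ≤ hhi n ∧ 16 * hhi n ≤ t₀)
    (hlam : ∀ n, 1 ≤ lam n) (hlim : Tendsto (fun n : ℕ => √√(n * hlo n) / lam n ^ 3) atTop atTop)
    {e : ℝ} (he : 0 < e) :
    Tendsto (fun n : ℕ => μ {ω | ∃ h ∈ Set.Icc (hlo n) (hhi n), e / (lam n * √√(n * h)) <
      ‖sampMom B zl zh n (fun i => (Z i ω, D i ω, Y i ω)) h -
        lateMom μ (Z 0) (D 0) (Y 0) f κ B zl zh h‖}) atTop (𝓝 0) := by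
  set V : ℕ → Ω → ℝ × ℝ × ℝ := fun i ω => (Z i ω, D i ω, Y i ω) with hVdef
  have key : ∀ s j, Tendsto (fun n : ℕ => μ {ω | ∃ h ∈ Set.Icc (hlo n) (hhi n),
      e / lam n * √√(n * h) ^ 3 <
        |devSum μ V ((nearSet zl zh s h).indicator fun w => mom B j w.2) n ω|}) atTop (𝓝 0) :=
    fun s j => tendsto_measure_exists_lt_abs_devSum hV hindep hident
      ((measurable_mom B j).comp measurable_snd) (C := (1 + B) ^ 2)
      (fun w => abs_mom_le M.nonneg_B j w.2) (measurableSet_nearSet zl zh s)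
      (monotone_nearSet zl zh s) hL0
      (fun h h0 h1 => M.measureReal_depth_le ht hL s h0 h1)
      (fun h h' h0 h1 h2 => M.measureReal_depth_sub_le ht hL s h0 h1 h2) hh hlam hlim he
  -- If the norm is large, one of the ten coordinates is large; a union bound finishes.
  have hsum := tendsto_finsetSum (Finset.univ : Finset (Bool × Fin 5)) fun p _ => key p.1 p.2
  rw [Finset.sum_const_zero] at hsum
  refine tendsto_of_tendsto_of_tendsto_of_le_of_le' tendsto_const_nhds hsum
    (Eventually.of_forall fun _ => zero_le) ?_
  filter_upwards [eventually_gt_atTop 0] with n hn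
  have hn' : (0 : ℝ) < n := by exact_mod_cast hn
  refine (measure_mono ?_).trans (measure_biUnion_finset_le _ _)
  rintro ω ⟨h, hmem, hω⟩
  by_contra hnot
  simp only [Set.mem_iUnion, Finset.mem_univ, exists_true_left, Set.mem_ofPred_eq, not_exists,
    not_and, not_lt] at hnot
  refine absurd hω (not_lt.2 ?_)
  have h0 : 0 < h := (hh n).1.trans_le hmem.1
  have hl : 0 < lam n := by linarith [hlam n]
  have hr : 0 < √√(n * h) := by positivity
  have hr4 : √√(n * h) ^ 4 = n * h := sqrt_sqrt_pow_four (by positivity)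
  have hc : 0 ≤ e / (lam n * √√(n * h)) := by positivity
  refine (pi_norm_le_iff_of_nonneg hc).2 fun s => (pi_norm_le_iff_of_nonneg hc).2 fun j => ?_
  show ‖sampMom B zl zh n (fun i => (Z i ω, D i ω, Y i ω)) h s j -
    lateMom μ (Z 0) (D 0) (Y 0) f κ B zl zh h s j‖ ≤ _
  rw [sampMom_sub_lateMom M.measurable_Z hn h0, Real.norm_eq_abs, abs_mul,
    abs_of_pos (by positivity : 0 < ((n : ℝ) * h)⁻¹), inv_mul_le_iff₀ (by positivity)]
  refine (hnot (s, j) h hmem).trans (le_of_eq ?_)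
  -- Dividing the (nh)^(3/4) bound for the centred sum by nh leaves (nh)^(-1/4).
  nth_rewrite 2 [← hr4]
  field_simp

/-- The class of influence functions at moment vectors in a ball has polynomial uniform covering
numbers. -/
theorem polynomialUniformCovering_infl {B zl zh ρ C : ℝ} (hB : 0 ≤ B) (hρ : 0 < ρ) (hC : 0 ≤ C)
    {x₀ : Moments}
    (hball : ∀ y ∈ Metric.ball x₀ ρ, MomRegular y ∧
      (∀ s, |momWeight s y| ≤ C) ∧ |momIcpt y| ≤ C ∧ |momSlope y| ≤ C ∧
      ∀ z ∈ Metric.ball x₀ ρ, (∀ s, |momWeight s y - momWeight s z| ≤ C * ‖y - z‖) ∧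
        |momIcpt y - momIcpt z| ≤ C * ‖y - z‖ ∧ |momSlope y - momSlope z| ≤ C * ‖y - z‖)
    (A : Set ℝ) (u : ℝ → Moments) (hu : ∀ h ∈ A, u h ∈ Metric.ball x₀ ρ) :
    PolynomialUniformCovering
      {g : ℝ × ℝ × ℝ → ℝ | ∃ h ∈ A, g = fun w => infl B zl zh (u h) w} := by
  set K := C * (1 + 4 * C) * (1 + B) ^ 2 with hK
  have hK0 : 0 ≤ K := by positivity
  refine polynomialUniformCovering_of_param (ι := Bool × Fin 5) A
    (fun h w => infl B zl zh (u h) w) (fun h _ => measurable_infl B zl zh (u h))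
    (R := ‖x₀‖ + ρ) (M := 1 + K) (by positivity) (by linarith) 1 one_ne_zero fun Q hQ =>
    ⟨fun h p => u h p.1 p.2, fun h hh p => ?_, fun a ha b hb ε hε _ hab => ?_⟩
  · have h1 : ‖u h‖ ≤ ‖x₀‖ + ρ := by
      have h2 := norm_le_norm_add_norm_sub x₀ (u h)
      have h3 : ‖x₀ - u h‖ < ρ := by
        rw [norm_sub_rev, ← dist_eq_norm]; exact hu h hh
      linarith
    exact ((norm_le_pi_norm (u h p.1) p.2).trans (norm_le_pi_norm (u h) p.1)).trans h1
  · have hn : ‖u a - u b‖ ≤ ε / (1 + K) := by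
      have hc : 0 ≤ ε / (1 + K) := by positivity
      refine (pi_norm_le_iff_of_nonneg hc).2 fun s => (pi_norm_le_iff_of_nonneg hc).2 fun j => ?_
      simpa using hab (s, j)
    refine eLpNorm_two_le_ofReal_of_abs_le fun w => ?_
    have h1 := hball _ (hu a ha)
    have h2 := h1.2.2.2.2 _ (hu b hb)
    have h3 := abs_infl_sub_le (zl := zl) (zh := zh) hB hC (norm_nonneg (u a - u b))
      (hball _ (hu b hb)).2.1 h1.2.2.1 h1.2.2.2.1 h2.1 h2.2.1 h2.2.2 w
    refine h3.trans ?_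
    calc K * ‖u a - u b‖ ≤ (1 + K) * (ε / (1 + K)) :=
          mul_le_mul (by linarith) hn (norm_nonneg _) (by positivity)
      _ = ε := by field_simp

/-- As `hi ≤ 1`, the ratio is at most `lo⁻¹`. This replaces the normalization, which involves both
bandwidths, by a function of the lower one. -/
theorem loglog_ratio_le {lo hi : ℝ} (hlo : 0 < lo) (hle : lo ≤ hi) (hhi : hi ≤ 1)
    (h1 : 1 ≤ Real.log (Real.log lo⁻¹)) :
    max 1 (Real.log (Real.log (hi / lo))) ≤ Real.log (Real.log lo⁻¹) := by
  refine max_le h1 ?_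
  have h2 : 0 ≤ Real.log (hi / lo) := Real.log_nonneg ((one_le_div hlo).2 hle)
  rcases h2.eq_or_lt with h3 | h3
  -- The case `hi = lo`: the inner logarithm is 0, and the outer one takes its default value 0.
  · rw [← h3, Real.log_zero]; linarith
  · refine Real.log_le_log h3 (Real.log_le_log (div_pos (hlo.trans_le hle) hlo) ?_)
    rw [div_eq_mul_inv]
    exact mul_le_of_le_one_left (inv_pos.2 hlo).le hhi

/-- The linearization error, when the sample moments are close to the population moments. -/
theorem abs_linearization_error_le {B zl zh ρ C h e lam : ℝ} (hC : 0 ≤ C) {x₀ u : Moments}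
    (hball : ∀ y ∈ Metric.ball x₀ ρ, MomRegular y ∧
      (∀ s, |momWeight s y| ≤ C) ∧ |momIcpt y| ≤ C ∧ |momSlope y| ≤ C ∧
      ∀ z ∈ Metric.ball x₀ ρ, (∀ s, |momWeight s y - momWeight s z| ≤ C * ‖y - z‖) ∧
        |momIcpt y - momIcpt z| ≤ C * ‖y - z‖ ∧ |momSlope y - momSlope z| ≤ C * ‖y - z‖)
    {n : ℕ} {z d y : ℕ → ℝ} (hz : ∀ i, z i ∈ Set.Icc zl zh) (hd : ∀ i, d i = 0 ∨ d i = 1)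
    (hy : ∀ i, |y i| ≤ B) (h0 : 0 < h) (h1 : h < (zh - zl) / 2) (hnh : 1 ≤ n * h)
    (hlam : 1 ≤ lam) (he : e < ρ / 2) (he0 : 0 ≤ e) (hu : u ∈ Metric.ball x₀ (ρ / 2))
    (hx : ‖sampMom B zl zh n (fun i => (z i, d i, y i)) h - u‖ ≤ e / (lam * √√(n * h))) :
    |√(n * h) * (lateEst n z d y zl zh h - momSlope u) / lateSigmaHat n z d y zl zh h -
      (√(n * h))⁻¹ * ∑ i ∈ Finset.range n, infl B zl zh u (z i, d i, y i) *
        uniformKernel (lateX zl zh (z i) / h)| ≤ 2 * C * (1 + 2 * C) * (e ^ 2 / lam ^ 2) := by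
  set x := sampMom B zl zh n (fun i => (z i, d i, y i)) h with hxd
  have hn : 0 < n := by
    rcases Nat.eq_zero_or_pos n with h2 | h2
    · subst h2; norm_num at hnh
    · exact h2
  have hr : 1 ≤ √√(n * h) := Real.one_le_sqrt.2 (Real.one_le_sqrt.2 hnh)
  have hr0 : 0 < √√(n * h) := by linarith
  have hsq : √(n * h) = √√(n * h) ^ 2 := (Real.sq_sqrt (Real.sqrt_nonneg _)).symm
  have hs0 : 0 < √(n * h) := Real.sqrt_pos.2 (by linarith)
  have hle : e / (lam * √√(n * h)) ≤ e :=
    div_le_self he0 (one_le_mul_of_one_le_of_one_le hlam hr)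
  have hxb : x ∈ Metric.ball x₀ ρ := by
    rw [Metric.mem_ball] at hu ⊢
    have h2 := dist_triangle x u x₀
    rw [dist_eq_norm x u] at h2
    linarith
  have hub : u ∈ Metric.ball x₀ ρ := Metric.ball_subset_ball (by linarith) hu
  have hX := hball x hxb
  have hU := hball u hub
  have hlin := momSlope_linearization hC (Real.sqrt_nonneg (n * h)) hX.1 hU.1 hU.2.2.1 hU.2.2.2.1
    (hX.2.2.2.2 u hub).1
  rw [lateEst_eq hd hy hn h0, lateSigmaHat_eq hd hy hn h0 h1 hxd hX.1,
    sum_infl_mul_uniformKernel hn h0 h1 hz u hxd, ← hxd, mul_div_assoc]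
  have e1 : ∀ a : ℝ, (√(n * h))⁻¹ * (n * h * a) = √(n * h) * a := fun a => by
    have h3 : (n : ℝ) * h = √(n * h) * √(n * h) := (Real.mul_self_sqrt (by linarith)).symm
    nth_rewrite 2 [h3]
    field_simp
  rw [e1]
  refine hlin.trans (mul_le_mul_of_nonneg_left ?_ (by positivity))
  calc √(n * h) * ‖x - u‖ ^ 2 ≤ √(n * h) * (e / (lam * √√(n * h))) ^ 2 :=
        mul_le_mul_of_nonneg_left (pow_le_pow_left₀ (norm_nonneg _) hx 2) hs0.le
    _ = e ^ 2 / lam ^ 2 := by nth_rewrite 1 [hsq]; field_simp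

end BandwidthSnooping

/-! ### Choice of the bandwidth range and of the rate; proof of the theorem -/

open BandwidthSnooping
theorem mainTheorem6
    {Ω : Type*} [MeasurableSpace Ω] (μ : Measure Ω) [IsProbabilityMeasure μ]
    -- the i.i.d. sample `(Z i, D i, Y i)`
    (Z D Y : ℕ → Ω → ℝ)
    (hZm : ∀ i, Measurable (Z i)) (hDm : ∀ i, Measurable (D i)) (hYm : ∀ i, Measurable (Y i))
    (hindep : iIndepFun (fun i ω => (Z i ω, D i ω, Y i ω)) μ)
    (hident : ∀ i, IdentDistrib (fun ω => (Z i ω, D i ω, Y i ω))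
      (fun ω => (Z 0 ω, D 0 ω, Y 0 ω)) μ μ)
    -- `Z` takes values in `[zl, zh]`, `D` is a zero-one variable, `Y` is bounded
    (zl zh : ℝ) (hz : zl < zh) (hZ : ∀ᵐ ω ∂μ, Z 0 ω ∈ Set.Icc zl zh)
    (hD : ∀ᵐ ω ∂μ, D 0 ω = 0 ∨ D 0 ω = 1)
    (B : ℝ) (hY : ∀ᵐ ω ∂μ, |Y 0 ω| ≤ B)
    -- near the endpoints `Z` has a density `f`, positive at the endpoints
    (δ : ℝ) (hδ : 0 < δ) (f : ℝ → ℝ) (hfm : Measurable f) (hf0 : ∀ z, 0 ≤ f z)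
    (hf : (μ.map (Z 0)).restrict (Set.Iio (zl + δ) ∪ Set.Ioi (zh - δ)) =
      (volume.restrict (Set.Iio (zl + δ) ∪ Set.Ioi (zh - δ))).withDensity
        (fun z => ENNReal.ofReal (f z)))
    (hfl : 0 < f zl) (hfh : 0 < f zh)
    -- `κ z` is (a version of) the conditional law of `(D, Y)` given `Z = z`
    (κ : Kernel ℝ (ℝ × ℝ)) [IsMarkovKernel κ]
    (hκ : HasCondDistrib (fun ω => (D 0 ω, Y 0 ω)) (Z 0) κ μ)
    (hκB : ∀ z, ∀ᵐ p ∂(κ z), (p.1 = 0 ∨ p.1 = 1) ∧ |p.2| ≤ B)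
    -- continuity at the endpoints of the density, of the conditional means and of the entries
    -- of the conditional variance matrix
    (ℓ : ℝ → ℝ) (hℓ : LogLogModulus ℓ)
    (hcf : ContAtEndpoints ℓ zl zh f)
    (hcY : ContAtEndpoints ℓ zl zh (fun z => ∫ p, p.2 ∂(κ z)))
    (hcD : ContAtEndpoints ℓ zl zh (fun z => ∫ p, p.1 ∂(κ z)))
    (hcYY : ContAtEndpoints ℓ zl zh (fun z => Var[fun p => p.2; κ z]))
    (hcDD : ContAtEndpoints ℓ zl zh (fun z => Var[fun p => p.1; κ z]))
    (hcDY : ContAtEndpoints ℓ zl zh (fun z => cov[fun p => p.1, fun p => p.2; κ z]))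
    -- nondegeneracy: `P(D=1|Z=zh) ≠ P(D=1|Z=zl)`, and `var(Y|D=d,Z=z) ≠ 0` for `d = 0` or `1`
    -- at one of the endpoints `z`
    (hrel : (κ zh).real {p | p.1 = 1} - (κ zl).real {p | p.1 = 1} ≠ 0)
    (hvar : ∃ d : ℝ, (d = 0 ∨ d = 1) ∧ ∃ z : ℝ, (z = zl ∨ z = zh) ∧
      κ z {p | p.1 = d} ≠ 0 ∧ Var[fun p => p.2; (κ z)[|{p | p.1 = d}]] ≠ 0) :
    KernelRegular uniformKernel ∧
    ∃ η : ℝ, 0 < η ∧ ∃ ψ : ℝ × ℝ × ℝ → ℝ → ℝ,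
      ∀ hlo hhi : ℕ → ℝ,
        (∀ n, 0 < hlo n ∧ hlo n ≤ hhi n ∧ hhi n ≤ η) →
        Tendsto (fun n : ℕ => n * hlo n / (Real.log (Real.log (hlo n)⁻¹)) ^ 3) atTop atTop →
        InfluenceRepresentation μ (fun i ω => lateX zl zh (Z i ω))
          (fun i ω => (Z i ω, D i ω, Y i ω))
          (fun n h ω => lateEst n (fun i => Z i ω) (fun i => D i ω) (fun i => Y i ω) zl zh h)
          (fun n h ω => lateSigmaHat n (fun i => Z i ω) (fun i => D i ω) (fun i => Y i ω) zl zh h)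
          (fun h => lateTheta μ (Z 0) (D 0) (Y 0) zl zh h)
          hlo hhi uniformKernel ψ ∧
        DgpRegular μ (fun ω => lateX zl zh (Z 0 ω)) (fun ω => (Z 0 ω, D 0 ω, Y 0 ω)) δ
          hhi uniformKernel ψ := by
  refine ⟨kernelRegular_uniformKernel, ?_⟩
  have hB : 0 ≤ B := by
    obtain ⟨ω, hω⟩ := hY.exists
    exact (abs_nonneg _).trans hω
  have M : LateDesign μ (Z 0) (D 0) (Y 0) zl zh B δ f κ :=
    ⟨hZm 0, hDm 0, hYm 0, hz, hZ, hD, hY, hB, hδ, hfm, hf0, hf, hκ, hκB⟩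
  have hVm : ∀ i, Measurable fun ω => (Z i ω, D i ω, Y i ω) := fun i =>
    (hZm i).prodMk ((hDm i).prodMk (hYm i))
  have hw := M.logLogCont_densMom hℓ hcf hcY hcD hcYY hcDY
  have hreg := M.momRegular_densMom hfl hfh hrel hvar
  set x₀ := densMom f κ B zl zh 0 with hx₀
  set u := lateMom μ (Z 0) (D 0) (Y 0) f κ B zl zh with hudef
  have hu0 : u 0 = x₀ := if_pos rfl
  have hut : Tendsto u (𝓝[>] 0) (𝓝 x₀) := hu0 ▸ (M.logLogCont_lateMom hw).tendsto
  obtain ⟨η₁, hη₁, hdgp⟩ := M.exists_dgpRegular hw hreg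
  obtain ⟨ρ, hρ, C, hC, hball⟩ := hreg.exists_ball
  obtain ⟨t₀, L, ht₀, htδ, htz, hL0, hL⟩ := M.exists_densMom_le hw
  -- The alternative t = 0 is needed because log log 0⁻¹ has the default value 0. The half radius
  -- leaves room for the sample moments in the full ball.
  obtain ⟨r, hr, hrb⟩ := exists_forall_Ico_of_eventually
    (P := fun t => u t ∈ Metric.ball x₀ (ρ / 2) ∧
      (t = 0 ∨ 1 ≤ Real.log (Real.log t⁻¹)))
    ((hut.eventually (Metric.ball_mem_nhds x₀ (half_pos hρ))).and
      ((tendsto_loglog_inv.eventually_ge_atTop 1).mono fun _ h => Or.inr h))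
    ⟨by rw [hu0]; exact Metric.mem_ball_self (half_pos hρ), Or.inl rfl⟩
  -- The four bounds serve, in order, the regularity of the design, the overshoot of the grid by a
  -- factor 16, membership in the ball with log log h⁻¹ ≥ 1, and the comparison of hhi / hlo with 1
  -- / hlo.
  set η := min (min η₁ (t₀ / 16)) (min (r / 2) 1) with hηdef
  have hη : 0 < η := by positivity
  have hη1 : η ≤ η₁ := (min_le_left _ _).trans (min_le_left _ _)
  have hη2 : η ≤ t₀ / 16 := (min_le_left _ _).trans (min_le_right _ _)
  have hη3 : η ≤ r / 2 := (min_le_right _ _).trans (min_le_left _ _)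
  have hη4 : η ≤ 1 := (min_le_right _ _).trans (min_le_right _ _)
  have hsmall : ∀ h, 0 < h → h ≤ η → u h ∈ Metric.ball x₀ (ρ / 2) ∧ h < (zh - zl) / 2 ∧
      1 ≤ Real.log (Real.log h⁻¹) := fun h h0 h1 => by
    have h2 := hrb h ⟨h0.le, by linarith⟩
    exact ⟨h2.1, by linarith, h2.2.resolve_left h0.ne'⟩
  have hsub : Metric.ball x₀ (ρ / 2) ⊆ Metric.ball x₀ ρ := Metric.ball_subset_ball (by linarith)
  refine ⟨η, hη, fun v h => infl B zl zh (u h) v, fun hlo hhi hh hlim => ⟨⟨?_, ?_, ?_, ?_⟩,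
    hdgp hhi fun n => (hh n).2.2.trans hη1⟩⟩
  · rintro h ⟨h0, n, hn⟩
    have h1 := hsmall h h0 (hn.trans (hh n).2.2)
    have h2 := (hball _ (hsub h1.1)).1
    exact ⟨M.integral_infl h0 h1.2.1 h2, M.variance_infl h0 h1.2.1 h2⟩
  · intro ε hε
    -- The fourth root of log log: the remainder is quadratic, so it gains lam⁻², the inverse of the
    -- square root that multiplies it. The bandwidth condition is then the fourth power of (n
    -- hlo)^(1/4) / lam³ → ∞.
    set lam : ℕ → ℝ := fun n => √√(Real.log (Real.log (hlo n)⁻¹)) with hlam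
    have hLL : ∀ n, 1 ≤ Real.log (Real.log (hlo n)⁻¹) := fun n =>
      (hsmall _ (hh n).1 ((hh n).2.1.trans (hh n).2.2)).2.2
    have hlam1 : ∀ n, 1 ≤ lam n := fun n =>
      Real.one_le_sqrt.2 (Real.one_le_sqrt.2 (hLL n))
    have hlim' : Tendsto (fun n : ℕ => √√(n * hlo n) / lam n ^ 3) atTop atTop := by
      refine (Real.tendsto_sqrt_atTop.comp (Real.tendsto_sqrt_atTop.comp hlim)).congr fun n => ?_
      have h1 := hLL n
      simp only [Function.comp_apply, hlam]
      rw [Real.sqrt_div' _ (by positivity), Real.sqrt_div' _ (by positivity)]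
      congr 1
      rw [eq_comm, ← Real.sqrt_sq (show 0 ≤ √√(Real.log (Real.log (hlo n)⁻¹)) ^ 3 by positivity),
        ← pow_mul, mul_comm 3 2, pow_mul, Real.sq_sqrt (Real.sqrt_nonneg _)]
      congr 1
      rw [← Real.sqrt_sq (show 0 ≤ √(Real.log (Real.log (hlo n)⁻¹)) ^ 3 by positivity),
        ← pow_mul, mul_comm 3 2, pow_mul, Real.sq_sqrt (by linarith)]
    set G := 2 * C * (1 + 2 * C) with hG
    have hG0 : 0 ≤ G := by positivity
    -- `e < ρ / 2` keeps the sample moments in the ball; `e ≤ 1` and `e ≤ ε / (1 + G)` give G e² ≤ G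
    -- e ≤ ε.
    obtain ⟨e, he, heρ, heG⟩ : ∃ e, 0 < e ∧ e < ρ / 2 ∧ G * e ^ 2 ≤ ε := by
      refine ⟨min (ρ / 4) (min 1 (ε / (1 + G))), by positivity,
        (min_le_left _ _).trans_lt (by linarith), ?_⟩
      set e := min (ρ / 4) (min 1 (ε / (1 + G))) with hedef
      have he0 : 0 < e := by positivity
      have h1 : e ≤ 1 := (min_le_right _ _).trans (min_le_left _ _)
      have h2 : e ≤ ε / (1 + G) := (min_le_right _ _).trans (min_le_right _ _)
      rw [le_div_iff₀ (by positivity)] at h2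
      nlinarith [mul_le_mul_of_nonneg_left h1 (mul_nonneg hG0 he0.le)]
    -- The support conditions are assumed for the first observation and pass to all others by
    -- equality of laws; outside one null set they hold for every `i`, so the algebraic identities
    -- apply.
    have hgood : ∀ᵐ ω ∂μ, ∀ i, Z i ω ∈ Set.Icc zl zh ∧ (D i ω = 0 ∨ D i ω = 1) ∧ |Y i ω| ≤ B := by
      refine ae_all_iff.2 fun i => ?_
      have hS : MeasurableSet {v : ℝ × ℝ × ℝ |
          v.1 ∈ Set.Icc zl zh ∧ (v.2.1 = 0 ∨ v.2.1 = 1) ∧ |v.2.2| ≤ B} := by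
        refine (measurable_fst measurableSet_Icc).inter (MeasurableSet.inter ?_ ?_)
        · exact (measurable_snd.fst (measurableSet_singleton 0)).union
            (measurable_snd.fst (measurableSet_singleton 1))
        · exact measurableSet_le (measurable_snd.snd.abs) measurable_const
      refine (hident i).symm.ae_snd hS ?_
      filter_upwards [hZ, hD, hY] with ω a b c
      exact ⟨a, b, c⟩
    have hmax := tendsto_measure_sampMom hVm hindep hident M htδ hL0 hL
      (fun n => ⟨(hh n).1, (hh n).2.1, by linarith [(hh n).2.2]⟩) hlam1 hlim' he
    refine tendsto_of_tendsto_of_tendsto_of_le_of_le' tendsto_const_nhds hmax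
      (Eventually.of_forall fun _ => zero_le) ?_
    filter_upwards [hlim'.eventually_ge_atTop 1] with n hn
    have hnlo : 1 ≤ n * hlo n := by
      have h1 : 1 ≤ √√(n * hlo n) := hn.trans
        (div_le_self (Real.sqrt_nonneg _) (one_le_pow₀ (hlam1 n)))
      exact Real.one_le_sqrt.1 (Real.one_le_sqrt.1 h1)
    refine measure_mono_ae ?_
    filter_upwards [hgood] with ω hω
    rintro ⟨h, hmem, hbad⟩
    -- By contraposition: at a bandwidth where the sample moments are close, the linearization error
    -- is too small for the bad event.
    refine ⟨h, hmem, ?_⟩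
    by_contra hclose
    refine absurd hbad (not_lt.2 ?_)
    have h0 : 0 < h := (hh n).1.trans_le hmem.1
    have h1 := hsmall h h0 (hmem.2.trans (hh n).2.2)
    have hnh : 1 ≤ n * h := hnlo.trans (mul_le_mul_of_nonneg_left hmem.1 (Nat.cast_nonneg n))
    have hlin := abs_linearization_error_le hC hball (fun i => (hω i).1) (fun i => (hω i).2.1)
      (fun i => (hω i).2.2) h0 h1.2.1 hnh (hlam1 n) heρ he.le h1.1 (not_lt.1 hclose)
    rw [← M.lateTheta_eq h0] at hlin
    have hsq : √(max 1 (Real.log (Real.log (hhi n / hlo n)))) ≤ lam n ^ 2 := by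
      rw [hlam, Real.sq_sqrt (Real.sqrt_nonneg _)]
      exact Real.sqrt_le_sqrt (loglog_ratio_le (hh n).1 (hh n).2.1 ((hh n).2.2.trans hη4) (hLL n))
    have hl0 : 0 < lam n := by linarith [hlam1 n]
    refine (mul_le_mul hsq hlin (abs_nonneg _) (by positivity)).trans ?_
    calc lam n ^ 2 * (2 * C * (1 + 2 * C) * (e ^ 2 / lam n ^ 2)) = G * e ^ 2 := by
          rw [hG]; field_simp
      _ ≤ ε := heG
  · refine polynomialUniformCovering_infl hB hρ hC hball (insert 0 (bandwidths hhi)) u ?_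
    rintro h (rfl | ⟨h0, n, hn⟩)
    · rw [hu0]; exact Metric.mem_ball_self hρ
    · exact hsub (hsmall h h0 (hn.trans (hh n).2.2)).1
  · exact polynomialUniformCovering_uniformKernel (bandwidths hhi) fun h hh => hh.1
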